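/- Let $R$ be an associative ring with identity, not necessarily commutative, and let $R^\circ$ be its opposite ring. An $R$-complex is a complex, not necessarily bounded, of left $R$-modules; right $R$-modules are $R^\circ$-modules. For a complex $M$ with homological grading $(M_i)_{i\in\mathbb{Z}}$ set $M^i=M_{-i}$. Write $F\simeq M$ for isomorphism in the derived category, and for $g\in\mathbb{Z}$ let $M_{\geqslant g}$ be the quotient complex of $M$ with $(M_{\geqslant g})_i=M_i$ for $i\geqslant g$ and $0$ for $i<g$. All infima below are taken in $\mathbb{Z}\cup\{\pm\infty\}$, with $\inf\varnothing=\infty$. Definitions. $\bullet$ An $R$-complex $F$ is semi-flat if each module $F_i$ is flat and the functor $-\otimes_R F$ preserves quasi-isomorphisms. The flat dimension $\operatorname{fd}_R M$ is the infimum of the integers $n$ for which there is a semi-flat complex $F\simeq M$ with $F_i=0$ for all $i>n$. $\bullet$ A complex $T$ of flat $R$-modules is totally acyclic if it is acyclic and $J\otimes_R T$ is acyclic for every injective $R^\circ$-module $J$. The Gorenstein flat dimension $\operatorname{Gfd}_R M$ is the infimum of the integers $g$ for which there are a totally acyclic complex $T$ of flat $R$-modules and a semi-flat complex $F\simeq M$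 with $T_{\geqslant g}\cong F_{\geqslant g}$. $\bullet$ A complex $I$ is semi-injective if each module $I^i$ is injective and the functor $\operatorname{Hom}(-,I)$ preserves quasi-isomorphisms. A complex $U$ of injective modules is totally acyclic if it is acyclic and $\operatorname{Hom}(J,U)$ is acyclic for every injective module $J$. The Gorenstein injective dimension $\operatorname{Gid} N$ of a complex $N$ is the infimum of the integers $g$ for which there are morphisms of complexes $N\xrightarrow{\iota}I\xrightarrow{\upsilon}U$, where $I$ is semi-injective, $\iota$ is a quasi-isomorphism, $U$ is a totally acyclic complex of injective modules, and $\upsilon^i\colon I^i\to U^i$ is bijective for all $i\geqslant g$. $\bullet$ The ring $R$ is right coherent if every finitely generated right ideal of $R$ is finitely presented. Theorem. For every $R$-complex $M$ the following assertions hold. (a) One has $\operatorname{Gfd}_R M\leqslant\operatorname{fd}_R M$, and equality holds if $\operatorname{fd}_R M<\infty$. (b) One has $\operatorname{Gid}_{R^\circ}\operatorname{Hom}_{\mathbb{Z}}(M,\mathbb{Q}/\mathbb{Z})\leqslant\operatorname{Gfd}_R M$, and equality holds if $R$ is right coherent. -/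

import Mathlib

open CategoryTheory
open scoped TensorProduct

universe u

namespace GorensteinDim

/-! ## Tensor products over a non-commutative ring

Left `R`-modules are objects of `ModuleCat R`; right `R`-modules are modules over the opposite
ring, that is, objects of `ModuleCat Rᵐᵒᵖ`, where `x r` is `MulOpposite.op r • x`. -/

section Tensor

variable (R : Type u) [Ring R]

/-- The subgroup of `X ⊗[ℤ] Y` generated by the elements `x r ⊗ y - x ⊗ r y`. -/
def balancedRel (X Y : Type u) [AddCommGroup X] [Module Rᵐᵒᵖ X] [AddCommGroup Y] [Module R Y] :
    AddSubgroup (X ⊗[ℤ] Y) :=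
  AddSubgroup.closure {t | ∃ (x : X) (r : R) (y : Y),
    t = (MulOpposite.op r • x) ⊗ₜ[ℤ] y - x ⊗ₜ[ℤ] (r • y)}

/-- The tensor product `X ⊗_R Y` of a right `R`-module `X` and a left `R`-module `Y`. -/
abbrev BalancedTensor (X Y : Type u) [AddCommGroup X] [Module Rᵐᵒᵖ X] [AddCommGroup Y]
    [Module R Y] : Type u :=
  (X ⊗[ℤ] Y) ⧸ balancedRel R X Y

variable {X X' X'' Y Y' Y'' : Type u}
  [AddCommGroup X] [Module Rᵐᵒᵖ X] [AddCommGroup X'] [Module Rᵐᵒᵖ X']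
  [AddCommGroup X''] [Module Rᵐᵒᵖ X'']
  [AddCommGroup Y] [Module R Y] [AddCommGroup Y'] [Module R Y'] [AddCommGroup Y''] [Module R Y'']

/-- The element `x ⊗ y` of `X ⊗_R Y`. -/
def BalancedTensor.tmul (x : X) (y : Y) : BalancedTensor R X Y :=
  QuotientAddGroup.mk (x ⊗ₜ[ℤ] y)

/-- The homomorphism `f ⊗ g : X ⊗_R Y → X' ⊗_R Y'`. -/
def BalancedTensor.map (f : X →ₗ[Rᵐᵒᵖ] X') (g : Y →ₗ[R] Y') :
    BalancedTensor R X Y →+ BalancedTensor R X' Y' :=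
  QuotientAddGroup.map (balancedRel R X Y) (balancedRel R X' Y')
    (TensorProduct.map f.toAddMonoidHom.toIntLinearMap
      g.toAddMonoidHom.toIntLinearMap).toAddMonoidHom (by
    rw [balancedRel, AddSubgroup.closure_le]
    rintro _ ⟨x, r, y, rfl⟩
    refine AddSubgroup.subset_closure ⟨f x, r, g y, ?_⟩
    simp)

@[simp]
lemma BalancedTensor.map_tmul (f : X →ₗ[Rᵐᵒᵖ] X') (g : Y →ₗ[R] Y') (x : X) (y : Y) :
    BalancedTensor.map R f g (BalancedTensor.tmul R x y) = BalancedTensor.tmul R (f x) (g y) :=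
  rfl

lemma BalancedTensor.hom_ext {A : Type*} [AddCommGroup A] {φ ψ : BalancedTensor R X Y →+ A}
    (h : ∀ x y, φ (BalancedTensor.tmul R x y) = ψ (BalancedTensor.tmul R x y)) : φ = ψ := by
  apply QuotientAddGroup.addMonoidHom_ext
  ext t
  induction t with
  | zero => simp only [map_zero]
  | tmul x y => exact h x y
  | add a b ha hb => simp only [map_add, ha, hb]

lemma BalancedTensor.add_tmul (x x' : X) (y : Y) :
    BalancedTensor.tmul R (x + x') y = BalancedTensor.tmul R x y + BalancedTensor.tmul R x' y :=
  congrArg QuotientAddGroup.mk (TensorProduct.add_tmul x x' y)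

lemma BalancedTensor.tmul_add (x : X) (y y' : Y) :
    BalancedTensor.tmul R x (y + y') = BalancedTensor.tmul R x y + BalancedTensor.tmul R x y' :=
  congrArg QuotientAddGroup.mk (TensorProduct.tmul_add x y y')

/-- The bifunctor `(X, Y) ↦ X ⊗_R Y`, with values in abelian groups. -/
def tensorBifunctor : ModuleCat.{u} Rᵐᵒᵖ ⥤ ModuleCat.{u} R ⥤ AddCommGrpCat.{u} where
  obj X :=
    { obj := fun Y => AddCommGrpCat.of (BalancedTensor R X Y)
      map := fun g => AddCommGrpCat.ofHom (BalancedTensor.map R LinearMap.id g.hom)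
      map_id := fun Y => by
        ext1; exact BalancedTensor.hom_ext R fun _ _ => rfl
      map_comp := fun f g => by
        ext1; exact BalancedTensor.hom_ext R fun _ _ => rfl }
  map f :=
    { app := fun Y => AddCommGrpCat.ofHom (BalancedTensor.map R f.hom LinearMap.id)
      naturality := fun Y Y' g => by
        ext1; exact BalancedTensor.hom_ext R fun _ _ => rfl }
  map_id X := by
    ext Y : 3; exact BalancedTensor.hom_ext R fun _ _ => rfl
  map_comp f g := by
    ext Y : 3; exact BalancedTensor.hom_ext R fun _ _ => rfl

instance (X : ModuleCat.{u} Rᵐᵒᵖ) : ((tensorBifunctor R).obj X).Additive where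
  map_add {Y Y' f g} := by
    ext1
    exact BalancedTensor.hom_ext R fun x y => BalancedTensor.tmul_add R x (f.hom y) (g.hom y)

instance : (tensorBifunctor R).Additive where
  map_add {X X' f g} := by
    ext Y : 3
    exact BalancedTensor.hom_ext R fun x y => BalancedTensor.add_tmul R (f.hom x) (g.hom x) y

end Tensor

/-! ## Flat modules and coherence -/

/-- A left `R`-module `M` is flat if `- ⊗_R M` takes injective homomorphisms of right `R`-modules
to injective homomorphisms. -/
def IsFlat {R : Type u} [Ring R] (M : ModuleCat.{u} R) : Prop :=
  ∀ ⦃X Y : ModuleCat.{u} Rᵐᵒᵖ⦄ (f : X ⟶ Y), Function.Injective f →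
    Function.Injective (((tensorBifunctor R).map f).app M)

/-- `R` is right coherent: every finitely generated right ideal is finitely presented.
(An `Ideal Rᵐᵒᵖ` is a left ideal of `Rᵐᵒᵖ`, that is, a right ideal of `R`.) -/
def IsRightCoherent (R : Type u) [Ring R] : Prop :=
  ∀ I : Ideal Rᵐᵒᵖ, I.FG → Module.FinitePresentation Rᵐᵒᵖ I

/-! ## Complexes

An `R`-complex `M` is an unbounded complex of left `R`-modules. It is stored with cohomological
indexing, `M.X i = Mⁱ`; the homological index is the opposite one: `M_i = M⁻ⁱ = M.X (-i)`. -/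

/-- Complexes of left `R`-modules. -/
abbrev RComplex (R : Type u) [Ring R] := CochainComplex (ModuleCat.{u} R) ℤ

/-- An isomorphism `M ≃ N` in the derived category: there are quasi-isomorphisms `M ← L → N`. -/
def DerivedIso {R : Type u} [Ring R] (M N : RComplex R) : Prop :=
  ∃ (L : RComplex R) (f : L ⟶ M) (g : L ⟶ N), QuasiIso f ∧ QuasiIso g

section HomComplex

variable {S : Type u} [Ring S]

/-- For a morphism `f : A ⟶ B` and a complex `K`, the morphism `Hom(f, K) : Hom(B, K) ⟶ Hom(A, K)`
of complexes of abelian groups, given by `z ↦ f ≫ z`. -/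
def homComplexPrecomp {A B : RComplex S} (f : A ⟶ B) (K : RComplex S) :
    CochainComplex.HomComplex B K ⟶ CochainComplex.HomComplex A K where
  f i := AddCommGrpCat.ofHom
    { toFun := fun z =>
        (CochainComplex.HomComplex.Cochain.ofHom f).comp z (zero_add i)
      map_zero' := CochainComplex.HomComplex.Cochain.comp_zero _ _
      map_add' := fun z z' => CochainComplex.HomComplex.Cochain.comp_add _ z z' _ }
  comm' i j _ := by
    ext z : 2
    exact CochainComplex.HomComplex.δ_ofHom_comp f z j

/-- Semi-injective complexes: complexes of injective modules such that `Hom(-, I)` preserves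
quasi-isomorphisms. -/
structure SemiInjective (I : RComplex S) : Prop where
  injective : ∀ i, Injective (I.X i)
  hom_quasiIso : ∀ ⦃A B : RComplex S⦄ (f : A ⟶ B), QuasiIso f → QuasiIso (homComplexPrecomp f I)

/-- Totally acyclic complexes of injective modules: acyclic complexes `U` of injective modules
such that `Hom(J, U)` is acyclic for every injective module `J`. -/
structure TotallyAcyclicInjective (U : RComplex S) : Prop where
  injective : ∀ i, Injective (U.X i)
  acyclic : U.Acyclic
  hom_acyclic : ∀ J : ModuleCat.{u} S, Injective J →
    (((preadditiveCoyoneda.obj (Opposite.op J)).mapHomologicalComplex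
      (ComplexShape.up ℤ)).obj U).Acyclic

/-- The Gorenstein injective dimension of `N`, an element of `ℤ ∪ {±∞}`: the infimum of the
integers `g` for which there is a complete injective resolution `N → I → U` such that
`Iⁱ → Uⁱ` is bijective for all `i ≥ g`. -/
noncomputable def gid (N : RComplex S) : WithBot (WithTop ℤ) :=
  sInf ((fun g : ℤ => ((g : WithTop ℤ) : WithBot (WithTop ℤ))) '' {g : ℤ |
    ∃ (I U : RComplex S) (ι : N ⟶ I) (υ : I ⟶ U),
      SemiInjective I ∧ QuasiIso ι ∧ TotallyAcyclicInjective U ∧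
        ∀ i : ℤ, g ≤ i → Function.Bijective (υ.f i)})

end HomComplex

section Flat

variable {R : Type u} [Ring R]

/-- The morphism `f ⊗ F : A ⊗_R F ⟶ B ⊗_R F` of total tensor product complexes induced by a
morphism `f : A ⟶ B` of complexes of right `R`-modules. -/
noncomputable def tensorComplexMap {A B : RComplex Rᵐᵒᵖ} (f : A ⟶ B) (F : RComplex R) :
    HomologicalComplex.mapBifunctor A F (tensorBifunctor R) (ComplexShape.up ℤ) ⟶
      HomologicalComplex.mapBifunctor B F (tensorBifunctor R) (ComplexShape.up ℤ) :=
  HomologicalComplex.mapBifunctorMap f (𝟙 F) (tensorBifunctor R) (ComplexShape.up ℤ)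

/-- Semi-flat complexes: complexes of flat modules such that `- ⊗_R F` preserves
quasi-isomorphisms. -/
structure SemiFlat (F : RComplex R) : Prop where
  flat : ∀ i, IsFlat (F.X i)
  tensor_quasiIso : ∀ ⦃A B : RComplex Rᵐᵒᵖ⦄ (f : A ⟶ B),
    QuasiIso f → QuasiIso (tensorComplexMap f F)

/-- Totally acyclic complexes of flat modules: acyclic complexes `T` of flat modules such that
`J ⊗_R T` is acyclic for every injective right module `J`. -/
structure TotallyAcyclicFlat (T : RComplex R) : Prop where
  flat : ∀ i, IsFlat (T.X i)
  acyclic : T.Acyclic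
  tensor_acyclic : ∀ J : ModuleCat.{u} Rᵐᵒᵖ, Injective J →
    ((((tensorBifunctor R).obj J).mapHomologicalComplex (ComplexShape.up ℤ)).obj T).Acyclic

/-- The truncated complex `M_{≥ g}` with `(M_{≥ g})_i = M_i` for `i ≥ g` and `0` for `i < g`
(homological indices); it keeps the modules `M.X j` with `j ≤ -g`. -/
noncomputable abbrev truncGE (M : RComplex R) (g : ℤ) : RComplex R :=
  M.stupidTrunc (ComplexShape.embeddingUpIntLE (-g))

/-- The Gorenstein flat dimension of `M`, an element of `ℤ ∪ {±∞}`: the infimum of the integers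
`g` for which there are a totally acyclic complex `T` of flat modules and a semi-flat complex
`F ≃ M` such that `T_{≥ g} ≅ F_{≥ g}`. -/
noncomputable def gfd (M : RComplex R) : WithBot (WithTop ℤ) :=
  sInf ((fun g : ℤ => ((g : WithTop ℤ) : WithBot (WithTop ℤ))) '' {g : ℤ |
    ∃ T F : RComplex R, TotallyAcyclicFlat T ∧ SemiFlat F ∧ DerivedIso F M ∧
      Nonempty (truncGE T g ≅ truncGE F g)})

/-- The flat dimension of `M`, an element of `ℤ ∪ {±∞}`: the infimum of the integers `n` for
which there is a semi-flat complex `F ≃ M` with `F_i = 0` for all `i > n`. -/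
noncomputable def fd (M : RComplex R) : WithBot (WithTop ℤ) :=
  sInf ((fun n : ℤ => ((n : WithTop ℤ) : WithBot (WithTop ℤ))) '' {n : ℤ |
    ∃ F : RComplex R, SemiFlat F ∧ DerivedIso F M ∧
      ∀ i : ℤ, n < i → Subsingleton (F.X (-i))})

end Flat

/-! ## Character complexes -/

section Character

variable (R : Type u) [Ring R]

/-- The right `R`-module structure on `Hom_ℤ(X, ℚ/ℤ)` for a left `R`-module `X`:
`(φ r)(x) = φ (r x)`. -/
abbrev characterModuleRight (X : Type u) [AddCommGroup X] [Module R X] :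
    Module Rᵐᵒᵖ (CharacterModule X) where
  smul r φ := AddMonoidHom.comp (φ : X →+ AddCircle (1 : ℚ))
    (DistribSMul.toAddMonoidHom X r.unop)
  one_smul φ := CharacterModule.ext X fun x => congrArg φ (one_smul R x)
  mul_smul r s φ := CharacterModule.ext X fun x => congrArg φ (mul_smul s.unop r.unop x)
  smul_zero _ := rfl
  smul_add _ _ _ := rfl
  add_smul r s φ := CharacterModule.ext X fun x =>
    (congrArg φ (add_smul r.unop s.unop x)).trans (map_add φ _ _)
  zero_smul φ := CharacterModule.ext X fun x =>
    (congrArg φ (zero_smul R x)).trans (map_zero φ)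

variable {R}

/-- The right `R`-module `Hom_ℤ(X, ℚ/ℤ)`. -/
def characterObj (X : ModuleCat.{u} R) : ModuleCat.{u} Rᵐᵒᵖ :=
  @ModuleCat.of Rᵐᵒᵖ _ (CharacterModule X) _ (characterModuleRight R X)

/-- The homomorphism `Hom_ℤ(f, ℚ/ℤ) : φ ↦ φ ∘ f`. -/
def characterMap {X Y : ModuleCat.{u} R} (f : X ⟶ Y) : characterObj Y ⟶ characterObj X :=
  letI := characterModuleRight R X
  letI := characterModuleRight R Y
  ModuleCat.ofHom (X := CharacterModule Y) (Y := CharacterModule X)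
    { toFun := fun φ => AddMonoidHom.comp (φ : Y →+ AddCircle (1 : ℚ)) f.hom.toAddMonoidHom
      map_add' := fun _ _ => rfl
      map_smul' := fun r φ => CharacterModule.ext X fun x =>
        congrArg φ (f.hom.map_smul r.unop x).symm }

lemma characterMap_zero (X Y : ModuleCat.{u} R) : characterMap (0 : X ⟶ Y) = 0 := by
  ext φ : 2
  exact CharacterModule.ext X fun x => map_zero (show CharacterModule Y from φ)

lemma characterMap_comp {X Y Z : ModuleCat.{u} R} (f : X ⟶ Y) (g : Y ⟶ Z) :
    characterMap (f ≫ g) = characterMap g ≫ characterMap f :=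
  rfl

/-- The complex `Hom_ℤ(M, ℚ/ℤ)` of right `R`-modules, with `Hom_ℤ(M_i, ℚ/ℤ)` in cohomological
degree `i` and differential `φ ↦ φ ∘ d`. (Inserting the customary signs gives an isomorphic
complex.) -/
def characterComplex (M : RComplex R) : RComplex Rᵐᵒᵖ where
  X i := characterObj (M.X (-i))
  d i j := characterMap (M.d (-j) (-i))
  shape i j hij := by
    rw [M.shape _ _ (by simp only [ComplexShape.up_Rel] at hij ⊢; omega), characterMap_zero]
  d_comp_d' i j k _ _ := by
    rw [← characterMap_comp, M.d_comp_d, characterMap_zero]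

end Character

end GorensteinDim

/-! Write X⁺ for Hom_ℤ(X, ℚ/ℤ). Since ℚ/ℤ is an injective cogenerator, (-)⁺ preserves and reflects
exactness, and up to signs the character complex of A ⊗ F is Hom(A, F⁺). Hence F is semi-flat iff F⁺
is semi-injective (`semiFlat_iff`), and T is totally acyclic iff T⁺ is (`totallyAcyclicFlat_iff`).
Resolutions are compared after dualizing: the complexes F⁺ are K-injective, so semi-flat complexes
isomorphic in the derived category have homotopy equivalent character complexes.

(a) If F vanishes above g, the contractible complex on F_g serves as T (`exists_gfd_of_fd`).
Conversely, let F be a bounded semi-flat resolution and T_{≥g} ≅ F'_{≥g} for another one F'. The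
homotopy equivalence F⁺ ~ F'⁺ makes Hom(J, F⁺) exact above degree g for J injective or free of rank
one. As F⁺ vanishes in high degrees, descending induction splits its differentials down to degree g
(`exists_splitting`). So the cokernel of F_{g+1} → F_g is flat, and truncating F there gives a
semi-flat resolution that vanishes above g (`exists_fd_of_gfd`).

(b) Dualizing T_{≥g} ≅ F_{≥g} gives isomorphisms F⁺ → T⁺ in degrees ≥ g, which extend downwards
because Hom(J, T⁺) is exact for the injective terms J of F⁺ (`exists_gid_of_gfd`). Conversely, let R
be right coherent and M⁺ → I → U be given. Take a semi-free F ≃ M, keep it in homological degrees ≥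
g, and continue it by flat preenvelopes of successive cokernels to get T (`exists_glue`). Coherence
makes J⁺ flat for J injective and products of flat modules flat; both are organized around
`SolvesRelations`. Then Hom(J, T⁺) is exact everywhere: in degrees up to g by the preenvelope
property, above g by comparison with U. Finally T⁺ is acyclic because its identity agrees on
cohomology with a map through the acyclic complex U (`acyclic_of_homotopyEquiv`). -/

namespace GorensteinDim

/-! ### Characters of abelian groups detect exactness. -/

section CharacterExactness

variable {A B C : Type*} [AddCommGroup A] [AddCommGroup B] [AddCommGroup C]

/-- Characters of a subgroup separate points: a character vanishing on the kernel of `g`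
factors through `g`. -/
lemma exists_character_comp_eq (g : B →+ C) (χ : B →+ AddCircle (1 : ℚ))
    (h : ∀ b, g b = 0 → χ b = 0) : ∃ ψ : C →+ AddCircle (1 : ℚ), ∀ b, ψ (g b) = χ b := by
  let j : (B ⧸ g.ker) →+ C := QuotientAddGroup.kerLift g
  have hj : Function.Injective j := QuotientAddGroup.kerLift_injective g
  let χ' : (B ⧸ g.ker) →+ AddCircle (1 : ℚ) :=
    QuotientAddGroup.lift g.ker χ fun b hb => h b hb
  obtain ⟨ψ, hψ⟩ := CharacterModule.dual_surjective_of_injective j.toIntLinearMap hj χ'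
  exact ⟨ψ, fun b => DFunLike.congr_fun hψ (b : B ⧸ g.ker)⟩

lemma exists_character_ne_zero (f : A →+ B) (b : B) (hb : ∀ a, f a ≠ b) :
    ∃ χ : B →+ AddCircle (1 : ℚ), (∀ a, χ (f a) = 0) ∧ χ b ≠ 0 := by
  have : (QuotientAddGroup.mk b : B ⧸ f.range) ≠ 0 := by
    rw [Ne, QuotientAddGroup.eq_zero_iff]
    rintro ⟨a, ha⟩
    exact hb a ha
  obtain ⟨c, hc⟩ := CharacterModule.exists_character_apply_ne_zero_of_ne_zero this
  refine ⟨(c : (B ⧸ f.range) →+ AddCircle (1 : ℚ)).comp (QuotientAddGroup.mk' _), fun a => ?_, hc⟩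
  have : (QuotientAddGroup.mk' f.range) (f a) = 0 :=
    (QuotientAddGroup.eq_zero_iff _).2 ⟨a, rfl⟩
  exact (congrArg c this).trans (map_zero c)

lemma eq_zero_of_forall_character (b : B)
    (h : ∀ χ : B →+ AddCircle (1 : ℚ), χ b = 0) : b = 0 :=
  CharacterModule.eq_zero_of_character_apply (A := B) fun c => h c

/-- A sequence of abelian groups is exact at `B` if and only if its character sequence is. -/
lemma exact_iff_character_exact (f : A →+ B) (g : B →+ C) :
    (∀ b, g b = 0 ↔ ∃ a, f a = b) ↔
      ∀ χ : B →+ AddCircle (1 : ℚ), χ.comp f = 0 ↔ ∃ ψ : C →+ AddCircle (1 : ℚ), ψ.comp g = χ := by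
  constructor
  · intro h χ
    constructor
    · intro hχ
      obtain ⟨ψ, hψ⟩ := exists_character_comp_eq g χ fun b hb => by
        obtain ⟨a, rfl⟩ := (h b).1 hb
        exact DFunLike.congr_fun hχ a
      exact ⟨ψ, AddMonoidHom.ext hψ⟩
    · rintro ⟨ψ, rfl⟩
      ext a
      simp [(h (f a)).2 ⟨a, rfl⟩]
  · intro h b
    constructor
    · intro hb
      by_contra! hne
      obtain ⟨χ, h1, h2⟩ := exists_character_ne_zero f b hne
      obtain ⟨ψ, rfl⟩ := (h χ).1 (AddMonoidHom.ext h1)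
      simp [hb] at h2
    · rintro ⟨a, rfl⟩
      refine eq_zero_of_forall_character _ fun ψ => ?_
      exact DFunLike.congr_fun ((h (ψ.comp g)).2 ⟨ψ, rfl⟩) a

end CharacterExactness

/-! ### Quasi-isomorphisms and acyclicity in terms of elements. -/

section ConeExact

/-- The exactness of the mapping cone of a morphism of complexes of abelian groups in one degree,
in terms of the groups and homomorphisms involved. -/
def ConeExactData {Kj Kk Kl Li Lj Lk : Type*} [AddCommGroup Kj] [AddCommGroup Kk]
    [AddCommGroup Kl] [AddCommGroup Li] [AddCommGroup Lj] [AddCommGroup Lk]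
    (a : Kj →+ Kk) (a' : Kk →+ Kl) (b : Li →+ Lj) (b' : Lj →+ Lk) (p : Kj →+ Lj)
    (p' : Kk →+ Lk) : Prop :=
  ∀ x y, a' x = 0 → p' x = b' y → ∃ x' y', a x' = x ∧ y = p x' + b y'

/-- This is `exact_iff_character_exact` for Kj × Li → Kk × Lj → Kl × Lk. When a character of Kk × Lj
is written as (ν, -μ), the dual condition is again cone exactness, now for the transposed maps in
reversed order. -/
lemma coneExactData_iff_character {Kj Kk Kl Li Lj Lk : Type*} [AddCommGroup Kj] [AddCommGroup Kk]
    [AddCommGroup Kl] [AddCommGroup Li] [AddCommGroup Lj] [AddCommGroup Lk]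
    (a : Kj →+ Kk) (a' : Kk →+ Kl) (b : Li →+ Lj) (b' : Lj →+ Lk) (p : Kj →+ Lj)
    (p' : Kk →+ Lk) (haa : ∀ x, a' (a x) = 0) (hbb : ∀ x, b' (b x) = 0)
    (hp : ∀ x, p' (a x) = b' (p x)) :
    ConeExactData a a' b b' p p' ↔
      ∀ (μ : Lj →+ AddCircle (1 : ℚ)) (ν : Kk →+ AddCircle (1 : ℚ)),
        μ.comp b = 0 → μ.comp p = ν.comp a →
          ∃ (l : Lk →+ AddCircle (1 : ℚ)) (κ : Kl →+ AddCircle (1 : ℚ)),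
            l.comp b' = μ ∧ ν = l.comp p' + κ.comp a' := by
  let f : Kj × Li →+ Kk × Lj := (a.comp (AddMonoidHom.fst _ _)).prod
    (p.comp (AddMonoidHom.fst _ _) + b.comp (AddMonoidHom.snd _ _))
  let g : Kk × Lj →+ Kl × Lk := (a'.comp (AddMonoidHom.fst _ _)).prod
    (p'.comp (AddMonoidHom.fst _ _) - b'.comp (AddMonoidHom.snd _ _))
  have key := exact_iff_character_exact f g
  have hl : ConeExactData a a' b b' p p' ↔ (∀ t, g t = 0 ↔ ∃ s, f s = t) := by
    constructor
    · rintro h ⟨x, y⟩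
      constructor
      · intro hg
        have h1 : a' x = 0 := congrArg Prod.fst hg
        have h2 : p' x - b' y = 0 := congrArg Prod.snd hg
        obtain ⟨x', y', h3, h4⟩ := h x y h1 (sub_eq_zero.1 h2)
        exact ⟨(x', y'), Prod.ext h3 h4.symm⟩
      · rintro ⟨⟨x', y'⟩, h⟩
        have h1 : a x' = x := congrArg Prod.fst h
        have h2 : p x' + b y' = y := congrArg Prod.snd h
        refine Prod.ext ?_ ?_
        · change a' x = 0
          rw [← h1, haa]
        · change p' x - b' y = 0
          rw [← h1, ← h2, hp, map_add, hbb, add_zero, sub_self]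
    · intro h x y h1 h2
      obtain ⟨⟨x', y'⟩, h3⟩ := (h (x, y)).1 (Prod.ext h1 (sub_eq_zero.2 h2))
      exact ⟨x', y', congrArg Prod.fst h3, (congrArg Prod.snd h3).symm⟩
  rw [hl, key]
  constructor
  · intro h μ ν h1 h2
    obtain ⟨ψ, hψ⟩ := (h ((ν.comp (AddMonoidHom.fst _ _)) - μ.comp (AddMonoidHom.snd _ _))).1 (by
      ext ⟨t, u⟩
      have e1 := DFunLike.congr_fun h2 t
      have e2 := DFunLike.congr_fun h1 u
      simp only [AddMonoidHom.comp_apply, AddMonoidHom.zero_apply] at e1 e2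
      simp [f, e1, e2])
    refine ⟨ψ.comp (AddMonoidHom.inr _ _), ψ.comp (AddMonoidHom.inl _ _), ?_, ?_⟩
    · ext y
      have := DFunLike.congr_fun hψ (0, y)
      have e : g (0, y) = -(0, b' y) := by simp [g]
      rw [AddMonoidHom.comp_apply, e, map_neg] at this
      simpa using this
    · ext x
      have := DFunLike.congr_fun hψ (x, 0)
      have e : g (x, 0) = (a' x, 0) + (0, p' x) := by simp [g]
      rw [AddMonoidHom.comp_apply, e, map_add] at this
      simp at this
      simp [← this, add_comm]
  · intro h χ
    constructor
    · intro hχ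
      obtain ⟨l, κ, h1, h2⟩ := h (-χ.comp (AddMonoidHom.inr _ _)) (χ.comp (AddMonoidHom.inl _ _))
        (by
          ext y
          have := DFunLike.congr_fun hχ (0, y)
          simpa [f] using this)
        (by
          ext x
          have := DFunLike.congr_fun hχ (x, 0)
          have e : f (x, 0) = (a x, 0) + (0, p x) := by simp [f]
          rw [AddMonoidHom.comp_apply, e, map_add] at this
          exact (neg_eq_of_add_eq_zero_left this))
      refine ⟨κ.comp (AddMonoidHom.fst _ _) + l.comp (AddMonoidHom.snd _ _), ?_⟩
      ext ⟨t, u⟩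
      have e1 := DFunLike.congr_fun h2 t
      have e2 := DFunLike.congr_fun h1 u
      have e : ((t, u) : Kk × Lj) = (t, 0) + (0, u) := by simp
      simp only [AddMonoidHom.comp_apply, AddMonoidHom.neg_apply, AddMonoidHom.inl_apply,
        AddMonoidHom.inr_apply, AddMonoidHom.add_apply] at e1 e2
      rw [e, map_add χ, e1, ← neg_eq_iff_eq_neg.2 e2]
      simp [g]
      abel
    · rintro ⟨ψ, rfl⟩
      ext ⟨t, u⟩
      simp only [f, g, AddMonoidHom.comp_apply, AddMonoidHom.prod_apply, AddMonoidHom.add_apply,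
        AddMonoidHom.sub_apply, AddMonoidHom.coe_fst, AddMonoidHom.coe_snd, map_add, haa, hbb, hp,
        add_zero, sub_self]
      exact map_zero ψ

/-- The exactness of the mapping cone of a morphism of complexes of abelian groups. -/
def ConeExact {K L : CochainComplex AddCommGrpCat.{u} ℤ} (φ : K ⟶ L) : Prop :=
  ∀ i j k l : ℤ, i + 1 = j → j + 1 = k → k + 1 = l →
    ConeExactData (K.d j k).hom (K.d k l).hom (L.d i j).hom (L.d j k).hom (φ.f j).hom (φ.f k).hom

section Ab

variable (K : CochainComplex AddCommGrpCat.{u} ℤ)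

lemma exists_cycle {j k : ℤ} (hjk : j + 1 = k) (x : K.X j) (hx : K.d j k x = 0) :
    ∃ z : K.cycles j, K.iCycles j z = x :=
  have hex : (ShortComplex.mk (K.iCycles j) (K.d j k) (by simp)).Exact :=
    ShortComplex.exact_of_f_is_kernel _ (K.cyclesIsKernel j k (by simp [hjk]))
  ((ShortComplex.ab_exact_iff _).1 hex) x hx

lemma d_iCycles_apply (j k : ℤ) (z : K.cycles j) : K.d j k (K.iCycles j z) = 0 := by
  rw [← AddCommGrpCat.comp_apply, K.iCycles_d]; rfl

lemma homologyπ_apply_eq_zero_iff {i j : ℤ} (hij : i + 1 = j) (z : K.cycles j) :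
    K.homologyπ j z = 0 ↔ ∃ y : K.X i, K.d i j y = K.iCycles j z := by
  have hex : (ShortComplex.mk (K.toCycles i j) (K.homologyπ j) (by simp)).Exact :=
    ShortComplex.exact_of_g_is_cokernel _ (K.homologyIsCokernel i j (by simp [← hij]))
  rw [ShortComplex.ab_exact_iff] at hex
  have hinj : Function.Injective (K.iCycles j) :=
    (AddCommGrpCat.mono_iff_injective _).1 inferInstance
  constructor
  · intro h
    obtain ⟨y, hy⟩ := hex z h
    exact ⟨y, by rw [← hy, ← AddCommGrpCat.comp_apply]; simp⟩
  · rintro ⟨y, hy⟩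
    have : z = K.toCycles i j y := hinj (by rw [← hy, ← AddCommGrpCat.comp_apply]; simp)
    rw [this, ← AddCommGrpCat.comp_apply]
    simp

end Ab

/-- The cone condition packs two statements: solving for x' alone gives injectivity on cohomology in
degree k, and the case x = 0 gives surjectivity in degree j. -/
lemma quasiIso_iff_coneExact {K L : CochainComplex AddCommGrpCat.{u} ℤ} (φ : K ⟶ L) :
    QuasiIso φ ↔ ConeExact φ := by
  have surj : ∀ (K : CochainComplex AddCommGrpCat.{u} ℤ) (j : ℤ),
      Function.Surjective (K.homologyπ j) := fun K j =>
    (AddCommGrpCat.epi_iff_surjective _).1 inferInstance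
  have nat : ∀ (j : ℤ) (z : K.cycles j), HomologicalComplex.homologyMap φ j (K.homologyπ j z) =
      L.homologyπ j (HomologicalComplex.cyclesMap φ j z) := fun j z => by
    rw [← AddCommGrpCat.comp_apply, ← AddCommGrpCat.comp_apply]; simp
  have nati : ∀ (j : ℤ) (z : K.cycles j), L.iCycles j (HomologicalComplex.cyclesMap φ j z) =
      φ.f j (K.iCycles j z) := fun j z => by
    rw [← AddCommGrpCat.comp_apply, ← AddCommGrpCat.comp_apply]; simp
  have nd : ∀ (j k : ℤ) (x : K.X j), φ.f k (K.d j k x) = L.d j k (φ.f j x) := fun j k x => by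
    rw [← AddCommGrpCat.comp_apply, ← AddCommGrpCat.comp_apply, φ.comm]
  rw [quasiIso_iff]
  constructor
  · intro h i j k l hij hjk hkl x y hx hxy
    have bij : ∀ j, Function.Bijective (HomologicalComplex.homologyMap φ j) := fun j => by
      have := (quasiIsoAt_iff_isIso_homologyMap φ j).1 (h j)
      exact ConcreteCategory.bijective_of_isIso (HomologicalComplex.homologyMap φ j)
    obtain ⟨z, hz⟩ := exists_cycle K hkl x hx
    have h1 : HomologicalComplex.homologyMap φ k (K.homologyπ k z) = 0 := by
      rw [nat, homologyπ_apply_eq_zero_iff L hjk, nati, hz]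
      exact ⟨y, hxy.symm⟩
    have h2 : K.homologyπ k z = 0 := (bij k).1 (h1.trans (map_zero _).symm)
    obtain ⟨x₀, hx₀⟩ := (homologyπ_apply_eq_zero_iff K hjk z).1 h2
    rw [hz] at hx₀
    -- The preimage x₀ of x need not match y; the error is a cycle of L, and surjectivity on
    -- cohomology corrects x₀ by a cycle of K.
    obtain ⟨w, hw⟩ := exists_cycle L hjk (y - φ.f j x₀) (by
      rw [map_sub, ← nd, hx₀]
      exact sub_eq_zero.2 hxy.symm)
    obtain ⟨c, hc⟩ := (bij j).2 (L.homologyπ j w)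
    obtain ⟨c, rfl⟩ := surj K j c
    rw [nat, ← sub_eq_zero, ← map_sub, homologyπ_apply_eq_zero_iff L hij] at hc
    obtain ⟨y', hy'⟩ := hc
    rw [map_sub, nati, hw] at hy'
    refine ⟨x₀ + K.iCycles j c, -y', ?_, ?_⟩
    · change K.d j k (x₀ + K.iCycles j c) = x
      rw [map_add, d_iCycles_apply, add_zero, hx₀]
    · change y = φ.f j (x₀ + K.iCycles j c) + L.d i j (-y')
      rw [map_add, map_neg, hy']
      abel
  · intro h j
    rw [quasiIsoAt_iff_isIso_homologyMap, ConcreteCategory.isIso_iff_bijective]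
    constructor
    · rw [injective_iff_map_eq_zero]
      intro c hc
      obtain ⟨c, rfl⟩ := surj K j c
      rw [nat, homologyπ_apply_eq_zero_iff L (sub_add_cancel j 1), nati] at hc
      obtain ⟨y, hy⟩ := hc
      obtain ⟨x', y', h1, -⟩ := h (j - 1 - 1) (j - 1) j (j + 1) (by ring) (by ring) rfl
        (K.iCycles j c) y (d_iCycles_apply K _ _ c) hy.symm
      exact (homologyπ_apply_eq_zero_iff K (sub_add_cancel j 1) c).2 ⟨x', h1⟩
    · intro c
      obtain ⟨c, rfl⟩ := surj L j c
      obtain ⟨x', y', h1, h2⟩ := h (j - 1) j (j + 1) (j + 1 + 1) (by ring) rfl rfl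
        0 (L.iCycles j c) (map_zero _) (by
          rw [map_zero]; exact (d_iCycles_apply L _ _ c).symm)
      obtain ⟨z, hz⟩ := exists_cycle K rfl x' h1
      refine ⟨K.homologyπ j z, ?_⟩
      rw [nat, ← sub_eq_zero, ← map_sub, homologyπ_apply_eq_zero_iff L (sub_add_cancel j 1)]
      refine ⟨-y', ?_⟩
      rw [map_sub, nati, hz, h2, map_neg]
      change _ = φ.f j x' - (φ.f j x' + L.d (j-1) j y')
      abel

variable {S : Type u} [Ring S]

lemma quasiIso_iff_of_moduleCat {K L : RComplex S} (φ : K ⟶ L) :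
    QuasiIso φ ↔ ∀ i j k l : ℤ, i + 1 = j → j + 1 = k → k + 1 = l →
      ConeExactData (K.d j k).hom.toAddMonoidHom (K.d k l).hom.toAddMonoidHom
        (L.d i j).hom.toAddMonoidHom (L.d j k).hom.toAddMonoidHom (φ.f j).hom.toAddMonoidHom
        (φ.f k).hom.toAddMonoidHom := by
  rw [← HomologicalComplex.quasiIso_map_iff_of_preservesHomology φ
    (forget₂ (ModuleCat.{u} S) AddCommGrpCat.{u}), quasiIso_iff_coneExact]
  rfl

lemma acyclic_iff_of_moduleCat (K : RComplex S) :
    K.Acyclic ↔ ∀ i j k : ℤ, i + 1 = j → j + 1 = k → ∀ x : K.X j, K.d j k x = 0 →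
      ∃ y : K.X i, K.d i j y = x := by
  constructor
  · intro h i j k hij hjk x hx
    have := h j
    rw [K.exactAt_iff' i j k (by simp [← hij]) (by simp [← hjk]),
      ShortComplex.moduleCat_exact_iff] at this
    exact this x hx
  · intro h j
    rw [K.exactAt_iff' (j - 1) j (j + 1) (by simp) (by simp),
      ShortComplex.moduleCat_exact_iff]
    exact h _ _ _ (by simp) rfl

lemma acyclic_iff_of_ab (K : CochainComplex AddCommGrpCat.{u} ℤ) :
    K.Acyclic ↔ ∀ i j k : ℤ, i + 1 = j → j + 1 = k → ∀ x : K.X j, K.d j k x = 0 →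
      ∃ y : K.X i, K.d i j y = x := by
  constructor
  · intro h i j k hij hjk x hx
    have := h j
    rw [K.exactAt_iff' i j k (by simp [← hij]) (by simp [← hjk]),
      ShortComplex.ab_exact_iff] at this
    exact this x hx
  · intro h j
    rw [K.exactAt_iff' (j - 1) j (j + 1) (by simp) (by simp),
      ShortComplex.ab_exact_iff]
    exact h _ _ _ (by simp) rfl

end ConeExact

/-! ### The character functor preserves and reflects quasi-isomorphisms. -/

section CharacterComplex

variable {R : Type u} [Ring R]

/-- The morphism `Hom_ℤ(f, ℚ/ℤ)` of character complexes. -/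
def characterComplexMap {M N : RComplex R} (f : M ⟶ N) :
    characterComplex N ⟶ characterComplex M where
  f i := characterMap (f.f (-i))
  comm' i j _ := by
    change characterMap _ ≫ characterMap _ = characterMap _ ≫ characterMap _
    rw [← characterMap_comp, ← characterMap_comp, f.comm]

lemma quasiIso_characterComplexMap_iff {M N : RComplex R} (f : M ⟶ N) :
    QuasiIso (characterComplexMap f) ↔ QuasiIso f := by
  rw [quasiIso_iff_of_moduleCat, quasiIso_iff_of_moduleCat]
  have key : ∀ i j k l : ℤ, _ := fun i j k l =>
    coneExactData_iff_character (M.d j k).hom.toAddMonoidHom (M.d k l).hom.toAddMonoidHom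
      (N.d i j).hom.toAddMonoidHom (N.d j k).hom.toAddMonoidHom (f.f j).hom.toAddMonoidHom
      (f.f k).hom.toAddMonoidHom
      (fun x => by
        change M.d k l (M.d j k x) = 0
        rw [← ModuleCat.comp_apply, M.d_comp_d]; rfl)
      (fun x => by
        change N.d j k (N.d i j x) = 0
        rw [← ModuleCat.comp_apply, N.d_comp_d]; rfl)
      (fun x => by
        change f.f k (M.d j k x) = N.d j k (f.f j x)
        rw [← ModuleCat.comp_apply, ← ModuleCat.comp_apply, f.comm])
  constructor
  · intro h i j k l hij hjk hkl
    rw [key]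
    -- Degrees are written as negatives so that `M.X (-i)` is literally the module underlying a term
    -- of the character complex, without transport along - -i = i.
    obtain ⟨i, rfl⟩ : ∃ i', i = -i' := ⟨-i, by simp⟩
    obtain ⟨j, rfl⟩ : ∃ i', j = -i' := ⟨-j, by simp⟩
    obtain ⟨k, rfl⟩ : ∃ i', k = -i' := ⟨-k, by simp⟩
    obtain ⟨l, rfl⟩ : ∃ i', l = -i' := ⟨-l, by simp⟩
    intro μ ν
    exact h l k j i (by omega) (by omega) (by omega) μ ν
  · intro h i j k l hij hjk hkl μ ν
    exact (key (-l) (-k) (-j) (-i)).1 (h _ _ _ _ (by omega) (by omega) (by omega)) μ ν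

lemma acyclic_characterComplex_iff (M : RComplex R) :
    (characterComplex M).Acyclic ↔ M.Acyclic := by
  rw [acyclic_iff_of_moduleCat, acyclic_iff_of_moduleCat]
  have key : ∀ i j k : ℤ, _ := fun i j k =>
    exact_iff_character_exact (M.d i j).hom.toAddMonoidHom (M.d j k).hom.toAddMonoidHom
  have dd : ∀ (i j k : ℤ) (x : M.X i), M.d j k (M.d i j x) = 0 := fun i j k x => by
    rw [← ModuleCat.comp_apply, M.d_comp_d]; rfl
  constructor
  · intro h i j k hij hjk x hx
    refine ((key i j k).2 (fun χ => ?_) x).1 hx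
    obtain ⟨i, rfl⟩ : ∃ i', i = -i' := ⟨-i, by simp⟩
    obtain ⟨j, rfl⟩ : ∃ i', j = -i' := ⟨-j, by simp⟩
    obtain ⟨k, rfl⟩ : ∃ i', k = -i' := ⟨-k, by simp⟩
    refine ⟨fun hχ => h k j i (by omega) (by omega) χ hχ, ?_⟩
    rintro ⟨ψ, rfl⟩
    exact AddMonoidHom.ext fun x => (congrArg ψ (dd _ _ _ x)).trans (map_zero _)
  · intro h i j k hij hjk χ hχ
    refine ((key (-k) (-j) (-i)).1 (fun x => ?_) χ).1 hχ
    refine ⟨fun hx => h _ _ _ (by omega) (by omega) x hx, ?_⟩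
    rintro ⟨y, rfl⟩
    exact dd _ _ _ y

end CharacterComplex

end GorensteinDim

namespace GorensteinDim

/-! ### Character modules of left modules. -/

section CharacterObj

variable {R : Type u} [Ring R]

/-- An element of the right module `Hom_ℤ(X, ℚ/ℤ)` viewed as a homomorphism. -/
def toCharacter {X : ModuleCat.{u} R} (φ : characterObj X) : X →+ AddCircle (1 : ℚ) := φ

/-- A homomorphism `X → ℚ/ℤ` viewed as an element of the right module `Hom_ℤ(X, ℚ/ℤ)`. -/
def ofCharacter {X : ModuleCat.{u} R} (φ : X →+ AddCircle (1 : ℚ)) : characterObj X := φ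

lemma characterObj_ext {X : ModuleCat.{u} R} {φ ψ : characterObj X}
    (h : ∀ x, toCharacter φ x = toCharacter ψ x) : φ = ψ :=
  CharacterModule.ext X h

@[simp]
lemma toCharacter_add {X : ModuleCat.{u} R} (φ ψ : characterObj X) (x : X) :
    toCharacter (φ + ψ) x = toCharacter φ x + toCharacter ψ x := rfl

@[simp]
lemma toCharacter_zero {X : ModuleCat.{u} R} (x : X) :
    toCharacter (0 : characterObj X) x = 0 := rfl

lemma characterMap_add {X Y : ModuleCat.{u} R} (f g : X ⟶ Y) :
    characterMap (f + g) = characterMap f + characterMap g := by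
  ext φ : 2
  exact characterObj_ext fun x => map_add (toCharacter φ) _ _

lemma characterMap_id (X : ModuleCat.{u} R) : characterMap (𝟙 X) = 𝟙 _ := rfl

lemma characterMap_injective {X Y : ModuleCat.{u} R} (f : X ⟶ Y) (hf : Function.Surjective f) :
    Function.Injective (characterMap f) := by
  intro φ ψ h
  refine characterObj_ext fun y => ?_
  obtain ⟨x, rfl⟩ := hf y
  exact DFunLike.congr_fun (congrArg toCharacter h) x

lemma characterMap_exact {X Y Z : ModuleCat.{u} R} (f : X ⟶ Y) (g : Y ⟶ Z)
    (hfg : ∀ y, g y = 0 → ∃ x, f x = y) (φ : characterObj Y) (h : characterMap f φ = 0) :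
    ∃ ψ, characterMap g ψ = φ := by
  obtain ⟨ψ, hψ⟩ := exists_character_comp_eq g.hom.toAddMonoidHom (toCharacter φ) fun y hy => by
    obtain ⟨x, rfl⟩ := hfg y hy
    exact DFunLike.congr_fun (congrArg toCharacter h) x
  exact ⟨ofCharacter ψ, characterObj_ext hψ⟩

end CharacterObj

/-! ### Tensor-Hom adjunction, Lambek's criterion, and total acyclicity. -/

section Adjunction

variable {R : Type u} [Ring R]

/-- The homomorphism `X ⊗_R Y → A` induced by a balanced biadditive map. -/
def BalancedTensor.lift {X Y : Type u} [AddCommGroup X] [Module Rᵐᵒᵖ X] [AddCommGroup Y]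
    [Module R Y] {A : Type*} [AddCommGroup A] (f : X →+ Y →+ A)
    (hf : ∀ x (r : R) y, f (MulOpposite.op r • x) y = f x (r • y)) : BalancedTensor R X Y →+ A :=
  QuotientAddGroup.lift (balancedRel R X Y) (TensorProduct.liftAddHom f (by simp)) (by
    rw [balancedRel, AddSubgroup.closure_le]
    rintro _ ⟨x, r, y, rfl⟩
    simp [hf])

lemma BalancedTensor.smul_tmul {X Y : Type u} [AddCommGroup X] [Module Rᵐᵒᵖ X] [AddCommGroup Y]
    [Module R Y] (x : X) (r : R) (y : Y) :
    BalancedTensor.tmul R (MulOpposite.op r • x) y = BalancedTensor.tmul R x (r • y) := by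
  rw [← sub_eq_zero]
  exact (QuotientAddGroup.eq_zero_iff _).2 (AddSubgroup.subset_closure ⟨x, r, y, rfl⟩)

/-- Characters of `X ⊗_R Y` are homomorphisms `X → Hom_ℤ(Y, ℚ/ℤ)` of right modules. -/
def tensorCharacterEquiv (X : ModuleCat.{u} Rᵐᵒᵖ) (Y : ModuleCat.{u} R) :
    (((tensorBifunctor R).obj X).obj Y →+ AddCircle (1 : ℚ)) ≃+ (X ⟶ characterObj Y) where
  toFun χ := ModuleCat.ofHom (X := (X : Type u)) (Y := (characterObj Y : Type u))
    { toFun := fun x => ofCharacter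
        { toFun := fun y => χ (BalancedTensor.tmul R x y)
          map_zero' := by
            have := BalancedTensor.tmul_add R x (0 : Y) 0
            rw [add_zero, left_eq_add] at this
            exact (congrArg χ this).trans (map_zero χ)
          map_add' := fun y y' =>
            (congrArg χ (BalancedTensor.tmul_add R x y y')).trans (map_add χ _ _) }
      map_add' := fun x x' => characterObj_ext fun y =>
        (congrArg χ (BalancedTensor.add_tmul R x x' y)).trans (map_add χ _ _)
      map_smul' := fun r x => characterObj_ext fun y =>
        congrArg χ (BalancedTensor.smul_tmul x r.unop y) }
  invFun f := BalancedTensor.lift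
    { toFun := fun x => toCharacter (f x)
      map_zero' := by rw [map_zero]; rfl
      map_add' := fun x x' => by rw [map_add]; rfl }
    (fun x r y => by
      change toCharacter (f (MulOpposite.op r • x)) y = toCharacter (f x) (r • y)
      rw [map_smul]; rfl)
  left_inv χ := BalancedTensor.hom_ext R fun x y => rfl
  right_inv f := rfl
  map_add' χ χ' := rfl

lemma tensorCharacterEquiv_map_left {X X' : ModuleCat.{u} Rᵐᵒᵖ} (f : X ⟶ X') (Y : ModuleCat.{u} R)
    (χ : ((tensorBifunctor R).obj X').obj Y →+ AddCircle (1 : ℚ)) :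
    tensorCharacterEquiv X Y (χ.comp (((tensorBifunctor R).map f).app Y).hom) =
      f ≫ tensorCharacterEquiv X' Y χ := rfl

/-- Lambek's criterion: a module is flat if and only if its character module is injective. -/
lemma isFlat_iff_injective_characterObj (Y : ModuleCat.{u} R) :
    IsFlat Y ↔ Injective (characterObj Y) := by
  constructor
  · intro h
    refine ⟨fun {A B} g f hf => ?_⟩
    have hinj := h f ((ModuleCat.mono_iff_injective f).1 hf)
    -- By adjunction, extending g along f means extending a character of A ⊗ Y to B ⊗ Y; this works
    -- because A ⊗ Y → B ⊗ Y is injective.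
    obtain ⟨ψ, hψ⟩ := exists_character_comp_eq (((tensorBifunctor R).map f).app Y).hom
      ((tensorCharacterEquiv A Y).symm g) (fun b hb => by
        rw [hinj (hb.trans (map_zero (((tensorBifunctor R).map f).app Y).hom).symm), map_zero])
    refine ⟨tensorCharacterEquiv B Y ψ, ?_⟩
    rw [← tensorCharacterEquiv_map_left,
      (AddMonoidHom.ext hψ : ψ.comp (((tensorBifunctor R).map f).app Y).hom = _),
      AddEquiv.apply_symm_apply]
  · intro h A B f hf
    have : Mono f := (ModuleCat.mono_iff_injective f).2 hf
    refine (injective_iff_map_eq_zero (((tensorBifunctor R).map f).app Y).hom).2 fun t ht => ?_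
    refine eq_zero_of_forall_character _ fun χ => ?_
    obtain ⟨g, hg⟩ := h.factors (tensorCharacterEquiv A Y χ) f
    have : χ = ((tensorCharacterEquiv B Y).symm g).comp (((tensorBifunctor R).map f).app Y).hom := by
      apply (tensorCharacterEquiv A Y).injective
      rw [tensorCharacterEquiv_map_left, AddEquiv.apply_symm_apply, hg]
    rw [this]
    exact (congrArg ((tensorCharacterEquiv B Y).symm g) ht).trans
      (map_zero ((tensorCharacterEquiv B Y).symm g))

/-- The complex `Hom(J, U)` is exact in degree `j`, where `i + 1 = j` and `j + 1 = k`. -/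
def HomExactAt {S : Type u} [Ring S] (J : ModuleCat.{u} S) (U : RComplex S) (i j k : ℤ) : Prop :=
  ∀ f : J ⟶ U.X j, f ≫ U.d j k = 0 → ∃ f' : J ⟶ U.X i, f' ≫ U.d i j = f

lemma hom_acyclic_iff {S : Type u} [Ring S] (J : ModuleCat.{u} S) (U : RComplex S) :
    (((preadditiveCoyoneda.obj (Opposite.op J)).mapHomologicalComplex
      (ComplexShape.up ℤ)).obj U).Acyclic ↔
        ∀ i j k : ℤ, i + 1 = j → j + 1 = k → HomExactAt J U i j k := by
  rw [acyclic_iff_of_ab]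
  rfl

/-- The characters of J ⊗ T^(-j) are the homomorphisms J → (T⁺)^j, so exactness of J ⊗ T is read off
from its characters. -/
lemma tensor_acyclic_iff (J : ModuleCat.{u} Rᵐᵒᵖ) (T : RComplex R) :
    ((((tensorBifunctor R).obj J).mapHomologicalComplex (ComplexShape.up ℤ)).obj T).Acyclic ↔
      ∀ i j k : ℤ, i + 1 = j → j + 1 = k → HomExactAt J (characterComplex T) i j k := by
  rw [acyclic_iff_of_ab]
  let D : ∀ i j : ℤ, ((tensorBifunctor R).obj J).obj (T.X i) →+
      ((tensorBifunctor R).obj J).obj (T.X j) :=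
    fun i j => (((tensorBifunctor R).obj J).map (T.d i j)).hom
  have key : ∀ i j k : ℤ, _ := fun i j k => exact_iff_character_exact (D i j) (D j k)
  have dd : ∀ i j k x, D j k (D i j x) = 0 := fun i j k x => by
    have : ((tensorBifunctor R).obj J).map (T.d i j) ≫ ((tensorBifunctor R).obj J).map (T.d j k) =
        0 := by rw [← Functor.map_comp, T.d_comp_d, Functor.map_zero]
    exact ConcreteCategory.congr_hom this x
  constructor
  · intro h i j k hij hjk f hf
    obtain ⟨χ, rfl⟩ := (tensorCharacterEquiv J (T.X (-j))).surjective f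
    obtain ⟨ψ, hψ⟩ := ((key (-k) (-j) (-i)).1 (fun b => ⟨fun hb => h _ _ _ (by omega) (by omega) b hb,
      by rintro ⟨a, rfl⟩; exact dd _ _ _ a⟩) χ).1 (by
        apply (tensorCharacterEquiv J (T.X (-k))).injective
        exact hf.trans (map_zero (tensorCharacterEquiv J (T.X (-k)))).symm)
    refine ⟨tensorCharacterEquiv J (T.X (-i)) ψ, ?_⟩
    rw [← hψ]
    rfl
  · intro h i j k hij hjk x hx
    refine ((key i j k).2 (fun χ => ⟨fun hχ => ?_, ?_⟩) x).1 hx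
    · obtain ⟨i, rfl⟩ : ∃ i', i = -i' := ⟨-i, by simp⟩
      obtain ⟨j, rfl⟩ : ∃ i', j = -i' := ⟨-j, by simp⟩
      obtain ⟨k, rfl⟩ : ∃ i', k = -i' := ⟨-k, by simp⟩
      obtain ⟨f', hf'⟩ := h k j i (by omega) (by omega) (tensorCharacterEquiv J (T.X (-j)) χ) (by
        refine Eq.trans ?_ (map_zero (tensorCharacterEquiv J (T.X (-i))))
        rw [← hχ]
        rfl)
      refine ⟨(tensorCharacterEquiv J (T.X (-k))).symm f', ?_⟩
      apply (tensorCharacterEquiv J (T.X (-j))).injective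
      rw [← hf']
      rfl
    · rintro ⟨ψ, rfl⟩
      exact AddMonoidHom.ext fun x => (congrArg ψ (dd _ _ _ x)).trans (map_zero ψ)

lemma totallyAcyclicFlat_iff (T : RComplex R) :
    TotallyAcyclicFlat T ↔ TotallyAcyclicInjective (characterComplex T) := by
  have hflat : (∀ i, IsFlat (T.X i)) ↔ ∀ i, Injective ((characterComplex T).X i) := by
    constructor
    · exact fun h i => (isFlat_iff_injective_characterObj _).1 (h (-i))
    · intro h i
      obtain ⟨i, rfl⟩ : ∃ i', i = -i' := ⟨-i, by simp⟩
      exact (isFlat_iff_injective_characterObj _).2 (h i)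
  constructor
  · intro h
    exact ⟨hflat.1 h.flat, (acyclic_characterComplex_iff T).2 h.acyclic, fun J hJ =>
      (hom_acyclic_iff _ _).2 ((tensor_acyclic_iff _ _).1 (h.tensor_acyclic J hJ))⟩
  · intro h
    exact ⟨hflat.2 h.injective, (acyclic_characterComplex_iff T).1 h.acyclic, fun J hJ =>
      (tensor_acyclic_iff _ _).2 ((hom_acyclic_iff _ _).1 (h.hom_acyclic J hJ))⟩

end Adjunction

end GorensteinDim

namespace GorensteinDim

open CochainComplex HomComplex

/-! ### Semi-injective complexes are the K-injective complexes of injectives. -/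

section SemiInjective

variable {S : Type u} [Ring S]

lemma acyclic_mappingCone {A B : RComplex S} (f : A ⟶ B) [hf : QuasiIso f] :
    (mappingCone f).Acyclic := by
  rw [← HomotopyCategory.quotient_obj_mem_subcategoryAcyclic_iff_acyclic]
  refine ((HomotopyCategory.subcategoryAcyclic (ModuleCat.{u} S)).trW_iff_of_distinguished _
    (HomotopyCategory.mappingCone_triangleh_distinguished f)).1 ?_
  rw [← HomotopyCategory.quasiIso_eq_trW_subcategoryAcyclic]
  exact (HomotopyCategory.quotient_map_mem_quasiIso_iff f).2 hf

lemma coneExact_homComplexPrecomp_iff {A B : RComplex S} (f : A ⟶ B) (I : RComplex S) :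
    ConeExact (homComplexPrecomp f I) ↔ ∀ i j k l : ℤ, i + 1 = j → j + 1 = k → k + 1 = l →
      ∀ (x : Cochain B I k) (y : Cochain A I j), δ k l x = 0 →
        (Cochain.ofHom f).comp x (zero_add k) = δ j k y →
          ∃ (x' : Cochain B I j) (y' : Cochain A I i), δ j k x' = x ∧
            y = (Cochain.ofHom f).comp x' (zero_add j) + δ i j y' := Iff.rfl

/-- A pair (x, y) as in the cone condition is a cocycle on the mapping cone of f with values in I.
That cone is acyclic, so K-injectivity makes the cocycle a coboundary, and its two components are x'
and y' up to sign. -/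
lemma coneExact_homComplexPrecomp {A B : RComplex S} (f : A ⟶ B) [QuasiIso f] (I : RComplex S)
    [I.IsKInjective] : ConeExact (homComplexPrecomp f I) := by
  rw [coneExact_homComplexPrecomp_iff]
  intro i j k l hij hjk hkl x y hx hxy
  -- The sign on y matches the convention of `descCocycle`; it reappears in the second witness
  -- below.
  let z := mappingCone.descCocycle f (k.negOnePow • y) (Cocycle.mk x l hkl hx) hjk (by
    rw [δ_units_smul, ← hxy]; rfl)
  obtain ⟨w, hw⟩ := IsKInjective.eq_δ_of_cocycle z (acyclic_mappingCone f) j hjk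
  have hji : -1 + j = i := by omega
  refine ⟨(Cochain.ofHom (mappingCone.inr f)).comp w (zero_add j),
    k.negOnePow • (mappingCone.inl f).comp w hji, ?_, ?_⟩
  · rw [δ_ofHom_comp, hw]
    exact mappingCone.inr_descCochain f _ _ hjk
  · rw [δ_units_smul, δ_comp (mappingCone.inl f) w hji 0 k j hij (by omega) hjk,
      hw, mappingCone.δ_inl]
    have h1 : (mappingCone.inl f).comp z.1 (by omega : -1 + k = j) = k.negOnePow • y :=
      mappingCone.inl_descCochain f _ _ hjk
    rw [h1, smul_add, smul_smul, Int.units_mul_self, one_smul, smul_smul, ← hjk,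
      Int.negOnePow_succ, neg_mul, Int.units_mul_self, Cochain.ofHom_comp,
      Cochain.comp_assoc_of_second_is_zero_cochain]
    simp

lemma semiInjective_iff (I : RComplex S) :
    SemiInjective I ↔ (∀ i, Injective (I.X i)) ∧ I.IsKInjective := by
  constructor
  · intro h
    refine ⟨h.injective, ⟨fun {A} f hA => ?_⟩⟩
    -- For acyclic A the zero endomorphism is a quasi-isomorphism; cone exactness for it, with
    -- second component 0, says that every cocycle from A to I is a coboundary.
    have hz : QuasiIso (0 : A ⟶ A) := by
      rw [quasiIso_iff_of_moduleCat]
      intro i j k l hij hjk hkl x y hx hxy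
      rw [acyclic_iff_of_moduleCat] at hA
      obtain ⟨x', hx'⟩ := hA _ _ _ hjk hkl x hx
      obtain ⟨y', hy'⟩ := hA _ _ _ hij hjk y hxy.symm
      exact ⟨x', y', hx', (hy'.symm.trans (zero_add _).symm)⟩
    have := (coneExact_homComplexPrecomp_iff _ _).1
      ((quasiIso_iff_coneExact _).1 (h.hom_quasiIso (0 : A ⟶ A) hz))
    obtain ⟨w, -, hw, -⟩ := this (-2) (-1) 0 1 rfl rfl rfl (Cochain.ofHom f) 0 (δ_ofHom f)
      (by simp)
    exact ⟨(Cochain.equivHomotopy f 0).symm ⟨w, by rw [Cochain.ofHom_zero, add_zero]; exact hw.symm⟩⟩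
  · rintro ⟨h, hI⟩
    exact ⟨h, fun A B f hf => (quasiIso_iff_coneExact _).2 (coneExact_homComplexPrecomp f I)⟩

end SemiInjective

/-! ### Characters of the total tensor product as cochains; semi-flat versus semi-injective. -/

section SemiFlat

variable {R : Type u} [Ring R]

/-- The sign `(-1) ^ (p (p + 1) / 2)`. -/
def triangularSign (p : ℤ) : ℤˣ := (p * (p + 1) / 2).negOnePow

lemma triangularSign_succ (p : ℤ) :
    triangularSign (p + 1) = (p + 1).negOnePow * triangularSign p := by
  rw [triangularSign, triangularSign, ← Int.negOnePow_add]
  congr 1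
  have : (p + 1) * (p + 1 + 1) = p * (p + 1) + (p + 1) * 2 := by ring
  rw [this, Int.add_mul_ediv_right _ _ (by norm_num), add_comm]

variable (A : RComplex Rᵐᵒᵖ) (F : RComplex R)

/-- The total tensor product complex `A ⊗_R F`. -/
noncomputable abbrev tensorComplex : CochainComplex AddCommGrpCat.{u} ℤ :=
  HomologicalComplex.mapBifunctor A F (tensorBifunctor R) (ComplexShape.up ℤ)

/-- The inclusion `A^p ⊗ F^q → (A ⊗_R F)^m`. -/
noncomputable abbrev ιTensor (p q m : ℤ) (h : p + q = m) :
    ((tensorBifunctor R).obj (A.X p)).obj (F.X q) ⟶ (tensorComplex A F).X m :=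
  HomologicalComplex.ιMapBifunctor A F (tensorBifunctor R) (ComplexShape.up ℤ) p q m h

variable {A F} in
lemma ιTensor_d (p q p' q' m m' : ℤ) (h : p + q = m) (hp : p + 1 = p') (hq : q + 1 = q')
    (hm : m + 1 = m') :
    ιTensor A F p q m h ≫ (tensorComplex A F).d m m' =
      ((tensorBifunctor R).map (A.d p p')).app (F.X q) ≫ ιTensor A F p' q m' (by omega) +
        p.negOnePow • (((tensorBifunctor R).obj (A.X p)).map (F.d q q') ≫
          ιTensor A F p q' m' (by omega)) := by
  rw [HomologicalComplex.mapBifunctor.d_eq, Preadditive.comp_add,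
    HomologicalComplex.mapBifunctor.ι_D₁, HomologicalComplex.mapBifunctor.ι_D₂,
    HomologicalComplex.mapBifunctor.d₁_eq _ _ _ _ (show (ComplexShape.up ℤ).Rel p p' from hp) q m'
      (show p' + q = m' by omega),
    HomologicalComplex.mapBifunctor.d₂_eq _ _ _ _ p (show (ComplexShape.up ℤ).Rel q q' from hq) m'
      (show p + q' = m' by omega)]
  congr 1
  exact one_smul _ _

/-- Characters of `A^p ⊗ F^(-q)` are homomorphisms from `A^p` to the degree `q` part of the
character complex of `F`. -/
def tensorCharacterXEquiv (p q : ℤ) :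
    (((tensorBifunctor R).obj (A.X p)).obj (F.X (-q)) →+ AddCircle (1 : ℚ)) ≃+
      (A.X p ⟶ (characterComplex F).X q) :=
  tensorCharacterEquiv (A.X p) (F.X (-q))

lemma tensorCharacterXEquiv_map_left {A' : RComplex Rᵐᵒᵖ} (p p' q : ℤ) (f : A.X p ⟶ A'.X p')
    (χ : ((tensorBifunctor R).obj (A'.X p')).obj (F.X (-q)) →+ AddCircle (1 : ℚ)) :
    tensorCharacterXEquiv A F p q (χ.comp (((tensorBifunctor R).map f).app (F.X (-q))).hom) =
      f ≫ tensorCharacterXEquiv A' F p' q χ := rfl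

lemma tensorCharacterXEquiv_map_d (p q q' : ℤ)
    (χ : ((tensorBifunctor R).obj (A.X p)).obj (F.X (-q)) →+ AddCircle (1 : ℚ)) :
    tensorCharacterXEquiv A F p q'
      (χ.comp (((tensorBifunctor R).obj (A.X p)).map (F.d (-q') (-q))).hom) =
        tensorCharacterXEquiv A F p q χ ≫ (characterComplex F).d q q' := rfl

lemma tensorCharacterXEquiv_units_smul (p q : ℤ) (s : ℤˣ)
    (χ : ((tensorBifunctor R).obj (A.X p)).obj (F.X (-q)) →+ AddCircle (1 : ℚ)) :
    tensorCharacterXEquiv A F p q (s • χ) = s • tensorCharacterXEquiv A F p q χ := by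
  rcases Int.units_eq_one_or s with h | h <;> rw [h] <;> simp

/-- The cochain in `Hom(A, Hom_ℤ(F, ℚ/ℤ))` that corresponds to a character of `A ⊗_R F`. -/
noncomputable def tensorComplexCharacter (n m : ℤ) (h : n + m = 0)
    (χ : (tensorComplex A F).X m →+ AddCircle (1 : ℚ)) : Cochain A (characterComplex F) n :=
  Cochain.mk fun p q hpq => ((p * n).negOnePow * triangularSign p) •
    tensorCharacterXEquiv A F p q (χ.comp (ιTensor A F p (-q) m (by omega)).hom)

lemma tensorComplexCharacter_v (n m : ℤ) (h : n + m = 0)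
    (χ : (tensorComplex A F).X m →+ AddCircle (1 : ℚ)) (p q : ℤ) (hpq : p + n = q) :
    (tensorComplexCharacter A F n m h χ).v p q hpq = ((p * n).negOnePow * triangularSign p) •
      tensorCharacterXEquiv A F p q (χ.comp (ιTensor A F p (-q) m (by omega)).hom) :=
  rfl

lemma tensorComplexCharacter_add (n m : ℤ) (h : n + m = 0)
    (χ χ' : (tensorComplex A F).X m →+ AddCircle (1 : ℚ)) :
    tensorComplexCharacter A F n m h (χ + χ') =
      tensorComplexCharacter A F n m h χ + tensorComplexCharacter A F n m h χ' := by
  ext p q hpq : 1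
  simp only [tensorComplexCharacter_v, Cochain.add_v, AddMonoidHom.add_comp, map_add, smul_add]

lemma tensorComplexCharacter_injective (n m : ℤ) (h : n + m = 0) :
    Function.Injective (tensorComplexCharacter A F n m h) := by
  intro χ χ' hχ
  -- ℚ/ℤ is lifted to universe u to become an object of the category in which the total complex is a
  -- coproduct.
  let up : AddCircle (1 : ℚ) →+ ULift.{u} (AddCircle (1 : ℚ)) := AddEquiv.ulift.symm.toAddMonoidHom
  have key : AddCommGrpCat.ofHom (up.comp χ) = AddCommGrpCat.ofHom (up.comp χ') := by
    refine HomologicalComplex.mapBifunctor.hom_ext fun p q hpq => ?_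
    have hpq : p + q = m := hpq
    obtain ⟨q, rfl⟩ : ∃ q', q = -q' := ⟨-q, by simp⟩
    have h1 := Cochain.congr_v hχ p q (by omega)
    replace h1 := smul_left_cancel _ h1
    have h2 := (tensorCharacterXEquiv A F p q).injective h1
    ext t
    exact DFunLike.congr_fun h2 t
  ext t
  exact congrArg ULift.down (ConcreteCategory.congr_hom key t)

lemma tensorComplexCharacter_surjective (n m : ℤ) (h : n + m = 0) :
    Function.Surjective (tensorComplexCharacter A F n m h) := by
  intro z
  let up : AddCircle (1 : ℚ) →+ ULift.{u} (AddCircle (1 : ℚ)) := AddEquiv.ulift.symm.toAddMonoidHom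
  let down : ULift.{u} (AddCircle (1 : ℚ)) →+ AddCircle (1 : ℚ) := AddEquiv.ulift.toAddMonoidHom
  -- The degree q' is kept as a variable with q' = -q: evaluation at -q produces the degree - -q,
  -- and a free q' allows it to be replaced by q.
  let c : ∀ p q q' : ℤ, p + q = m → q' = -q → (((tensorBifunctor R).obj (A.X p)).obj (F.X q) →+
      AddCircle (1 : ℚ)) := fun p q q' hpq hq =>
    (((p * n).negOnePow * triangularSign p) • (tensorCharacterXEquiv A F p q').symm
      (z.v p q' (by omega))).comp (((tensorBifunctor R).obj (A.X p)).map
        (F.XIsoOfEq (by omega : q = -q')).hom).hom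
  let ψ : (tensorComplex A F).X m ⟶ AddCommGrpCat.of (ULift.{u} (AddCircle (1 : ℚ))) :=
    HomologicalComplex.mapBifunctorDesc fun p q hpq =>
      AddCommGrpCat.ofHom (up.comp (c p q (-q) hpq rfl))
  refine ⟨down.comp ψ.hom, ?_⟩
  ext p q hpq : 1
  have hι : (down.comp ψ.hom).comp (ιTensor A F p (-q) m (by omega)).hom =
      c p (-q) (- -q) (by omega) rfl := by
    ext t
    have := HomologicalComplex.ι_mapBifunctorDesc (K₁ := A) (K₂ := F) (F := tensorBifunctor R)
      (c := ComplexShape.up ℤ) (j := m)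
      (fun p q hpq => AddCommGrpCat.ofHom (up.comp (c p q (-q) hpq rfl))) p (-q)
      (show p + -q = m by omega)
    exact congrArg ULift.down (ConcreteCategory.congr_hom this t)
  have hc : c p (-q) (- -q) (by omega) rfl = ((p * n).negOnePow * triangularSign p) •
      (tensorCharacterXEquiv A F p q).symm (z.v p q hpq) := by
    have : ∀ q' (h : q' = - -q), c p (-q) q' (by omega) h = c p (-q) q (by omega) (by omega) := by
      intro q' h
      obtain rfl : q' = q := by omega
      rfl
    rw [this _ rfl]
    simp only [c, HomologicalComplex.XIsoOfEq_rfl, Iso.refl_hom, CategoryTheory.Functor.map_id]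
    rfl
  rw [tensorComplexCharacter_v, hι, hc, tensorCharacterXEquiv_units_smul,
    AddEquiv.apply_symm_apply, smul_smul, Int.units_mul_self, one_smul]

/-- On A^p ⊗ F^q the differential is d ⊗ 1 + (-1)^p 1 ⊗ d, while δ z = z d + (-1)^(n+1) d z and the
character complex carries no signs. The factor (-1)^(pn) reconciles the terms with the differential
of F. Those with the differential of A then force a sign e with e(p+1) = (-1)^(p+1) e(p), which is
the recursion of `triangularSign`. -/
lemma tensorComplexCharacter_d (n m n' m' : ℤ) (h : n + m = 0) (hn : n + 1 = n') (hm : m' + 1 = m)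
    (χ : (tensorComplex A F).X m →+ AddCircle (1 : ℚ)) :
    tensorComplexCharacter A F n' m' (by omega) (χ.comp ((tensorComplex A F).d m' m).hom) =
      δ n n' (tensorComplexCharacter A F n m h χ) := by
  subst hn
  ext p q hpq : 1
  rw [δ_v n (n + 1) rfl _ p q hpq (q - 1) (p + 1) rfl rfl, tensorComplexCharacter_v,
    tensorComplexCharacter_v, tensorComplexCharacter_v]
  have hd := ιTensor_d (A := A) (F := F) p (-q) (p + 1) (-(q - 1)) m' m (by omega) rfl (by omega) hm
  have e : (χ.comp ((tensorComplex A F).d m' m).hom).comp (ιTensor A F p (-q) m' (by omega)).hom =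
      (χ.comp (ιTensor A F (p + 1) (-q) m (by omega)).hom).comp
        (((tensorBifunctor R).map (A.d p (p + 1))).app (F.X (-q))).hom +
      p.negOnePow • (χ.comp (ιTensor A F p (-(q - 1)) m (by omega)).hom).comp
        (((tensorBifunctor R).obj (A.X p)).map (F.d (-q) (-(q - 1)))).hom := by
    ext t
    have := congrArg χ (ConcreteCategory.congr_hom hd t)
    refine this.trans ((map_add χ _ _).trans (congrArg _ ?_))
    rcases Int.units_eq_one_or p.negOnePow with h | h <;> rw [h]
    · simp
    · simp
  rw [e, map_add, smul_add, add_comm]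
  congr 1
  · rw [tensorCharacterXEquiv_units_smul, smul_smul, tensorCharacterXEquiv_map_d,
      Linear.units_smul_comp]
    congr 1
    rw [mul_add, mul_one, Int.negOnePow_add, mul_right_comm, mul_assoc (p * n).negOnePow,
      Int.units_mul_self, mul_one]
  · rw [tensorCharacterXEquiv_map_left, Linear.comp_units_smul, smul_smul, triangularSign_succ]
    congr 1
    rw [mul_add, mul_one, add_mul, one_mul]
    simp only [Int.negOnePow_add, Int.negOnePow_one]
    rcases Int.units_eq_one_or p.negOnePow with h₁ | h₁ <;>
      rcases Int.units_eq_one_or n.negOnePow with h₂ | h₂ <;> simp [h₁, h₂]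

variable {A} in
lemma tensorComplexCharacter_map {B : RComplex Rᵐᵒᵖ} (f : A ⟶ B) (n m : ℤ) (h : n + m = 0)
    (χ : (tensorComplex B F).X m →+ AddCircle (1 : ℚ)) :
    tensorComplexCharacter A F n m h (χ.comp ((tensorComplexMap f F).f m).hom) =
      (Cochain.ofHom f).comp (tensorComplexCharacter B F n m h χ) (zero_add n) := by
  ext p q hpq : 1
  rw [Cochain.zero_cochain_comp_v, tensorComplexCharacter_v, tensorComplexCharacter_v,
    Linear.comp_units_smul, Cochain.ofHom_v, ← tensorCharacterXEquiv_map_left]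
  congr 2
  have := HomologicalComplex.ι_mapBifunctorMap f (𝟙 F) (tensorBifunctor R) (ComplexShape.up ℤ)
    p (-q) m (show p + -q = m by omega)
  rw [HomologicalComplex.id_f, CategoryTheory.Functor.map_id, Category.id_comp] at this
  ext t
  exact congrArg χ (ConcreteCategory.congr_hom this t)

variable {A} in
-- Characters of A ⊗ F in degree m are the cochains of degree -m from A to F⁺, compatibly with
-- differentials and with f. So `coneExactData_iff_character` translates one cone condition into the
-- other.
lemma quasiIso_tensorComplexMap_iff {B : RComplex Rᵐᵒᵖ} (f : A ⟶ B) :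
    QuasiIso (tensorComplexMap f F) ↔ QuasiIso (homComplexPrecomp f (characterComplex F)) := by
  rw [quasiIso_iff_coneExact, quasiIso_iff_coneExact, coneExact_homComplexPrecomp_iff]
  let K := tensorComplex A F
  let L := tensorComplex B F
  have dd : ∀ (K : CochainComplex AddCommGrpCat.{u} ℤ) (i j k : ℤ) (x : K.X i),
      K.d j k (K.d i j x) = 0 := fun K i j k x => by
    rw [← AddCommGrpCat.comp_apply, K.d_comp_d]; rfl
  have key : ∀ i j k l : ℤ, _ := fun i j k l =>
    coneExactData_iff_character (K.d j k).hom (K.d k l).hom (L.d i j).hom (L.d j k).hom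
      ((tensorComplexMap f F).f j).hom ((tensorComplexMap f F).f k).hom (dd K j k l) (dd L i j k)
      (fun x => by
        have := (tensorComplexMap f F).comm j k
        exact (ConcreteCategory.congr_hom this x).symm)
  constructor
  · intro h i j k l hij hjk hkl x y hx hxy
    obtain ⟨μ, rfl⟩ := tensorComplexCharacter_surjective B F k (-k) (by omega) x
    obtain ⟨ν, rfl⟩ := tensorComplexCharacter_surjective A F j (-j) (by omega) y
    rw [← tensorComplexCharacter_d B F k (-k) l (-l) (by omega) hkl (by omega)] at hx
    rw [← tensorComplexCharacter_map,
      ← tensorComplexCharacter_d A F j (-j) k (-k) (by omega) hjk (by omega)] at hxy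
    have zero : ∀ n m h, tensorComplexCharacter B F n m h 0 = 0 := fun n m h =>
      left_eq_add.1 ((congrArg _ (add_zero 0)).symm.trans
        (tensorComplexCharacter_add B F n m h 0 0))
    obtain ⟨l', κ, h1, h2⟩ := (key (-l) (-k) (-j) (-i)).1
      (h _ _ _ _ (by omega) (by omega) (by omega)) μ ν
      (tensorComplexCharacter_injective B F l (-l) (by omega) (hx.trans (zero _ _ _).symm))
      (tensorComplexCharacter_injective A F k (-k) (by omega) hxy)
    refine ⟨tensorComplexCharacter B F j (-j) (by omega) l',
      tensorComplexCharacter A F i (-i) (by omega) κ, ?_, ?_⟩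
    · rw [← tensorComplexCharacter_d B F j (-j) k (-k) (by omega) hjk (by omega), ← h1]
    · rw [← tensorComplexCharacter_map,
        ← tensorComplexCharacter_d A F i (-i) j (-j) (by omega) hij (by omega),
        ← tensorComplexCharacter_add, h2]
  · intro h i j k l hij hjk hkl
    refine (key i j k l).2 fun μ ν hμ hμν => ?_
    have zero : ∀ n m h, tensorComplexCharacter B F n m h 0 = 0 := fun n m h =>
      left_eq_add.1 ((congrArg _ (add_zero 0)).symm.trans
        (tensorComplexCharacter_add B F n m h 0 0))
    obtain ⟨x', y', h1, h2⟩ := h (-l) (-k) (-j) (-i) (by omega) (by omega) (by omega)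
      (tensorComplexCharacter B F (-j) j (by omega) μ)
      (tensorComplexCharacter A F (-k) k (by omega) ν) (by
        rw [← tensorComplexCharacter_d B F (-j) j (-i) i (by omega) (by omega) hij, ← zero]
        exact congrArg _ hμ) (by
        rw [← tensorComplexCharacter_map,
          ← tensorComplexCharacter_d A F (-k) k (-j) j (by omega) (by omega) hjk]
        exact congrArg _ hμν)
    obtain ⟨l', rfl⟩ := tensorComplexCharacter_surjective B F (-k) k (by omega) x'
    obtain ⟨κ, rfl⟩ := tensorComplexCharacter_surjective A F (-l) l (by omega) y'
    refine ⟨l', κ, ?_, ?_⟩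
    · refine tensorComplexCharacter_injective B F (-j) j (by omega) ?_
      exact (tensorComplexCharacter_d B F (-k) k (-j) j (by omega) (by omega) hjk l').trans h1
    · refine tensorComplexCharacter_injective A F (-k) k (by omega) ?_
      refine h2.trans (Eq.trans ?_ (tensorComplexCharacter_add A F (-k) k (by omega) _ _).symm)
      rw [tensorComplexCharacter_map,
        tensorComplexCharacter_d A F (-l) l (-k) k (by omega) (by omega) hkl]

lemma isFlat_iff_injective_characterComplex :
    (∀ i, IsFlat (F.X i)) ↔ ∀ i, Injective ((characterComplex F).X i) := by
  constructor
  · exact fun h i => (isFlat_iff_injective_characterObj _).1 (h (-i))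
  · intro h i
    obtain ⟨i, rfl⟩ : ∃ i', i = -i' := ⟨-i, by simp⟩
    exact (isFlat_iff_injective_characterObj _).2 (h i)

/-- Through this equivalence the flat side inherits everything available for K-injective complexes:
lifting of derived morphisms, homotopy equivalences and passage to retracts. -/
lemma semiFlat_iff : SemiFlat F ↔ SemiInjective (characterComplex F) :=
  ⟨fun h => ⟨(isFlat_iff_injective_characterComplex F).1 h.flat, fun _ _ f hf =>
    (quasiIso_tensorComplexMap_iff F f).1 (h.tensor_quasiIso f hf)⟩,
  fun h => ⟨(isFlat_iff_injective_characterComplex F).2 h.injective, fun _ _ f hf =>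
    (quasiIso_tensorComplexMap_iff F f).2 (h.hom_quasiIso f hf)⟩⟩

end SemiFlat

end GorensteinDim

namespace GorensteinDim

/-! ### Extending morphisms downwards, and transporting Hom-exactness. -/

section Extension

variable {S : Type u} [Ring S]

/-- A family of homomorphisms that commutes with the differentials in degrees `≥ g` can be
extended downwards to a morphism of complexes, if the relevant obstructions vanish. -/
lemma exists_hom_of_homExactAt (A B : RComplex S) (g : ℤ) (f : ∀ i, A.X i ⟶ B.X i)
    (hf : ∀ i j, g ≤ i → i + 1 = j → f i ≫ B.d i j = A.d i j ≫ f j)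
    (hB : ∀ i j k, i < g → i + 1 = j → j + 1 = k → HomExactAt (A.X i) B i j k) :
    ∃ φ : A ⟶ B, ∀ i, g ≤ i → φ.f i = f i := by
  let P : ℤ → (∀ i, A.X i ⟶ B.X i) → Prop := fun m f =>
    ∀ i j, m ≤ i → i + 1 = j → f i ≫ B.d i j = A.d i j ≫ f j
  have step : ∀ (n : ℕ) (f : {f // P (g - n) f}), ∃ f' : {f // P (g - (n + 1 : ℕ)) f},
      ∀ i, g - n ≤ i → f'.1 i = f.1 i := by
    rintro n ⟨f, hf⟩
    obtain ⟨i, hi⟩ : ∃ i, i = g - (n + 1 : ℕ) := ⟨_, rfl⟩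
    -- The composite of the differential of A with the component already constructed is a cocycle in
    -- Hom(A^i, B); a preimage of it is the next component.
    obtain ⟨u, hu⟩ := hB i (i + 1) (i + 1 + 1) (by push_cast at hi; omega) rfl rfl
      (A.d i (i + 1) ≫ f (i + 1)) (by
        rw [Category.assoc, hf (i + 1) _ (by push_cast at hi; omega) rfl, ← Category.assoc,
          A.d_comp_d, Limits.zero_comp])
    refine ⟨⟨Function.update f i u, ?_⟩, fun j hj => ?_⟩
    · rintro j k hj rfl
      rw [Function.update_of_ne (a := j + 1) (by omega)]
      rcases eq_or_ne j i with rfl | hne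
      · rw [Function.update_self, hu]
      · rw [Function.update_of_ne hne, hf j _ (by push_cast at hi; omega) rfl]
    · exact Function.update_of_ne (by push_cast at hi; omega) _ _
  choose next hnext using step
  -- Passing to stage n + 1 alters only degree g - (n + 1), so the component in degree i is final
  -- from stage (g - i).toNat on, and the limit reads it off there.
  let F : ∀ n : ℕ, {f // P (g - n) f} := fun n =>
    Nat.rec ⟨f, fun i j hi => hf i j (by simpa using hi)⟩ (fun n f => next n f) n
  have hF : ∀ (n : ℕ) i, g - (n : ℤ) ≤ i → (F (n + 1)).1 i = (F n).1 i := fun n i hi => hnext n (F n) i hi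
  have hF' : ∀ i (N : ℕ), (g - i).toNat ≤ N → (F N).1 i = (F (g - i).toNat).1 i := by
    intro i N hN
    induction N, hN using Nat.le_induction with
    | base => rfl
    | succ N hN ih => rw [hF N i (by omega), ih]
  refine ⟨{ f := fun i => (F (g - i).toNat).1 i, comm' := fun i j hij => ?_ }, fun i hi => ?_⟩
  · have hij : i + 1 = j := hij
    rw [← hF' j (g - i).toNat (by omega)]
    exact (F (g - i).toNat).2 i j (by omega) hij
  · change (F (g - i).toNat).1 i = f i
    rw [Int.toNat_of_nonpos (by omega)]
    rfl

lemma homotopy_comm {K L : RComplex S} {φ ψ : K ⟶ L} (h : Homotopy φ ψ) (i j k : ℤ)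
    (hij : i + 1 = j) (hjk : j + 1 = k) :
    φ.f j = K.d j k ≫ h.hom k j + h.hom j i ≫ L.d i j + ψ.f j := by
  rw [h.comm j, dNext_eq _ (show (ComplexShape.up ℤ).Rel j k from hjk),
    prevD_eq _ (show (ComplexShape.up ℤ).Rel i j from hij)]

/-- If f e = y d in I', then f differs from f e e⁻¹ = (y e⁻¹) d by f composed with the homotopy, and
the part of the homotopy starting with d dies because f is a cocycle. -/
lemma HomExactAt.of_homotopyEquiv {I I' : RComplex S} (e : HomotopyEquiv I I') (J : ModuleCat.{u} S)
    {i j k : ℤ} (hij : i + 1 = j) (hjk : j + 1 = k) (h : HomExactAt J I' i j k) :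
    HomExactAt J I i j k := by
  intro f hf
  obtain ⟨y, hy⟩ := h (f ≫ e.hom.f j) (by
    rw [Category.assoc, e.hom.comm, ← Category.assoc, hf, Limits.zero_comp])
  have hc := homotopy_comm e.homotopyHomInvId i j k hij hjk
  rw [HomologicalComplex.comp_f, HomologicalComplex.id_f] at hc
  refine ⟨y ≫ e.inv.f i - f ≫ e.homotopyHomInvId.hom j i, ?_⟩
  have h1 := congrArg (f ≫ ·) hc
  simp only [Preadditive.comp_add, Category.comp_id, ← Category.assoc, hf, Limits.zero_comp,
    zero_add] at h1
  rw [← hy] at h1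
  rw [Preadditive.sub_comp, Category.assoc, e.inv.comm, ← Category.assoc, h1]
  abel

/-- The map c only carries the cocycle condition from I to U, so no inverse is needed in degree k.
-/
lemma HomExactAt.of_isIso {I U : RComplex S} (J : ModuleCat.{u} S) {i j k : ℤ}
    (a : I.X i ⟶ U.X i) (b : I.X j ⟶ U.X j) (c : I.X k ⟶ U.X k) [IsIso a] [IsIso b]
    (hab : a ≫ U.d i j = I.d i j ≫ b) (hbc : b ≫ U.d j k = I.d j k ≫ c)
    (h : HomExactAt J U i j k) : HomExactAt J I i j k := by
  intro f hf
  obtain ⟨y, hy⟩ := h (f ≫ b) (by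
    rw [Category.assoc, hbc, ← Category.assoc, hf, Limits.zero_comp])
  refine ⟨y ≫ inv a, ?_⟩
  rw [← cancel_mono b, ← hy, Category.assoc, Category.assoc, ← hab, IsIso.inv_hom_id_assoc]

/-- Allowing J to be the ring itself puts ordinary exactness and exactness of Hom(J, U) for
injective J under the same transport lemmas. -/
lemma homExactAt_self_iff (U : RComplex S) (i j k : ℤ) :
    HomExactAt (ModuleCat.of S S) U i j k ↔ ∀ x, U.d j k x = 0 → ∃ y, U.d i j y = x := by
  constructor
  · intro h x hx
    obtain ⟨f, hf⟩ := h (ModuleCat.ofHom (LinearMap.toSpanSingleton S _ x)) (by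
      ext
      simpa using hx)
    refine ⟨f (1 : S), ?_⟩
    have := ConcreteCategory.congr_hom hf (1 : S)
    simpa using this
  · intro h f hf
    obtain ⟨y, hy⟩ := h (f (1 : S)) (ConcreteCategory.congr_hom hf (1 : S))
    refine ⟨ModuleCat.ofHom (LinearMap.toSpanSingleton S _ y), ?_⟩
    ext
    simpa using hy

lemma TotallyAcyclicInjective.homExactAt {U : RComplex S} (hU : TotallyAcyclicInjective U)
    (J : ModuleCat.{u} S) (hJ : Injective J ∨ J = ModuleCat.of S S) {i j k : ℤ} (hij : i + 1 = j)
    (hjk : j + 1 = k) : HomExactAt J U i j k := by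
  rcases hJ with hJ | rfl
  · exact (hom_acyclic_iff J U).1 (hU.hom_acyclic J hJ) i j k hij hjk
  · exact (homExactAt_self_iff U i j k).2 ((acyclic_iff_of_moduleCat U).1 hU.acyclic i j k hij hjk)

lemma injective_of_retract {X Y : ModuleCat.{u} S} (hX : Injective X) (i : Y ⟶ X) (r : X ⟶ Y)
    (h : i ≫ r = 𝟙 Y) : Injective Y :=
  ⟨fun g f _ => ⟨Injective.factorThru (g ≫ i) f ≫ r, by
    rw [← Category.assoc, Injective.comp_factorThru, Category.assoc, h, Category.comp_id]⟩⟩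

lemma SemiInjective.of_retract {I I' : RComplex S} (h : SemiInjective I) (i : I' ⟶ I) (r : I ⟶ I')
    (hr : i ≫ r = 𝟙 I') : SemiInjective I' := by
  rw [semiInjective_iff] at h ⊢
  have hI := h.2
  constructor
  · intro n
    have := h.1 n
    have hrn : i.f n ≫ r.f n = 𝟙 _ := by rw [← HomologicalComplex.comp_f, hr]; rfl
    exact injective_of_retract this _ _ hrn
  · refine ⟨fun {K} f hK => ?_⟩
    obtain ⟨H⟩ := CochainComplex.IsKInjective.nonempty_homotopy_zero (f ≫ i) hK
    exact ⟨(Homotopy.ofEq (by rw [Category.assoc, hr, Category.comp_id])).trans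
      ((H.compRight r).trans (Homotopy.ofEq (by simp)))⟩

end Extension

/-! ### Derived isomorphisms realized by maps into K-injective complexes. -/

section Derived

open DerivedCategory

attribute [local instance] HasDerivedCategory.standard

variable {S : Type u} [Ring S]

lemma exists_Q_map_eq {A I : RComplex S} [I.IsKInjective] (f : Q.obj A ⟶ Q.obj I) :
    ∃ φ : A ⟶ I, Q.map φ = f := by
  obtain ⟨g, hg⟩ := (CochainComplex.IsKInjective.Qh_map_bijective
    ((HomotopyCategory.quotient _ _).obj A) I).surjective
    ((quotientCompQhIso (ModuleCat.{u} S)).hom.app A ≫ f ≫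
      (quotientCompQhIso (ModuleCat.{u} S)).inv.app I)
  obtain ⟨φ, rfl⟩ := (HomotopyCategory.quotient _ _).map_surjective g
  refine ⟨φ, ?_⟩
  have := (quotientCompQhIso (ModuleCat.{u} S)).hom.naturality φ
  rw [Functor.comp_map, hg] at this
  simpa using this.symm

lemma homotopic_of_Q_map_eq {A I : RComplex S} [I.IsKInjective] {φ ψ : A ⟶ I}
    (h : (Q.map φ : Q.obj A ⟶ Q.obj I) = Q.map ψ) : Nonempty (Homotopy φ ψ) := by
  refine ⟨HomotopyCategory.homotopyOfEq _ _ ?_⟩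
  refine (CochainComplex.IsKInjective.Qh_map_bijective
    ((HomotopyCategory.quotient _ _).obj A) I).injective ?_
  have h1 := (quotientCompQhIso (ModuleCat.{u} S)).hom.naturality φ
  have h2 := (quotientCompQhIso (ModuleCat.{u} S)).hom.naturality ψ
  rw [h, ← h2] at h1
  exact (cancel_mono _).1 h1

lemma nonempty_homotopyEquiv {I I' : RComplex S} [I.IsKInjective] [I'.IsKInjective]
    (e : Q.obj I ≅ Q.obj I') : Nonempty (HomotopyEquiv I I') := by
  obtain ⟨a, ha⟩ := exists_Q_map_eq e.hom
  obtain ⟨b, hb⟩ := exists_Q_map_eq e.inv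
  obtain ⟨h₁⟩ := homotopic_of_Q_map_eq (φ := a ≫ b) (ψ := 𝟙 I) (by
    rw [Functor.map_comp, ha, hb, e.hom_inv_id, CategoryTheory.Functor.map_id])
  obtain ⟨h₂⟩ := homotopic_of_Q_map_eq (φ := b ≫ a) (ψ := 𝟙 I') (by
    rw [Functor.map_comp, ha, hb, e.inv_hom_id, CategoryTheory.Functor.map_id])
  exact ⟨⟨a, b, h₁, h₂⟩⟩

variable {R : Type u} [Ring R]

lemma nonempty_iso_Q_of_quasiIso {A B : RComplex S} (f : A ⟶ B) (hf : QuasiIso f) :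
    Nonempty (Q.obj A ≅ Q.obj B) :=
  have := (isIso_Q_map_iff_quasiIso _ f).2 hf
  ⟨asIso (Q.map f)⟩

lemma DerivedIso.nonempty_iso {F M : RComplex R} (h : DerivedIso F M) :
    Nonempty (Q.obj (characterComplex F) ≅ Q.obj (characterComplex M)) := by
  obtain ⟨L, f, g, hf, hg⟩ := h
  obtain ⟨a⟩ := nonempty_iso_Q_of_quasiIso _ ((quasiIso_characterComplexMap_iff f).2 hf)
  obtain ⟨b⟩ := nonempty_iso_Q_of_quasiIso _ ((quasiIso_characterComplexMap_iff g).2 hg)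
  exact ⟨a ≪≫ b.symm⟩

lemma SemiFlat.isKInjective {F : RComplex R} (hF : SemiFlat F) :
    (characterComplex F).IsKInjective :=
  ((semiInjective_iff _).1 ((semiFlat_iff F).1 hF)).2

/-- F and F' need not be homotopy equivalent themselves; only their character complexes, being
K-injective, are. -/
lemma SemiFlat.nonempty_homotopyEquiv {F F' M : RComplex R} (hF : SemiFlat F) (hF' : SemiFlat F')
    (h : DerivedIso F M) (h' : DerivedIso F' M) :
    Nonempty (HomotopyEquiv (characterComplex F) (characterComplex F')) := by
  have := hF.isKInjective
  have := hF'.isKInjective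
  obtain ⟨a⟩ := h.nonempty_iso
  obtain ⟨b⟩ := h'.nonempty_iso
  exact GorensteinDim.nonempty_homotopyEquiv (a ≪≫ b.symm)

lemma SemiFlat.nonempty_homotopyEquiv_of_quasiIso {F M : RComplex R} {I : RComplex Rᵐᵒᵖ}
    (hF : SemiFlat F) (h : DerivedIso F M) (hI : SemiInjective I) (ι : characterComplex M ⟶ I)
    (hι : QuasiIso ι) : Nonempty (HomotopyEquiv (characterComplex F) I) := by
  have := hF.isKInjective
  have := ((semiInjective_iff _).1 hI).2
  obtain ⟨a⟩ := h.nonempty_iso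
  obtain ⟨b⟩ := nonempty_iso_Q_of_quasiIso ι hι
  exact GorensteinDim.nonempty_homotopyEquiv (a ≪≫ b)

lemma SemiFlat.exists_quasiIso {F M : RComplex R} (hF : SemiFlat F) (h : DerivedIso F M) :
    ∃ ι : characterComplex M ⟶ characterComplex F, QuasiIso ι := by
  have := hF.isKInjective
  obtain ⟨a⟩ := h.nonempty_iso
  obtain ⟨ι, hι⟩ := exists_Q_map_eq a.inv
  exact ⟨ι, (isIso_Q_map_iff_quasiIso _ ι).1 (hι ▸ inferInstance)⟩

end Derived

/-! ### Isomorphisms of truncations as compatible families of isomorphisms. -/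

section Truncation

variable {R : Type u} [Ring R]

lemma nonempty_truncGE_iso {T F : RComplex R} (g : ℤ) (e : ∀ j : ℤ, j ≤ -g → (T.X j ≅ F.X j))
    (he : ∀ i j (hi : i ≤ -g) (hj : j ≤ -g), i + 1 = j →
      (e i hi).hom ≫ F.d i j = T.d i j ≫ (e j hj).hom) :
    Nonempty (truncGE T g ≅ truncGE F g) := by
  let ε := ComplexShape.embeddingUpIntLE (-g)
  have hε : ∀ n, ε.f n ≤ -g := fun n => by
    change -g - (n : ℤ) ≤ -g
    omega
  let φ : T.restriction ε ≅ F.restriction ε :=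
    HomologicalComplex.Hom.isoOfComponents (fun n => e (ε.f n) (hε n)) (fun i j hij =>
      he _ _ _ _ (show ε.f i + 1 = ε.f j from ε.rel hij))
  exact ⟨(ε.extendFunctor (ModuleCat.{u} R)).mapIso φ⟩

/-- The truncation is the extension by zero of a restriction to half of the degrees, and extension
is fully faithful, so an isomorphism of truncations comes from one of restrictions. -/
lemma exists_iso_of_truncGE_iso {T F : RComplex R} (g : ℤ) (φ : truncGE T g ≅ truncGE F g) :
    ∃ e : ∀ j : ℤ, j ≤ -g → (T.X j ≅ F.X j), ∀ i j (hi : i ≤ -g) (hj : j ≤ -g), i + 1 = j →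
      (e i hi).hom ≫ F.d i j = T.d i j ≫ (e j hj).hom := by
  let ε := ComplexShape.embeddingUpIntLE (-g)
  let ψ : T.restriction ε ≅ F.restriction ε :=
    (ε.fullyFaithfulExtendFunctor (ModuleCat.{u} R)).preimageIso φ
  have hε : ∀ j : ℤ, j ≤ -g → ε.f (-g - j).toNat = j := fun j hj => by
    change -g - ((-g - j).toNat : ℤ) = j
    omega
  refine ⟨fun j hj => (T.restrictionXIso ε (hε j hj)).symm ≪≫
    (HomologicalComplex.Hom.isoApp ψ (-g - j).toNat) ≪≫ F.restrictionXIso ε (hε j hj), ?_⟩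
  intro i j hi hj hij
  have := ψ.hom.comm (-g - i).toNat (-g - j).toNat
  rw [HomologicalComplex.restriction_d_eq _ _ (hε i hi) (hε j hj),
    HomologicalComplex.restriction_d_eq _ _ (hε i hi) (hε j hj)] at this
  rw [← cancel_epi (T.restrictionXIso ε (hε i hi)).hom,
    ← cancel_mono (F.restrictionXIso ε (hε j hj)).inv]
  simpa using this

end Truncation

end GorensteinDim

namespace GorensteinDim

/-! ### Contractible complexes and the inequality Gfd ≤ fd. -/

section Contractible

variable {R : Type u} [Ring R]

lemma IsFlat.of_retract {X Y : ModuleCat.{u} R} (hX : IsFlat X) (i : Y ⟶ X) (r : X ⟶ Y)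
    (h : i ≫ r = 𝟙 Y) : IsFlat Y := by
  rw [isFlat_iff_injective_characterObj] at hX ⊢
  exact injective_of_retract hX (characterMap r) (characterMap i) (by
    rw [← characterMap_comp, h, characterMap_id])

/-- A contraction is preserved by every additive functor, so J ⊗ T is exact for every J, injective
or not. -/
lemma TotallyAcyclicFlat.of_contraction {T : RComplex R} (hT : ∀ i, IsFlat (T.X i))
    (s : ∀ i j, T.X i ⟶ T.X j)
    (hs : ∀ i j k, i + 1 = j → j + 1 = k → T.d j k ≫ s k j + s j i ≫ T.d i j = 𝟙 _) :
    TotallyAcyclicFlat T where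
  flat := hT
  acyclic := by
    rw [acyclic_iff_of_moduleCat]
    intro i j k hij hjk x hx
    have h1 := ConcreteCategory.congr_hom (hs i j k hij hjk) x
    have h2 : (T.d j k ≫ s k j) x = 0 := by
      rw [ModuleCat.comp_apply, hx, map_zero]
    refine ⟨s j i x, ?_⟩
    change (T.d j k ≫ s k j) x + (s j i ≫ T.d i j) x = x at h1
    rw [h2, zero_add] at h1
    exact h1
  tensor_acyclic J _ := by
    rw [tensor_acyclic_iff]
    intro i j k hij hjk f hf
    have key : ∀ f : J ⟶ characterObj (T.X (-j)), f ≫ characterMap (T.d (-k) (-j)) = 0 →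
        f ≫ characterMap (s (-i) (-j)) ≫ characterMap (T.d (-j) (-i)) = f := fun f h2 => by
      have h1 := congrArg (fun z => f ≫ characterMap z) (hs (-k) (-j) (-i) (by omega) (by omega))
      simp only [characterMap_add, characterMap_comp, characterMap_id, Preadditive.comp_add] at h1
      rw [← Category.assoc f (characterMap (T.d (-k) (-j))), h2, Limits.zero_comp, add_zero] at h1
      exact h1.trans (Category.comp_id f)
    exact ⟨f ≫ characterMap (s (-i) (-j)), (Category.assoc _ _ _).trans (key f hf)⟩

/-- The submodule that is everything in degrees `a` and `a + 1` and zero elsewhere. -/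
noncomputable def discSubmodule (X : Type u) [AddCommGroup X] [Module R X] (a j : ℤ) :
    Submodule R X :=
  if j = a ∨ j = a + 1 then ⊤ else ⊥

/-- Multiplication by `1` or `0` between the terms of the disc complex. -/
noncomputable def discMap (X : Type u) [AddCommGroup X] [Module R X] (a i j : ℤ) (P : Prop)
    [Decidable P] (hP : P → j = a ∨ j = a + 1) :
    discSubmodule (R := R) X a i →ₗ[R] discSubmodule (R := R) X a j where
  toFun x := ⟨if P then (x : X) else 0, by
    split_ifs with h
    · rw [discSubmodule, if_pos (hP h)]; trivial
    · exact zero_mem _⟩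
  map_add' x y := by
    ext
    by_cases h : P <;> simp [h]
  map_smul' r x := by
    ext
    by_cases h : P <;> simp [h]

lemma coe_eq_zero_of_mem_discSubmodule {X : Type u} [AddCommGroup X] [Module R X] {a j : ℤ}
    (h : ¬ (j = a ∨ j = a + 1)) (x : discSubmodule (R := R) X a j) : (x : X) = 0 := by
  have : discSubmodule (R := R) X a j = ⊥ := if_neg h
  exact (Submodule.mem_bot R).1 (this.le x.2)

/-- The contractible complex `X = X` concentrated in degrees `a` and `a + 1`. -/
noncomputable def disc (X : ModuleCat.{u} R) (a : ℤ) : RComplex R where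
  -- All terms are submodules of the single module X, so the differential and the contraction are
  -- "identity or zero" with no transport between degrees.
  X j := ModuleCat.of R (discSubmodule (R := R) X a j)
  d i j := ModuleCat.ofHom (discMap X a i j (i = a ∧ j = a + 1) (fun h => Or.inr h.2))
  shape i j hij := ModuleCat.hom_ext <| LinearMap.ext fun x => Subtype.ext <|
    if_neg fun h => hij (by simp [h.1, h.2])
  d_comp_d' i j k _ _ := ModuleCat.hom_ext <| LinearMap.ext fun x => Subtype.ext <| by
    change (if j = a ∧ k = a + 1 then (if i = a ∧ j = a + 1 then (x : X) else 0) else 0) = 0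
    split_ifs <;> first | rfl | omega

lemma totallyAcyclicFlat_disc {X : ModuleCat.{u} R} (hX : IsFlat X) (a : ℤ) :
    TotallyAcyclicFlat (disc X a) := by
  refine .of_contraction (fun j => ?_)
    (fun i j => ModuleCat.ofHom (discMap X a i j (i = a + 1 ∧ j = a) (fun h => Or.inl h.2))) ?_
  · refine hX.of_retract (ModuleCat.ofHom (discSubmodule (R := R) X a j).subtype)
      (ModuleCat.ofHom (X := X) (Y := discSubmodule (R := R) X a j)
        { toFun := fun x => ⟨if j = a ∨ j = a + 1 then x else 0, by
            split_ifs with h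
            · rw [discSubmodule, if_pos h]; trivial
            · exact zero_mem _⟩
          map_add' := fun x y => by
            ext
            by_cases h : j = a ∨ j = a + 1 <;> simp [h]
          map_smul' := fun r x => by
            ext
            by_cases h : j = a ∨ j = a + 1 <;> simp [h] }) ?_
    refine ModuleCat.hom_ext <| LinearMap.ext fun (x : discSubmodule (R := R) X a _) =>
      Subtype.ext ?_
    change (if j = a ∨ j = a + 1 then (x : X) else 0) = x
    split_ifs with h
    · rfl
    · exact (coe_eq_zero_of_mem_discSubmodule h x).symm
  · rintro i j k rfl rfl
    refine ModuleCat.hom_ext <| LinearMap.ext fun (x : discSubmodule (R := R) X a _) =>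
      Subtype.ext ?_
    change (if i + 1 + 1 = a + 1 ∧ i + 1 = a then
        (if i + 1 = a ∧ i + 1 + 1 = a + 1 then (x : X) else 0) else 0) +
      (if i = a ∧ i + 1 = a + 1 then (if i + 1 = a + 1 ∧ i = a then (x : X) else 0) else 0) = x
    have h0 := fun h => coe_eq_zero_of_mem_discSubmodule (a := a) (j := i + 1) h x
    split_ifs <;> first | omega | exact (add_zero _).trans (h0 (by omega)).symm | simp

/-- The disc lives in cohomological degrees -g and -g + 1. The truncation cuts off the second copy,
which leaves F_g alone, just as in F. -/
lemma nonempty_truncGE_disc_iso (F : RComplex R) (g : ℤ)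
    (hF : ∀ i : ℤ, g < i → Subsingleton (F.X (-i))) :
    Nonempty (truncGE (disc (F.X (-g)) (-g)) g ≅ truncGE F g) := by
  have hF' : ∀ j, j ≤ -g → j ≠ -g → Limits.IsZero (F.X j) := fun j hj hne => by
    have := hF (-j) (by omega)
    rw [neg_neg] at this
    exact ModuleCat.isZero_of_subsingleton _
  have hD : ∀ j, j ≤ -g → j ≠ -g → Limits.IsZero ((disc (F.X (-g)) (-g)).X j) := fun j hj hne => by
    have : Subsingleton (discSubmodule (R := R) (F.X (-g)) (-g) j) := by
      rw [discSubmodule, if_neg (by omega)]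
      infer_instance
    exact ModuleCat.isZero_of_subsingleton (ModuleCat.of R _)
  have htop : discSubmodule (R := R) (F.X (-g)) (-g) (-g) = ⊤ := if_pos (Or.inl rfl)
  let e₀ : (disc (F.X (-g)) (-g)).X (-g) ≅ F.X (-g) :=
    ((LinearEquiv.ofEq _ _ htop).trans Submodule.topEquiv).toModuleIso
  refine nonempty_truncGE_iso g (fun j hj => if h : j = -g then
    HomologicalComplex.XIsoOfEq _ h ≪≫ e₀ ≪≫ (F.XIsoOfEq h).symm else
    (hD j hj h).iso (hF' j hj h)) fun i j hi hj hij => ?_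
  exact (hD i hi (by omega)).eq_of_src _ _

lemma exists_gfd_of_fd {F M : RComplex R} (g : ℤ) (hF : SemiFlat F) (hFM : DerivedIso F M)
    (h : ∀ i : ℤ, g < i → Subsingleton (F.X (-i))) :
    ∃ T F : RComplex R, TotallyAcyclicFlat T ∧ SemiFlat F ∧ DerivedIso F M ∧
      Nonempty (truncGE T g ≅ truncGE F g) :=
  ⟨_, F, totallyAcyclicFlat_disc (hF.flat (-g)) (-g), hF, hFM, nonempty_truncGE_disc_iso F g h⟩

end Contractible

/-! ### Truncation with a cokernel in the boundary degree. -/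

section SmartTruncation

variable {R : Type u} [Ring R]

lemma d_d_apply (F : RComplex R) (i j k : ℤ) (x : F.X i) : F.d j k (F.d i j x) = 0 := by
  rw [← ModuleCat.comp_apply, F.d_comp_d]; rfl

/-- The subcomplex whose quotient is the truncation of `F` in degrees `≥ a`. -/
noncomputable def truncSubmodule (F : RComplex R) (a j : ℤ) : Submodule R (F.X j) :=
  if j < a then ⊤ else if j = a then LinearMap.range (F.d (j - 1) j).hom else ⊥

lemma truncSubmodule_le (F : RComplex R) (a i j : ℤ) :
    truncSubmodule F a i ≤ (truncSubmodule F a j).comap (F.d i j).hom := by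
  intro x hx
  rw [Submodule.mem_comap]
  by_cases hij : i + 1 = j
  · subst hij
    rcases lt_trichotomy i a with h | h | h
    · rcases lt_or_eq_of_le (show i + 1 ≤ a by omega) with h' | h'
      · rw [truncSubmodule, if_pos h']; trivial
      · rw [truncSubmodule, if_neg (by omega), if_pos h']
        have : i + 1 - 1 = i := by omega
        rw [this]
        exact ⟨x, rfl⟩
    · rw [truncSubmodule, if_neg (by omega), if_pos h] at hx
      obtain ⟨y, rfl⟩ := hx
      have : (F.d i (i + 1)).hom ((F.d (i - 1) i).hom y) = 0 := d_d_apply F _ _ _ y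
      rw [this]
      exact zero_mem _
    · rw [truncSubmodule, if_neg (by omega), if_neg (by omega), Submodule.mem_bot] at hx
      rw [hx, map_zero]
      exact zero_mem _
  · have : F.d i j = 0 := F.shape i j (by simpa using hij)
    rw [this]
    exact zero_mem _

/-- The truncation of `F` in cohomological degrees `≥ a`, with the cokernel of `F^(a-1) → F^a` in
degree `a`. -/
noncomputable def smartTrunc (F : RComplex R) (a : ℤ) : RComplex R where
  X j := ModuleCat.of R (F.X j ⧸ truncSubmodule F a j)
  d i j := ModuleCat.ofHom (Submodule.mapQ _ _ (F.d i j).hom (truncSubmodule_le F a i j))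
  shape i j hij := by
    ext x
    simp [F.shape i j hij]
  d_comp_d' i j k _ _ := by
    ext x
    have := d_d_apply F i j k x
    change Submodule.Quotient.mk (F.d j k (F.d i j x)) = _
    rw [this]
    rfl

/-- The projection onto the truncation. -/
noncomputable def πSmartTrunc (F : RComplex R) (a : ℤ) : F ⟶ smartTrunc F a where
  f j := ModuleCat.ofHom (truncSubmodule F a j).mkQ
  comm' i j _ := by ext x; rfl

lemma πSmartTrunc_surjective (F : RComplex R) (a j : ℤ) :
    Function.Surjective ((πSmartTrunc F a).f j) := Submodule.mkQ_surjective _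

lemma πSmartTrunc_eq_zero_iff (F : RComplex R) (a j : ℤ) (x : F.X j) :
    (πSmartTrunc F a).f j x = 0 ↔ x ∈ truncSubmodule F a j :=
  Submodule.Quotient.mk_eq_zero _

lemma subsingleton_smartTrunc (F : RComplex R) {a j : ℤ} (h : j < a) :
    Subsingleton ((smartTrunc F a).X j) := by
  have : truncSubmodule F a j = ⊤ := if_pos h
  exact Submodule.Quotient.subsingleton_iff.2 this

/-- The kernel of the projection is ⋯ → F^(a-1) → d(F^(a-1)) → 0, which is exact as soon as F is
exact in degrees below a. -/
lemma quasiIso_πSmartTrunc (F : RComplex R) (a : ℤ)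
    (hF : ∀ i j k, i + 1 = j → j + 1 = k → j < a → ∀ x, F.d j k x = 0 → ∃ y, F.d i j y = x) :
    QuasiIso (πSmartTrunc F a) := by
  rw [quasiIso_iff_of_moduleCat]
  intro i j k l hij hjk hkl x y hx hxy
  obtain ⟨y₀, rfl⟩ := πSmartTrunc_surjective F a j y
  change F.d k l x = 0 at hx
  have hxy' : (πSmartTrunc F a).f k x = (πSmartTrunc F a).f k (F.d j k y₀) := hxy
  have hmem : x - F.d j k y₀ ∈ truncSubmodule F a k := by
    rw [← πSmartTrunc_eq_zero_iff, map_sub, hxy', sub_self]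
  obtain ⟨w, hw, hw'⟩ : ∃ w, F.d j k w = x - F.d j k y₀ ∧ w ∈ truncSubmodule F a j := by
    rcases lt_trichotomy k a with h | h | h
    · obtain ⟨w, hw⟩ := hF j k l hjk hkl h (x - F.d j k y₀) (by
        rw [map_sub, hx, d_d_apply, sub_self])
      refine ⟨w, hw, ?_⟩
      rw [truncSubmodule, if_pos (by omega)]
      trivial
    · rw [truncSubmodule, if_neg (by omega), if_pos h] at hmem
      obtain rfl : j = k - 1 := by omega
      obtain ⟨w, hw⟩ := hmem
      refine ⟨w, hw, ?_⟩
      rw [truncSubmodule, if_pos (by omega)]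
      trivial
    · rw [truncSubmodule, if_neg (by omega), if_neg (by omega), Submodule.mem_bot] at hmem
      exact ⟨0, by rw [hmem, map_zero], zero_mem _⟩
  refine ⟨w + y₀, 0, ?_, ?_⟩
  · change F.d j k (w + y₀) = x
    rw [map_add, hw, sub_add_cancel]
  · change _ = (πSmartTrunc F a).f j (w + y₀) + _
    rw [map_add, (πSmartTrunc_eq_zero_iff F a j w).2 hw', map_zero]
    simp

/-- The dual of the projection is degreewise a monomorphism from an injective module, hence split.
Arbitrary splittings already form a chain map, since at each differential either the target vanishes
or the source component is an isomorphism. So the dual of the truncation is a retract of the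
semi-injective F⁺. -/
lemma semiFlat_smartTrunc {F : RComplex R} (hF : SemiFlat F) (a : ℤ)
    (hC : IsFlat ((smartTrunc F a).X a)) : SemiFlat (smartTrunc F a) := by
  have bij : ∀ j, a < j → Function.Injective ((πSmartTrunc F a).f j) := fun j hj => by
    refine (injective_iff_map_eq_zero ((πSmartTrunc F a).f j).hom).2 fun x hx => ?_
    have := (πSmartTrunc_eq_zero_iff F a j x).1 hx
    rwa [truncSubmodule, if_neg (by omega), if_neg (by omega), Submodule.mem_bot] at this
  have flat : ∀ j, IsFlat ((smartTrunc F a).X j) := by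
    intro j
    rcases lt_trichotomy j a with h | rfl | h
    · have := subsingleton_smartTrunc F h
      refine (hF.flat j).of_retract 0 0 ?_
      ext x
      exact Subsingleton.elim _ _
    · exact hC
    · have : IsIso ((πSmartTrunc F a).f j) := (ConcreteCategory.isIso_iff_bijective _).2
        ⟨bij j h, πSmartTrunc_surjective F a j⟩
      exact (hF.flat j).of_retract (inv ((πSmartTrunc F a).f j)) ((πSmartTrunc F a).f j) (by simp)
  have inj := (isFlat_iff_injective_characterComplex _).1 flat
  rw [semiFlat_iff] at hF ⊢
  have mono : ∀ i, Mono ((characterComplexMap (πSmartTrunc F a)).f i) := fun i =>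
    (ModuleCat.mono_iff_injective _).2 (characterMap_injective _ (πSmartTrunc_surjective F a (-i)))
  let r : ∀ i, (characterComplex F).X i ⟶ (characterComplex (smartTrunc F a)).X i := fun i =>
    Injective.factorThru (𝟙 _) ((characterComplexMap (πSmartTrunc F a)).f i)
  have hr : ∀ i, (characterComplexMap (πSmartTrunc F a)).f i ≫ r i = 𝟙 _ := fun i =>
    Injective.comp_factorThru _ _
  refine hF.of_retract (characterComplexMap (πSmartTrunc F a))
    { f := r, comm' := fun i j hij => ?_ } (by ext i : 1; exact hr i)
  have hij : i + 1 = j := hij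
  rcases lt_or_ge (-j) a with h | h
  · have hz : Limits.IsZero ((characterComplex (smartTrunc F a)).X j) := by
      have := subsingleton_smartTrunc F h
      have : Subsingleton ((characterComplex (smartTrunc F a)).X j) :=
        ⟨fun φ ψ => characterObj_ext fun x => by
          rw [Subsingleton.elim x 0, map_zero, map_zero]⟩
      exact ModuleCat.isZero_of_subsingleton _
    exact hz.eq_of_tgt _ _
  · have hepi : IsIso ((πSmartTrunc F a).f (-i)) := (ConcreteCategory.isIso_iff_bijective _).2
      ⟨bij (-i) (by omega), πSmartTrunc_surjective F a (-i)⟩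
    have hsurj : Epi ((characterComplexMap (πSmartTrunc F a)).f i) := by
      refine (ModuleCat.epi_iff_surjective _).2 fun φ =>
        ⟨characterMap (inv ((πSmartTrunc F a).f (-i))) φ, ?_⟩
      change (characterMap _ ≫ characterMap _) φ = φ
      rw [← characterMap_comp, IsIso.hom_inv_id]
      rfl
    rw [← cancel_epi ((characterComplexMap (πSmartTrunc F a)).f i), ← Category.assoc, hr,
      Category.id_comp, ← Category.assoc, (characterComplexMap (πSmartTrunc F a)).comm,
      Category.assoc, hr, Category.comp_id]

end SmartTruncation

/-! ### Finite flat dimension: equality of fd and Gfd. -/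

section FlatDimension

variable {R : Type u} [Ring R]

lemma isIso_characterMap_hom {X Y : ModuleCat.{u} R} (e : X ≅ Y) : IsIso (characterMap e.hom) :=
  ⟨characterMap e.inv, by rw [← characterMap_comp, Iso.inv_hom_id]; rfl,
    by rw [← characterMap_comp, Iso.hom_inv_id]; rfl⟩

lemma homExactAt_of_truncGE_iso {T F : RComplex R} (hT : TotallyAcyclicFlat T) {g : ℤ}
    (e : truncGE T g ≅ truncGE F g) (J : ModuleCat.{u} Rᵐᵒᵖ)
    (hJ : Injective J ∨ J = ModuleCat.of Rᵐᵒᵖ Rᵐᵒᵖ) {i j k : ℤ} (hi : g ≤ i) (hij : i + 1 = j)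
    (hjk : j + 1 = k) : HomExactAt J (characterComplex F) i j k := by
  obtain ⟨e, he⟩ := exists_iso_of_truncGE_iso g e
  have hT' := (totallyAcyclicFlat_iff T).1 hT
  let u : ∀ i, g ≤ i → ((characterComplex F).X i ⟶ (characterComplex T).X i) := fun i hi =>
    characterMap (e (-i) (by omega)).hom
  have iso : ∀ i hi, IsIso (u i hi) := fun i hi => isIso_characterMap_hom _
  have hi' := iso i (by omega)
  have hj' := iso j (by omega)
  refine HomExactAt.of_isIso (U := characterComplex T) J (u i (by omega)) (u j (by omega))
    (u k (by omega)) ?_ ?_ (hT'.homExactAt J hJ hij hjk)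
  · change characterMap _ ≫ characterMap _ = characterMap _ ≫ characterMap _
    rw [← characterMap_comp, ← characterMap_comp, he _ _ _ _ (by omega)]
  · change characterMap _ ≫ characterMap _ = characterMap _ ≫ characterMap _
    rw [← characterMap_comp, ← characterMap_comp, he _ _ _ _ (by omega)]

lemma exact_of_homExactAt_characterComplex {F : RComplex R} {i j k : ℤ}
    (h : HomExactAt (ModuleCat.of Rᵐᵒᵖ Rᵐᵒᵖ) (characterComplex F) (-k) (-j) (-i))
    (x : F.X j) (hx : F.d j k x = 0) : ∃ y, F.d i j y = x := by
  rw [homExactAt_self_iff] at h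
  refine ((exact_iff_character_exact (F.d i j).hom.toAddMonoidHom
    (F.d j k).hom.toAddMonoidHom).2 (fun χ => ?_) x).1 hx
  obtain ⟨i, rfl⟩ : ∃ i', i = -i' := ⟨-i, by simp⟩
  obtain ⟨j, rfl⟩ : ∃ i', j = -i' := ⟨-j, by simp⟩
  obtain ⟨k, rfl⟩ : ∃ i', k = -i' := ⟨-k, by simp⟩
  rw [neg_neg, neg_neg, neg_neg] at h
  refine ⟨fun hχ => h χ hχ, ?_⟩
  rintro ⟨ψ, rfl⟩
  exact AddMonoidHom.ext fun x => (congrArg ψ (d_d_apply _ _ _ _ x)).trans (map_zero _)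

/-- Descending induction from degree n, beyond which I vanishes and s = 0 works. If d s d = d one
degree higher, then 1 - d s is a cocycle in Hom(J, I) for the injective term J, so 1 - d s = y d,
and multiplying by the preceding differential gives d = d y d. -/
lemma exists_splitting {S : Type u} [Ring S] {I : RComplex S} (hI : ∀ i, Injective (I.X i))
    (g n : ℤ) (hn : ∀ i, n < i → Subsingleton (I.X i))
    (h : ∀ J : ModuleCat.{u} S, Injective J → ∀ i j k, g ≤ i → i + 1 = j → j + 1 = k →
      HomExactAt J I i j k) :
    ∃ s : I.X (g + 1) ⟶ I.X g, I.d g (g + 1) ≫ s ≫ I.d g (g + 1) = I.d g (g + 1) := by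
  have key : ∀ (m : ℕ) (i : ℤ), g ≤ i → n ≤ i + m →
      ∃ s : I.X (i + 1) ⟶ I.X i, I.d i (i + 1) ≫ s ≫ I.d i (i + 1) = I.d i (i + 1) := by
    intro m
    induction m with
    | zero =>
      intro i _ hi
      have := hn (i + 1) (by omega)
      refine ⟨0, ?_⟩
      ext x
      exact Subsingleton.elim _ _
    | succ m ih =>
      intro i hgi hi
      obtain ⟨s, hs⟩ := ih (i + 1) (by omega) (by push_cast at hi; omega)
      obtain ⟨y, hy⟩ := h (I.X (i + 1)) (hI _) i (i + 1) (i + 1 + 1) hgi rfl rfl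
        (𝟙 _ - I.d _ _ ≫ s) (by
          rw [Preadditive.sub_comp, Category.id_comp, Category.assoc, hs, sub_self])
      refine ⟨y, ?_⟩
      rw [hy, Preadditive.comp_sub, Category.comp_id, ← Category.assoc, I.d_comp_d,
        Limits.zero_comp, sub_zero]
  exact key (n - g).toNat g le_rfl (by omega)

lemma exists_fd_of_gfd {F T F' M : RComplex R} (g n : ℤ) (hF : SemiFlat F) (hFM : DerivedIso F M)
    (hFn : ∀ i : ℤ, n < i → Subsingleton (F.X (-i))) (hT : TotallyAcyclicFlat T)
    (hF' : SemiFlat F') (hF'M : DerivedIso F' M) (e : truncGE T g ≅ truncGE F' g) :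
    ∃ F : RComplex R, SemiFlat F ∧ DerivedIso F M ∧
      ∀ i : ℤ, g < i → Subsingleton (F.X (-i)) := by
  obtain ⟨E⟩ := hF.nonempty_homotopyEquiv hF' hFM hF'M
  have hex : ∀ J : ModuleCat.{u} Rᵐᵒᵖ, (Injective J ∨ J = ModuleCat.of Rᵐᵒᵖ Rᵐᵒᵖ) → ∀ i j k,
      g ≤ i → i + 1 = j → j + 1 = k → HomExactAt J (characterComplex F) i j k :=
    fun J hJ i j k hi hij hjk => HomExactAt.of_homotopyEquiv E J hij hjk
      (homExactAt_of_truncGE_iso hT e J hJ hi hij hjk)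
  have hI := ((semiFlat_iff F).1 hF).injective
  obtain ⟨s, hs⟩ := exists_splitting hI g n (fun i hi => by
      have := hFn i hi
      exact ⟨fun φ ψ => characterObj_ext fun x => by rw [Subsingleton.elim x 0, map_zero, map_zero]⟩)
    (fun J hJ i j k hi hij hjk => hex J (Or.inl hJ) i j k hi hij hjk)
  have hflat : IsFlat ((smartTrunc F (-g)).X (-g)) := by
    rw [isFlat_iff_injective_characterObj]
    -- Through p, the character module of the cokernel becomes the kernel of d in degree g of F⁺.
    let p : characterObj ((smartTrunc F (-g)).X (-g)) ⟶ (characterComplex F).X g :=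
      characterMap ((πSmartTrunc F (-g)).f (-g))
    have hp : p ≫ (characterComplex F).d g (g + 1) = 0 := by
      change characterMap _ ≫ characterMap _ = 0
      rw [← characterMap_comp]
      rw [show F.d (-(g + 1)) (-g) ≫ (πSmartTrunc F (-g)).f (-g) = 0 from ?_, characterMap_zero]
      ext x
      refine (πSmartTrunc_eq_zero_iff F (-g) (-g) _).2 ?_
      rw [truncSubmodule, if_neg (by omega), if_pos rfl]
      have : -(g + 1) = -g - 1 := by omega
      rw [← this]
      exact ⟨x, rfl⟩
    have hmono : Mono p :=
      (ModuleCat.mono_iff_injective _).2 (characterMap_injective _ (πSmartTrunc_surjective F _ _))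
    have hexact : (ShortComplex.mk p _ hp).Exact := by
      rw [ShortComplex.moduleCat_exact_iff]
      refine fun φ hφ => characterMap_exact (F.d (-(g + 1)) (-g)) _ (fun y hy => ?_) φ hφ
      have := (πSmartTrunc_eq_zero_iff F (-g) (-g) y).1 hy
      rw [truncSubmodule, if_neg (by omega), if_pos rfl] at this
      have h : -(g + 1) = -g - 1 := by omega
      rw [h]
      exact this
    have : Mono (ShortComplex.mk p _ hp).f := hmono
    -- Since d s d = d, the endomorphism 1 - d s has image in the kernel of d and is the identity on
    -- that kernel, which is therefore a retract of an injective module.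
    refine injective_of_retract (hI g) p (hexact.lift (𝟙 _ - (characterComplex F).d g (g + 1) ≫ s) (by
      rw [Preadditive.sub_comp, Category.id_comp]
      refine sub_eq_zero.2 ?_
      rw [Category.assoc]
      exact hs.symm)) ?_
    rw [← cancel_mono p, Category.assoc]
    have := hexact.lift_f (𝟙 _ - (characterComplex F).d g (g + 1) ≫ s) (by
      rw [Preadditive.sub_comp, Category.id_comp]
      refine sub_eq_zero.2 ?_
      rw [Category.assoc]
      exact hs.symm)
    refine (congrArg (p ≫ ·) this).trans ?_
    rw [Preadditive.comp_sub, Category.comp_id, ← Category.assoc, hp, Limits.zero_comp, sub_zero,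
      Category.id_comp]
  refine ⟨smartTrunc F (-g), semiFlat_smartTrunc hF _ hflat, ?_, fun i hi =>
    subsingleton_smartTrunc F (by omega)⟩
  obtain ⟨L, f, f', hf, hf'⟩ := hFM
  -- Hom-exactness for J = Rᵐᵒᵖ is exactness of F⁺ above degree g, that is, of F below cohomological
  -- degree -g.
  have hπ := quasiIso_πSmartTrunc F (-g) fun i j k hij hjk hj x hx =>
    exact_of_homExactAt_characterComplex (hex _ (Or.inr rfl) (-k) (-j) (-i) (by omega) (by omega)
      (by omega)) x hx
  exact ⟨L, f ≫ πSmartTrunc F (-g), f', inferInstance, hf'⟩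

end FlatDimension

/-! ### The inequality Gid ≤ Gfd. -/

section GorensteinInjective

variable {R : Type u} [Ring R]

/-- The dual of the flat data is the injective data: F⁺ is K-injective, so the derived isomorphism
M⁺ ≅ F⁺ is one chain map, and total acyclicity of T⁺ extends the dual isomorphisms below degree g.
-/
lemma exists_gid_of_gfd {T F M : RComplex R} (g : ℤ) (hT : TotallyAcyclicFlat T)
    (hF : SemiFlat F) (hFM : DerivedIso F M) (e : truncGE T g ≅ truncGE F g) :
    ∃ (I U : RComplex Rᵐᵒᵖ) (ι : characterComplex M ⟶ I) (υ : I ⟶ U),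
      SemiInjective I ∧ QuasiIso ι ∧ TotallyAcyclicInjective U ∧
        ∀ i : ℤ, g ≤ i → Function.Bijective (υ.f i) := by
  obtain ⟨ι, hι⟩ := hF.exists_quasiIso hFM
  have hI := (semiFlat_iff F).1 hF
  have hU := (totallyAcyclicFlat_iff T).1 hT
  obtain ⟨e, he⟩ := exists_iso_of_truncGE_iso g e
  let u : ∀ i, (characterComplex F).X i ⟶ (characterComplex T).X i := fun i =>
    if h : g ≤ i then (characterMap (e (-i) (by omega)).hom) else 0
  have hu : ∀ i (h : g ≤ i), u i = characterMap (e (-i) (by omega)).hom := fun i h => dif_pos h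
  obtain ⟨υ, hυ⟩ := exists_hom_of_homExactAt (characterComplex F) (characterComplex T) g u
    (fun i j hi hij => by
      rw [hu i hi, hu j (by omega)]
      change characterMap _ ≫ characterMap _ = characterMap _ ≫ characterMap _
      rw [← characterMap_comp, ← characterMap_comp, he _ _ _ _ (by omega)])
    (fun i j k _ hij hjk => hU.homExactAt _ (Or.inl (hI.injective i)) hij hjk)
  refine ⟨_, _, ι, υ, hI, hι, hU, fun i hi => ?_⟩
  rw [hυ i hi, hu i hi]
  exact (ConcreteCategory.isIso_iff_bijective _).1 (isIso_characterMap_hom (e (-i) _))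

end GorensteinInjective

end GorensteinDim

namespace GorensteinDim

/-! ### Characters of right modules; projective modules are flat. -/

section LeftCharacter

variable {R : Type u} [Ring R]

/-- The left `R`-module structure on `Hom_ℤ(X, ℚ/ℤ)` for a right `R`-module `X`. -/
abbrev characterModuleLeft (X : Type u) [AddCommGroup X] [Module Rᵐᵒᵖ X] :
    Module R (CharacterModule X) where
  smul r φ := AddMonoidHom.comp (φ : X →+ AddCircle (1 : ℚ))
    (DistribSMul.toAddMonoidHom X (MulOpposite.op r))
  one_smul φ := CharacterModule.ext X fun x => congrArg φ (one_smul Rᵐᵒᵖ x)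
  mul_smul r s φ := CharacterModule.ext X fun x =>
    congrArg φ (mul_smul (MulOpposite.op s) (MulOpposite.op r) x)
  smul_zero _ := rfl
  smul_add _ _ _ := rfl
  add_smul r s φ := CharacterModule.ext X fun x =>
    (congrArg φ (add_smul (MulOpposite.op r) (MulOpposite.op s) x)).trans (map_add φ _ _)
  zero_smul φ := CharacterModule.ext X fun x =>
    (congrArg φ (zero_smul Rᵐᵒᵖ x)).trans (map_zero φ)

/-- The left `R`-module `Hom_ℤ(X, ℚ/ℤ)` for a right `R`-module `X`. -/
def leftCharacterObj (X : ModuleCat.{u} Rᵐᵒᵖ) : ModuleCat.{u} R :=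
  @ModuleCat.of R _ (CharacterModule X) _ (characterModuleLeft X)

/-- An element of the left module `Hom_ℤ(X, ℚ/ℤ)` viewed as a homomorphism. -/
def leftToCharacter {X : ModuleCat.{u} Rᵐᵒᵖ} (φ : leftCharacterObj X) :
    X →+ AddCircle (1 : ℚ) := φ

/-- A homomorphism `X → ℚ/ℤ` viewed as an element of the left module `Hom_ℤ(X, ℚ/ℤ)`. -/
def leftOfCharacter {X : ModuleCat.{u} Rᵐᵒᵖ} (φ : X →+ AddCircle (1 : ℚ)) :
    leftCharacterObj X := φ

lemma leftCharacterObj_ext {X : ModuleCat.{u} Rᵐᵒᵖ} {φ ψ : leftCharacterObj X}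
    (h : ∀ x, leftToCharacter φ x = leftToCharacter ψ x) : φ = ψ :=
  CharacterModule.ext X h

/-- The homomorphism `Hom_ℤ(f, ℚ/ℤ)` of left modules. -/
def leftCharacterMap {X Y : ModuleCat.{u} Rᵐᵒᵖ} (f : X ⟶ Y) :
    leftCharacterObj Y ⟶ leftCharacterObj X :=
  letI := characterModuleLeft (R := R) X
  letI := characterModuleLeft (R := R) Y
  ModuleCat.ofHom (X := CharacterModule Y) (Y := CharacterModule X)
    { toFun := fun φ => AddMonoidHom.comp (φ : Y →+ AddCircle (1 : ℚ)) f.hom.toAddMonoidHom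
      map_add' := fun _ _ => rfl
      map_smul' := fun r φ => CharacterModule.ext X fun x =>
        congrArg φ (f.hom.map_smul (MulOpposite.op r) x).symm }

lemma leftCharacterMap_surjective {X Y : ModuleCat.{u} Rᵐᵒᵖ} (f : X ⟶ Y)
    (hf : Function.Injective f) : Function.Surjective (leftCharacterMap f) := fun φ => by
  obtain ⟨ψ, hψ⟩ := exists_character_comp_eq f.hom.toAddMonoidHom (leftToCharacter φ) fun x hx => by
    rw [hf (hx.trans (map_zero f.hom).symm), map_zero]
  exact ⟨leftOfCharacter ψ, leftCharacterObj_ext hψ⟩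

lemma leftCharacterMap_exact {X Y Z : ModuleCat.{u} Rᵐᵒᵖ} (f : X ⟶ Y) (g : Y ⟶ Z)
    (hfg : ∀ y, g y = 0 → ∃ x, f x = y) (φ : leftCharacterObj Y) (h : leftCharacterMap f φ = 0) :
    ∃ ψ, leftCharacterMap g ψ = φ := by
  obtain ⟨ψ, hψ⟩ := exists_character_comp_eq g.hom.toAddMonoidHom (leftToCharacter φ) fun y hy => by
    obtain ⟨x, rfl⟩ := hfg y hy
    exact DFunLike.congr_fun (congrArg leftToCharacter h) x
  exact ⟨leftOfCharacter ψ, leftCharacterObj_ext hψ⟩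

/-- Homomorphisms `X → Hom_ℤ(Y, ℚ/ℤ)` of right modules correspond to homomorphisms
`Y → Hom_ℤ(X, ℚ/ℤ)` of left modules. -/
def characterSwap (X : ModuleCat.{u} Rᵐᵒᵖ) (Y : ModuleCat.{u} R) :
    (X ⟶ characterObj Y) ≃ (Y ⟶ leftCharacterObj X) where
  toFun f := ModuleCat.ofHom (X := (Y : Type u)) (Y := (leftCharacterObj X : Type u))
    { toFun := fun y => leftOfCharacter
        { toFun := fun x => toCharacter (f x) y
          map_zero' := by rw [map_zero, toCharacter_zero]
          map_add' := fun x x' => by rw [map_add, toCharacter_add] }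
      map_add' := fun y y' => leftCharacterObj_ext fun x => map_add (toCharacter (f x)) y y'
      map_smul' := fun r y => leftCharacterObj_ext fun x => by
        have := congrArg (fun φ => toCharacter φ y) (f.hom.map_smul (MulOpposite.op r) x)
        exact this.symm }
  invFun f := ModuleCat.ofHom (X := (X : Type u)) (Y := (characterObj Y : Type u))
    { toFun := fun x => ofCharacter
        { toFun := fun y => leftToCharacter (f y) x
          map_zero' := by rw [map_zero]; rfl
          map_add' := fun y y' => by rw [map_add]; rfl }
      map_add' := fun x x' => characterObj_ext fun y => map_add (leftToCharacter (f y)) x x'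
      map_smul' := fun r x => characterObj_ext fun y => by
        have := congrArg (fun φ => leftToCharacter φ x) (f.hom.map_smul r.unop y)
        exact this.symm }
  left_inv f := rfl
  right_inv f := rfl

/-- `characterSwap` turns extension of a map into P⁺ along a monomorphism g into lifting a map from
P along the epimorphism g⁺. -/
lemma isFlat_of_projective {P : ModuleCat.{u} R} (hP : Projective P) : IsFlat P := by
  rw [isFlat_iff_injective_characterObj]
  refine ⟨fun {A B} f g hg => ?_⟩
  have : Epi (leftCharacterMap g) := (ModuleCat.epi_iff_surjective _).2
    (leftCharacterMap_surjective g ((ModuleCat.mono_iff_injective g).1 hg))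
  refine ⟨(characterSwap B P).symm
    (Projective.factorThru (characterSwap A P f) (leftCharacterMap g)), ?_⟩
  apply (characterSwap A P).injective
  exact Projective.factorThru_comp (characterSwap A P f) (leftCharacterMap g)

end LeftCharacter

/-! ### Semi-free resolutions of unbounded complexes from an inductive type of generators. -/

section SemiFree

variable {R : Type u} [Ring R]

/-- Formal generators of a semi-free resolution of `M`: a generator of degree `n` consists of its
image in `M` and of a formal linear combination of generators of degree `n + 1`, its boundary. -/
inductive RawGenerator (M : RComplex R) : ℤ → Type u
  | mk {n : ℤ} (m : M.X n) (k : ℕ) (r : Fin k → R) (b : Fin k → RawGenerator M (n + 1)) :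
      RawGenerator M n

namespace RawGenerator

variable {M : RComplex R}

/-- The image of a formal generator in `M`. -/
def value : ∀ {n : ℤ}, RawGenerator M n → M.X n
  | _, mk m _ _ _ => m

/-- The boundary of a formal generator. -/
noncomputable def boundary : ∀ {n : ℤ}, RawGenerator M n → (RawGenerator M (n + 1) →₀ R)
  | _, mk _ _ r b => ∑ i, Finsupp.single (b i) (r i)

variable (M) in
/-- The boundary of linear combinations of formal generators. -/
noncomputable def boundaryMap (n : ℤ) :
    (RawGenerator M n →₀ R) →ₗ[R] (RawGenerator M (n + 1) →₀ R) :=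
  Finsupp.linearCombination R boundary

variable (M) in
/-- The image in `M` of linear combinations of formal generators. -/
noncomputable def valueMap (n : ℤ) : (RawGenerator M n →₀ R) →ₗ[R] M.X n :=
  Finsupp.linearCombination R value

/-- A formal generator is valid if its boundary is a cycle of valid generators whose image is the
boundary of its image. -/
def Valid : ∀ {n : ℤ}, RawGenerator M n → Prop
  | n, mk m _ r b => (∀ i, Valid (b i)) ∧
      boundaryMap M (n + 1) (∑ i, Finsupp.single (b i) (r i)) = 0 ∧
      valueMap M (n + 1) (∑ i, Finsupp.single (b i) (r i)) = M.d n (n + 1) m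

end RawGenerator

open RawGenerator

/-- The generators of the semi-free resolution of `M`. -/
abbrev Generator (M : RComplex R) (n : ℤ) : Type u := {b : RawGenerator M n // b.Valid}

variable {M : RComplex R}

/-- The boundary of a generator as a linear combination of generators. -/
noncomputable def Generator.boundary : ∀ {n : ℤ}, Generator M n → (Generator M (n + 1) →₀ R)
  | _, ⟨mk _ _ r b, h⟩ => ∑ i, Finsupp.single ⟨b i, h.1 i⟩ (r i)

variable (M) in
/-- Linear combinations of generators as linear combinations of formal generators. -/
noncomputable def Generator.toRaw (n : ℤ) :
    (Generator M n →₀ R) →ₗ[R] (RawGenerator M n →₀ R) :=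
  Finsupp.lmapDomain R R Subtype.val

/-- Validity is defined by recursion and can refer only to raw combinations. This injectivity brings
the identity ∂∂ = 0 back to combinations of valid generators. -/
lemma Generator.toRaw_injective (n : ℤ) : Function.Injective (Generator.toRaw M n) :=
  Finsupp.mapDomain_injective Subtype.val_injective

@[simp]
lemma Generator.toRaw_single {n : ℤ} (b : Generator M n) (r : R) :
    Generator.toRaw M n (Finsupp.single b r) = Finsupp.single b.1 r :=
  Finsupp.mapDomain_single

lemma Generator.toRaw_boundary {n : ℤ} (b : Generator M n) :
    Generator.toRaw M (n + 1) b.boundary = b.1.boundary := by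
  obtain ⟨⟨m, k, r, b⟩, h⟩ := b
  simp [Generator.boundary, RawGenerator.boundary]

lemma Generator.boundaryMap_boundary {n : ℤ} (b : Generator M n) :
    boundaryMap M (n + 1) b.1.boundary = 0 := by
  obtain ⟨⟨m, k, r, b⟩, h⟩ := b
  exact h.2.1

lemma Generator.valueMap_boundary {n : ℤ} (b : Generator M n) :
    valueMap M (n + 1) b.1.boundary = M.d n (n + 1) b.1.value := by
  obtain ⟨⟨m, k, r, b⟩, h⟩ := b
  exact h.2.2

variable (M) in
/-- The differential of the semi-free resolution. -/
noncomputable def semiFreeD (n : ℤ) :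
    (Generator M n →₀ R) →ₗ[R] (Generator M (n + 1) →₀ R) :=
  Finsupp.linearCombination R Generator.boundary

lemma toRaw_semiFreeD (n : ℤ) (x : Generator M n →₀ R) :
    Generator.toRaw M (n + 1) (semiFreeD M n x) = boundaryMap M n (Generator.toRaw M n x) := by
  have : Generator.toRaw M (n + 1) ∘ₗ semiFreeD M n = boundaryMap M n ∘ₗ Generator.toRaw M n := by
    ext1 b
    ext1
    simp [semiFreeD, boundaryMap, Generator.toRaw_boundary]
  exact LinearMap.congr_fun this x

lemma semiFreeD_comp (n : ℤ) : semiFreeD M (n + 1) ∘ₗ semiFreeD M n = 0 := by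
  ext1 b
  ext1
  refine Generator.toRaw_injective _ ?_
  simp only [LinearMap.comp_apply, Finsupp.lsingle_apply]
  rw [toRaw_semiFreeD, toRaw_semiFreeD]
  simp [boundaryMap]
  exact b.boundaryMap_boundary

variable (M) in
/-- The semi-free resolution of `M`. -/
noncomputable def semiFree : RComplex R :=
  CochainComplex.of (fun n => ModuleCat.of R (Generator M n →₀ R))
    (fun n => ModuleCat.ofHom (semiFreeD M n))
    (fun n => by rw [← ModuleCat.ofHom_comp, semiFreeD_comp]; rfl)

lemma semiFree_d (n : ℤ) : (semiFree M).d n (n + 1) = ModuleCat.ofHom (semiFreeD M n) :=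
  CochainComplex.of_d (fun n => ModuleCat.of R (Generator M n →₀ R))
    (fun n => ModuleCat.ofHom (semiFreeD M n)) n

lemma projective_semiFree (n : ℤ) : Projective ((semiFree M).X n) :=
  (IsProjective.iff_projective (Generator M n →₀ R)).1 inferInstance

variable (M) in
/-- The resolution `semiFree M → M`. -/
noncomputable def semiFreeπ : semiFree M ⟶ M where
  f n := ModuleCat.ofHom (valueMap M n ∘ₗ Generator.toRaw M n)
  comm' i j hij := by
    obtain rfl : i + 1 = j := hij
    rw [semiFree_d]
    refine ModuleCat.hom_ext <| Finsupp.lhom_ext fun b r => ?_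
    change M.d i (i + 1) (valueMap M i (Generator.toRaw M i (Finsupp.single b r))) =
      valueMap M (i + 1) (Generator.toRaw M (i + 1) (semiFreeD M i (Finsupp.single b r)))
    rw [toRaw_semiFreeD]
    simp [boundaryMap, valueMap]
    rw [← b.valueMap_boundary]
    rfl

lemma exists_eq_sum_single {ι A : Type*} [AddCommMonoid A] (x : ι →₀ A) :
    ∃ (c : ℕ) (b : Fin c → ι) (r : Fin c → A), x = ∑ i, Finsupp.single (b i) (r i) := by
  refine ⟨_, fun i => (x.support.equivFin.symm i).1, fun i => x (x.support.equivFin.symm i).1, ?_⟩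
  rw [Equiv.sum_comp x.support.equivFin.symm (fun b => Finsupp.single b.1 (x b.1)),
    Finset.sum_coe_sort x.support (fun b => Finsupp.single b (x b))]
  exact (Finsupp.sum_single x).symm

/-- A cycle x together with y such that the value of x is d y is exactly the data of a valid
generator with boundary x and value y. That one generator solves the cone condition, with correction
term 0. -/
lemma quasiIso_semiFreeπ : QuasiIso (semiFreeπ M) := by
  rw [quasiIso_iff_of_moduleCat]
  rintro i j k l hij rfl rfl x y hx hxy
  change (semiFree M).d (j + 1) (j + 1 + 1) x = 0 at hx
  change (semiFreeπ M).f (j + 1) x = M.d j (j + 1) y at hxy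
  rw [semiFree_d] at hx
  replace hx : semiFreeD M (j + 1) x = 0 := hx
  replace hxy : valueMap M (j + 1) (Generator.toRaw M (j + 1) x) = M.d j (j + 1) y := hxy
  obtain ⟨c, b, r, rfl⟩ : ∃ (c : ℕ) (b : Fin c → Generator M (j + 1)) (r : Fin c → R),
      x = ∑ i, Finsupp.single (b i) (r i) := exists_eq_sum_single (ι := Generator M (j + 1)) x
  have hraw : Generator.toRaw M (j + 1) (∑ i, Finsupp.single (b i) (r i)) =
      ∑ i, Finsupp.single (b i).1 (r i) := by simp
  let g : Generator M j := ⟨mk y c r fun i => (b i).1, fun i => (b i).2, by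
    rw [← hraw, ← toRaw_semiFreeD, hx, map_zero], by rw [← hraw, hxy]⟩
  refine ⟨(Finsupp.single g 1 : Generator M j →₀ R), 0, ?_, ?_⟩
  · change (semiFree M).d j (j + 1) (Finsupp.single g 1 : Generator M j →₀ R) = _
    rw [semiFree_d]
    change semiFreeD M j (Finsupp.single g 1) = _
    simp [semiFreeD]
    rfl
  · rw [map_zero, add_zero]
    change _ = valueMap M j (Generator.toRaw M j (Finsupp.single g 1))
    simp [valueMap]
    rfl

end SemiFree

end GorensteinDim

namespace GorensteinDim

/-! ### Null homotopies by recursion on generators. -/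

section NullHomotopy

variable {R : Type u} [Ring R]

lemma nonempty_homotopy_zero_of_components {K L : RComplex R} (φ : K ⟶ L)
    (s : ∀ i j, K.X j ⟶ L.X i) (hs : ∀ i j k, i + 1 = j → j + 1 = k →
      φ.f j = K.d j k ≫ s j k + s i j ≫ L.d i j) : Nonempty (Homotopy φ 0) :=
  ⟨{ hom := fun j i => if i + 1 = j then s i j else 0
     zero := fun j i hij => if_neg hij
     comm := fun j => by
      rw [dNext_eq _ (show (ComplexShape.up ℤ).Rel j (j + 1) from rfl),
        prevD_eq _ (show (ComplexShape.up ℤ).Rel (j - 1) j from sub_add_cancel j 1),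
        if_pos rfl, if_pos (sub_add_cancel j 1), HomologicalComplex.zero_f, add_zero]
      exact hs _ _ _ (sub_add_cancel j 1) rfl }⟩

/-- The homomorphism `Fⁿ → Hom_ℤ(Aʲ, ℚ/ℤ)`, where `n = -j`, that corresponds to a morphism
from `A` to the character complex of `F`. -/
noncomputable def swapComponent {A : RComplex Rᵐᵒᵖ} {F : RComplex R} (φ : A ⟶ characterComplex F)
    (n j : ℤ) (h : n = -j) : F.X n ⟶ leftCharacterObj (A.X j) :=
  (F.XIsoOfEq h).hom ≫ characterSwap (A.X j) (F.X (-j)) (φ.f j)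

lemma swapComponent_self {A : RComplex Rᵐᵒᵖ} {F : RComplex R} (φ : A ⟶ characterComplex F)
    (j : ℤ) : swapComponent φ (-j) j rfl = characterSwap (A.X j) (F.X (-j)) (φ.f j) := by
  simp [swapComponent]

lemma swapComponent_comm {A : RComplex Rᵐᵒᵖ} {F : RComplex R} (φ : A ⟶ characterComplex F)
    (n n' i j : ℤ) (h : n = -j) (h' : n' = -i) :
    swapComponent φ n j h ≫ leftCharacterMap (A.d i j) = F.d n n' ≫ swapComponent φ n' i h' := by
  subst h h'
  rw [swapComponent_self, swapComponent_self]
  exact congrArg (characterSwap (A.X i) (F.X (-j))) (φ.comm i j).symm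

open RawGenerator

variable {M : RComplex R} (A : RComplex Rᵐᵒᵖ)
  (Φ : ∀ n, RawGenerator M n → ∀ j, leftCharacterObj (A.X j))

open Classical in
/-- A null homotopy, constructed by recursion on formal generators. -/
noncomputable def contraction : ∀ {n : ℤ}, RawGenerator M n → ∀ j, leftCharacterObj (A.X j)
  | n, mk m k r b, j =>
    if h : ∃ χ, leftCharacterMap (A.d (j - 1) j) χ =
        Φ n (mk m k r b) (j - 1) - ∑ i, r i • contraction (b i) (j - 1) then h.choose else 0

/-- By the induction hypothesis and ∂∂b = 0, the prescribed value Φ(b) minus the contraction of ∂b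
is a cocycle. A is acyclic and ℚ/ℤ is injective, so it is a coboundary. Hence on valid generators in
the matching degree the default value 0 of `contraction` is never used. -/
lemma leftCharacterMap_contraction (hA : A.Acyclic)
    (hΦ : ∀ n j (b : RawGenerator M n), b.Valid → n = -j →
      leftCharacterMap (A.d (j - 1) j) (Φ n b j) =
        Finsupp.linearCombination R (fun b => Φ (n + 1) b (j - 1)) b.boundary)
    {n : ℤ} (b : RawGenerator M n) : b.Valid → ∀ j, n = -(j - 1) →
      leftCharacterMap (A.d (j - 1) j) (contraction A Φ b j) = Φ n b (j - 1) -
        Finsupp.linearCombination R (fun b => contraction A Φ b (j - 1)) b.boundary := by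
  induction b with
  | @mk n m k r b ih =>
    intro hb j hn
    have hsum : ∀ j, Finsupp.linearCombination R (fun b => contraction A Φ b j)
        (mk m k r b).boundary = ∑ i, r i • contraction A Φ (b i) j := fun j => by
      simp [boundary]
    have hex : ∃ χ, leftCharacterMap (A.d (j - 1) j) χ =
        Φ n (mk m k r b) (j - 1) - ∑ i, r i • contraction A Φ (b i) (j - 1) := by
      refine leftCharacterMap_exact (A.d (j - 1 - 1) (j - 1)) (A.d (j - 1) j)
        ((acyclic_iff_of_moduleCat A).1 hA _ _ _ (by omega) (by omega)) _ ?_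
      have hih := fun i => ih i (hb.1 i) (j - 1) (by omega)
      have h1 : Finsupp.linearCombination R (fun b => contraction A Φ b (j - 1 - 1))
          (boundaryMap M (n + 1) (∑ i, Finsupp.single (b i) (r i))) = 0 := by
        rw [hb.2.1, map_zero]
      rw [map_sum, map_sum] at h1
      simp only [boundaryMap, Finsupp.linearCombination_single, map_smul] at h1
      rw [map_sub, map_sum, hΦ n (j - 1) _ hb hn]
      simp only [map_smul, hih, smul_sub, Finset.sum_sub_distrib, h1, sub_zero]
      simp [boundary]
    rw [hsum, contraction, dif_pos hex]
    exact hex.choose_spec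

variable (M) in
/-- The null homotopy on the terms of the semi-free resolution. -/
noncomputable def contractionMap (n j : ℤ) : (semiFree M).X n ⟶ leftCharacterObj (A.X j) :=
  ModuleCat.ofHom (X := (Generator M n →₀ R)) (Y := (leftCharacterObj (A.X j) : Type u))
    (Finsupp.linearCombination R fun b : Generator M n => contraction A Φ b.1 j)

lemma contractionMap_d (n n' j : ℤ) (h : n + 1 = n') (b : Generator M n) :
    contractionMap M A Φ n' j
      ((semiFree M).d n n' (Finsupp.single b 1 : Generator M n →₀ R)) =
        Finsupp.linearCombination R (fun b => contraction A Φ b j) b.1.boundary := by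
  subst h
  rw [semiFree_d]
  change Finsupp.linearCombination R (fun b : Generator M (n + 1) => contraction A Φ b.1 j)
    (semiFreeD M n (Finsupp.single b 1)) = _
  rw [← b.toRaw_boundary, semiFreeD, Finsupp.linearCombination_single, one_smul]
  refine Eq.symm ((Finsupp.linearCombination_mapDomain R
    (v' := fun b : RawGenerator M (n + 1) => contraction A Φ b j) Subtype.val _).trans rfl)

end NullHomotopy

/-! ### Every complex has a semi-flat resolution. -/

section SemiFlatResolution

open RawGenerator

variable {R : Type u} [Ring R] {M : RComplex R}

-- A map from A to the character complex is the same as compatible maps from the free terms to the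
-- left character modules of A. Since every generator is a well-founded tree, a null homotopy can be
-- chosen generator by generator although the complex is unbounded.
open Classical in
lemma isKInjective_characterComplex_semiFree : (characterComplex (semiFree M)).IsKInjective := by
  refine ⟨fun {A} φ hA => ?_⟩
  -- The recursion runs over all raw generators and all pairs of degrees, so φ is extended by 0
  -- where it has no meaning.
  let Φ : ∀ n, RawGenerator M n → ∀ j, leftCharacterObj (A.X j) := fun n b j =>
    if h : b.Valid ∧ n = -j then
      swapComponent φ n j h.2 (Finsupp.single ⟨b, h.1⟩ 1 : Generator M n →₀ R) else 0
  have hΦ : ∀ n j (h : n = -j) (b : Generator M n),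
      Φ n b.1 j = swapComponent φ n j h (Finsupp.single b 1 : Generator M n →₀ R) :=
    fun n j h b => dif_pos ⟨b.2, h⟩
  have hΦ' : ∀ n j (h : n = -j) (x : Generator M n →₀ R),
      Finsupp.linearCombination R (fun b => Φ n b j) (Generator.toRaw M n x) =
        swapComponent φ n j h x := fun n j h x => by
    have : Finsupp.linearCombination R (fun b => Φ n b j) ∘ₗ Generator.toRaw M n =
        (swapComponent φ n j h).hom := by
      refine Finsupp.lhom_ext' fun b => LinearMap.ext_ring ?_
      change Finsupp.linearCombination R (fun b => Φ n b j)
        (Generator.toRaw M n (Finsupp.single b 1)) = _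
      rw [Generator.toRaw_single, Finsupp.linearCombination_single, one_smul, hΦ n j h]
      rfl
    exact LinearMap.congr_fun this x
  have key := fun n => leftCharacterMap_contraction A Φ hA (n := n) (fun n j b hb hn => by
    rw [hΦ n j hn ⟨b, hb⟩, ← Generator.toRaw_boundary ⟨b, hb⟩, hΦ' (n + 1) (j - 1) (by omega)]
    have := ConcreteCategory.congr_hom (swapComponent_comm φ n (n + 1) (j - 1) j hn (by omega))
      (Finsupp.single ⟨b, hb⟩ 1 : Generator M n →₀ R)
    rw [semiFree_d] at this
    refine Eq.trans this (congrArg (swapComponent φ (n + 1) (j - 1) _) ?_)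
    change semiFreeD M n (Finsupp.single ⟨b, hb⟩ 1) = _
    rw [semiFreeD, Finsupp.linearCombination_single, one_smul])
  refine nonempty_homotopy_zero_of_components φ (fun i j =>
    (characterSwap (A.X j) ((semiFree M).X (-i))).symm (contractionMap M A Φ (-i) j)) ?_
  intro i j k hij hjk
  obtain rfl : j = k - 1 := by omega
  apply (characterSwap _ _).injective
  change _ = contractionMap M A Φ (-(k - 1)) k ≫ leftCharacterMap (A.d (k - 1) k) +
    (semiFree M).d (-(k - 1)) (-i) ≫ contractionMap M A Φ (-i) (k - 1)
  refine ModuleCat.hom_ext (Finsupp.lhom_ext' fun b => LinearMap.ext_ring ?_)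
  have h1 := key (-(k - 1)) b.1 b.2 k rfl
  rw [← contractionMap_d A Φ (-(k - 1)) (-i) (k - 1) (by omega) b, hΦ _ _ rfl,
    swapComponent_self, eq_sub_iff_add_eq] at h1
  refine Eq.trans h1.symm (congrArg₂ (· + ·) ?_ rfl)
  refine congrArg (leftCharacterMap (A.d (k - 1) k)) ?_
  change _ = Finsupp.linearCombination R (fun b : Generator M (-(k - 1)) => contraction A Φ b.1 k)
    (Finsupp.single b 1)
  rw [Finsupp.linearCombination_single, one_smul]

lemma exists_semiFlat (M : RComplex R) : ∃ F : RComplex R, SemiFlat F ∧ DerivedIso F M := by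
  refine ⟨semiFree M, ?_, semiFree M, 𝟙 _, semiFreeπ M, inferInstance, quasiIso_semiFreeπ⟩
  rw [semiFlat_iff, semiInjective_iff]
  exact ⟨(isFlat_iff_injective_characterComplex _).1
    fun n => isFlat_of_projective (projective_semiFree n), isKInjective_characterComplex_semiFree⟩

end SemiFlatResolution

end GorensteinDim

namespace GorensteinDim

/-! ### Coherence: uniform solutions of linear relations. -/

section Coherent

variable {R : Type u} [Ring R]

variable (R) in
/-- A choice of finite generating families for the right modules of relations
`{s | ∑ rᵢ sᵢ = 0}`, for all finite families `r`. -/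
structure RelationData where
  /-- The number of generators. -/
  card : ∀ {n : ℕ}, (Fin n → R) → ℕ
  /-- The generators. -/
  gen : ∀ {n : ℕ} (r : Fin n → R), Fin (card r) → Fin n → R
  sum_mul_gen : ∀ {n : ℕ} (r : Fin n → R) (j : Fin (card r)), ∑ i, r i * gen r j i = 0
  exists_eq : ∀ {n : ℕ} (r s : Fin n → R), ∑ i, r i * s i = 0 →
    ∃ c : Fin (card r) → R, ∀ i, s i = ∑ j, gen r j i * c j

/-- The right ideal generated by the family r is finitely presented, so the kernel of the map from
the free module onto it is finitely generated. -/
lemma nonempty_relationData (hR : IsRightCoherent R) : Nonempty (RelationData R) := by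
  have key : ∀ (n : ℕ) (r : Fin n → R), ∃ (m : ℕ) (a : Fin m → Fin n → R),
      (∀ j, ∑ i, r i * a j i = 0) ∧ ∀ s : Fin n → R, ∑ i, r i * s i = 0 →
        ∃ c : Fin m → R, ∀ i, s i = ∑ j, a j i * c j := by
    intro n r
    let l : (Fin n → Rᵐᵒᵖ) →ₗ[Rᵐᵒᵖ] Rᵐᵒᵖ :=
      Fintype.linearCombination Rᵐᵒᵖ fun i => MulOpposite.op (r i)
    have hl : ∀ t, l t = MulOpposite.op (∑ i, r i * (t i).unop) := fun t => by
      rw [Fintype.linearCombination_apply, Finset.op_sum]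
      rfl
    have := hR (LinearMap.range l) (Module.Finite.iff_fg.1 (Module.Finite.range l))
    obtain ⟨m, a, ha⟩ := Submodule.fg_iff_exists_fin_generating_family.1
      (Module.FinitePresentation.fg_ker l.rangeRestrict l.surjective_rangeRestrict)
    rw [LinearMap.ker_rangeRestrict] at ha
    refine ⟨m, fun j i => (a j i).unop, fun j => ?_, fun s hs => ?_⟩
    · have : a j ∈ LinearMap.ker l := ha.le (Submodule.subset_span ⟨j, rfl⟩)
      rw [LinearMap.mem_ker, hl] at this
      exact MulOpposite.op_injective this
    · have : (fun i => MulOpposite.op (s i)) ∈ LinearMap.ker l := by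
        rw [LinearMap.mem_ker, hl]
        exact congrArg MulOpposite.op hs
      rw [← ha, Submodule.mem_span_range_iff_exists_fun] at this
      obtain ⟨c, hc⟩ := this
      refine ⟨fun j => (c j).unop, fun i => ?_⟩
      have h1 := congrArg MulOpposite.unop (congrFun hc i)
      rw [Finset.sum_apply, Finset.unop_sum] at h1
      exact h1.symm
  choose m a h1 h2 using key
  exact ⟨⟨fun {n} r => m n r, fun {n} r => a n r, fun {n} r => h1 n r, fun {n} r => h2 n r⟩⟩

/-- Every relation `∑ rᵢ φᵢ = 0` in `Φ` is a consequence of the chosen relations in `R`. -/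
def SolvesRelations (D : RelationData R) (Φ : Type u) [AddCommGroup Φ] [Module R Φ] : Prop :=
  ∀ (n : ℕ) (r : Fin n → R) (φ : Fin n → Φ), ∑ i, r i • φ i = 0 →
    ∃ ψ : Fin (D.card r) → Φ, ∀ i, φ i = ∑ j, D.gen r j i • ψ j

variable (D : RelationData R)

/-- The number of solutions ψ depends on r only, so solutions chosen in each factor assemble to a
solution in the product. Thus products cause no loss of flatness over a coherent ring. -/
lemma SolvesRelations.pi {ι : Type u} (Φ : ι → Type u) [∀ k, AddCommGroup (Φ k)]
    [∀ k, Module R (Φ k)] (h : ∀ k, SolvesRelations D (Φ k)) : SolvesRelations D (∀ k, Φ k) := by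
  intro n r φ hφ
  choose ψ hψ using fun k => h k n r (fun i => φ i k) (by simpa using congrFun hφ k)
  refine ⟨fun j k => ψ k j, fun i => funext fun k => ?_⟩
  rw [hψ k i]
  simp

lemma toCharacter_sum {ι : Type*} {X : ModuleCat.{u} R} (s : Finset ι) (v : ι → characterObj X)
    (x : X) : toCharacter (∑ i ∈ s, v i) x = ∑ i ∈ s, toCharacter (v i) x := by
  induction s using Finset.cons_induction with
  | empty => rfl
  | cons a s ha ih => rw [Finset.sum_cons, Finset.sum_cons, ← ih]; rfl

lemma leftToCharacter_sum {ι : Type*} {X : ModuleCat.{u} Rᵐᵒᵖ} (s : Finset ι)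
    (v : ι → leftCharacterObj X) (x : X) :
    leftToCharacter (∑ i ∈ s, v i) x = ∑ i ∈ s, leftToCharacter (v i) x := by
  induction s using Finset.cons_induction with
  | empty => rfl
  | cons a s ha ih => rw [Finset.sum_cons, Finset.sum_cons, ← ih]; rfl

/-- Baer's criterion for Φ⁺: a map f : I → Φ⁺ is a character χ of a direct sum of copies of Φ
indexed by I, and extending f means factoring χ through (φ_x) ↦ ∑ x φ_x. On the kernel of this map
the solved relations rewrite χ as values of f at ∑ xᵢ gᵢ = 0. -/
lemma SolvesRelations.isFlat (Φ : ModuleCat.{u} R) (h : SolvesRelations D Φ) : IsFlat Φ := by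
  rw [isFlat_iff_injective_characterObj]
  refine Module.injective_object_of_injective_module Rᵐᵒᵖ (characterObj Φ)
    (inj := Module.Baer.injective fun I f => ?_)
  let g : (I →₀ Φ) →+ Φ := Finsupp.liftAddHom fun x => DistribSMul.toAddMonoidHom Φ x.1.unop
  let χ : (I →₀ Φ) →+ AddCircle (1 : ℚ) := Finsupp.liftAddHom fun x => toCharacter (f x)
  obtain ⟨ψ, hψ⟩ := exists_character_comp_eq g χ fun y hy => by
    obtain ⟨n, x, φ, rfl⟩ := exists_eq_sum_single y
    have hy' : ∑ i, (x i).1.unop • φ i = 0 := by simpa [g] using hy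
    obtain ⟨ψ, hψ⟩ := h n (fun i => (x i).1.unop) φ hy'
    have hx : ∀ j, ∑ i, MulOpposite.op (D.gen (fun i => (x i).1.unop) j i) • x i = 0 := fun j => by
      refine Subtype.ext (MulOpposite.unop_injective ?_)
      have := D.sum_mul_gen (fun i => (x i).1.unop) j
      simpa using this
    have hf : ∀ j, ∑ i, toCharacter (f (x i))
        (D.gen (fun i => (x i).1.unop) j i • ψ j) = 0 := fun j => by
      have h1 := congrArg (fun z => toCharacter (f z) (ψ j)) (hx j)
      simp only [map_sum, map_zero, toCharacter_zero] at h1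
      rw [← h1]
      rw [toCharacter_sum]
      exact Finset.sum_congr rfl fun i _ => congrArg (fun z => toCharacter z (ψ j))
        (f.map_smul (MulOpposite.op (D.gen (fun i => (x i).1.unop) j i)) (x i)).symm
    have : χ (∑ i, Finsupp.single (x i) (φ i)) = ∑ i, toCharacter (f (x i)) (φ i) := by
      simp [χ]
    rw [this]
    calc ∑ i, toCharacter (f (x i)) (φ i)
        = ∑ i, ∑ j, toCharacter (f (x i)) (D.gen (fun i => (x i).1.unop) j i • ψ j) :=
          Finset.sum_congr rfl fun i _ => by rw [hψ i, map_sum]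
      _ = 0 := by rw [Finset.sum_comm]; exact Finset.sum_eq_zero fun j _ => hf j
  refine ⟨LinearMap.toSpanSingleton Rᵐᵒᵖ (characterObj Φ) (ofCharacter ψ), fun x hx =>
    characterObj_ext fun y => ?_⟩
  have : ψ (x.unop • y) = toCharacter (f ⟨x, hx⟩) y := by
    simpa [g, χ] using hψ (Finsupp.single ⟨x, hx⟩ y)
  exact this

lemma exists_comp_eq_of_injective {S : Type u} [Ring S] {X Y J : ModuleCat.{u} S}
    (hJ : Injective J) (l : X ⟶ Y) (f : X ⟶ J) (h : ∀ x, l x = 0 → f x = 0) :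
    ∃ g : Y ⟶ J, l ≫ g = f := by
  let l' : ModuleCat.of S (X ⧸ LinearMap.ker l.hom) ⟶ Y :=
    ModuleCat.ofHom ((LinearMap.ker l.hom).liftQ l.hom le_rfl)
  have : Mono l' := (ModuleCat.mono_iff_injective _).2
    (LinearMap.ker_eq_bot.1 (Submodule.ker_liftQ_eq_bot _ _ le_rfl le_rfl))
  refine ⟨Injective.factorThru (ModuleCat.ofHom ((LinearMap.ker l.hom).liftQ f.hom h)) l', ?_⟩
  ext x
  exact ConcreteCategory.congr_hom (Injective.comp_factorThru
    (ModuleCat.ofHom ((LinearMap.ker l.hom).liftQ f.hom h)) l') (Submodule.Quotient.mk x)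

/-- Dual to an exactness property of J. If x ∈ Jⁿ is annihilated by the generating relations of r,
then eᵢ ↦ xᵢ factors through the ideal generated by r, and injectivity extends it to the ring, so xᵢ
= z rᵢ for some z. A family φ with ∑ rᵢ φᵢ = 0 therefore vanishes on such x and factors through the
generating relations. -/
lemma solvesRelations_leftCharacterObj {J : ModuleCat.{u} Rᵐᵒᵖ} (hJ : Injective J) :
    SolvesRelations D (leftCharacterObj J) := by
  intro n r φ hφ
  let χ : (Fin n → J) →+ AddCircle (1 : ℚ) :=
    ∑ i, (leftToCharacter (φ i)).comp (Pi.evalAddMonoidHom (fun _ : Fin n => (J : Type u)) i)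
  have hχ : ∀ x, χ x = ∑ i, leftToCharacter (φ i) (x i) := fun x => by
    simp [χ]
  let g : (Fin n → J) →+ (Fin (D.card r) → J) :=
    { toFun := fun x j => ∑ i, MulOpposite.op (D.gen r j i) • x i
      map_zero' := by ext; simp
      map_add' := fun x y => by ext; simp [Finset.sum_add_distrib] }
  obtain ⟨ψ, hψ⟩ := exists_character_comp_eq g χ fun x hx => by
    let l : ModuleCat.of Rᵐᵒᵖ (Fin n → Rᵐᵒᵖ) ⟶ ModuleCat.of Rᵐᵒᵖ Rᵐᵒᵖ :=
      ModuleCat.ofHom (Fintype.linearCombination Rᵐᵒᵖ fun i => MulOpposite.op (r i))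
    let f : ModuleCat.of Rᵐᵒᵖ (Fin n → Rᵐᵒᵖ) ⟶ J :=
      ModuleCat.ofHom (Fintype.linearCombination Rᵐᵒᵖ x)
    obtain ⟨k, hk⟩ := exists_comp_eq_of_injective hJ l f fun t ht => by
      have ht' : ∑ i, r i * (t i).unop = 0 := by
        have : ∑ i, t i • MulOpposite.op (r i) = 0 := ht
        have := congrArg MulOpposite.unop this
        rw [Finset.unop_sum] at this
        exact this
      obtain ⟨c, hc⟩ := D.exists_eq r (fun i => (t i).unop) ht'
      have ht : ∀ i, t i = ∑ j, MulOpposite.op (c j) * MulOpposite.op (D.gen r j i) := fun i => by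
        refine MulOpposite.unop_injective ((hc i).trans ?_)
        rw [Finset.unop_sum]
        rfl
      change ∑ i, t i • x i = 0
      calc ∑ i, t i • x i
          = ∑ i, ∑ j, MulOpposite.op (c j) • MulOpposite.op (D.gen r j i) • x i :=
            Finset.sum_congr rfl fun i _ => by
              rw [ht i, Finset.sum_smul]
              exact Finset.sum_congr rfl fun j _ => mul_smul _ _ _
        _ = ∑ j, MulOpposite.op (c j) • g x j := by
            rw [Finset.sum_comm]
            exact Finset.sum_congr rfl fun j _ => (Finset.smul_sum).symm
        _ = 0 := by
            rw [hx]
            simp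
    have hx' : ∀ i, x i = MulOpposite.op (r i) • k (1 : Rᵐᵒᵖ) := fun i => by
      have := ConcreteCategory.congr_hom hk (Pi.single i 1 : Fin n → Rᵐᵒᵖ)
      have h1 : f (Pi.single i 1 : Fin n → Rᵐᵒᵖ) = x i := by
        change Fintype.linearCombination Rᵐᵒᵖ x (Pi.single i 1) = x i
        simp
      have h2 : l (Pi.single i 1 : Fin n → Rᵐᵒᵖ) = MulOpposite.op (r i) • (1 : Rᵐᵒᵖ) := by
        change Fintype.linearCombination Rᵐᵒᵖ _ (Pi.single i 1) = _
        simp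
      rw [h1, ModuleCat.comp_apply, h2] at this
      rw [← this]
      exact k.hom.map_smul _ _
    have := congrArg (fun z => leftToCharacter z (k (1 : Rᵐᵒᵖ))) hφ
    rw [hχ, ← show _ = (0 : AddCircle (1 : ℚ)) from this]
    dsimp only
    rw [leftToCharacter_sum]
    exact Finset.sum_congr rfl fun i _ => by rw [hx' i]; rfl
  refine ⟨fun j => leftOfCharacter (ψ.comp (AddMonoidHom.single (fun _ => (J : Type u)) j)),
    fun i => leftCharacterObj_ext fun x => ?_⟩
  have h1 := hψ (Pi.single i x)
  have h2 : χ (Pi.single i x) = leftToCharacter (φ i) x := by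
    rw [hχ, Finset.sum_eq_single i (fun k _ hk => by rw [Pi.single_eq_of_ne hk, map_zero])
      (fun h => absurd (Finset.mem_univ i) h), Pi.single_eq_same]
  have h3 : g (Pi.single i x) =
      ∑ j, Pi.single j (MulOpposite.op (D.gen r j i) • x) := by
    rw [Finset.univ_sum_single]
    funext j
    change ∑ k, MulOpposite.op (D.gen r j k) • (Pi.single i x : Fin n → J) k = _
    rw [Finset.sum_eq_single i (fun k _ hk => by rw [Pi.single_eq_of_ne hk, smul_zero])
      (fun h => absurd (Finset.mem_univ i) h), Pi.single_eq_same]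
  rw [← h2, ← h1, h3, map_sum, leftToCharacter_sum]
  rfl

end Coherent

end GorensteinDim

namespace GorensteinDim

/-! ### Flat preenvelopes from formal solutions of relations. -/

section Preenvelope

variable {R : Type u} [Ring R] (D : RelationData R)

/-- Formal expressions in elements of `X`, the module operations, and solutions of relations. -/
inductive SkolemTerm (X : Type u) : Type u
  | base (x : X) : SkolemTerm X
  | add (s t : SkolemTerm X) : SkolemTerm X
  | smul (r : R) (t : SkolemTerm X) : SkolemTerm X
  | solve {n : ℕ} (r : Fin n → R) (t : Fin n → SkolemTerm X) (j : Fin (D.card r)) : SkolemTerm X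

variable {D} {X Φ : Type u} [AddCommGroup X] [Module R X] [AddCommGroup Φ] [Module R Φ]

open Classical in
/-- The value of a formal expression in a module that solves relations. -/
noncomputable def SkolemTerm.eval (hΦ : SolvesRelations D Φ) (f : X →ₗ[R] Φ) : SkolemTerm D X → Φ
  | base x => f x
  | add s t => eval hΦ f s + eval hΦ f t
  | smul r t => r • eval hΦ f t
  | solve r t j => if h : ∑ i, r i • eval hΦ f (t i) = 0 then
      (hΦ _ r (fun i => eval hΦ f (t i)) h).choose j else 0

lemma SkolemTerm.eval_solve (hΦ : SolvesRelations D Φ) (f : X →ₗ[R] Φ) {n : ℕ} (r : Fin n → R)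
    (t : Fin n → SkolemTerm D X) (h : ∑ i, r i • eval hΦ f (t i) = 0) (i : Fin n) :
    eval hΦ f (t i) = ∑ j, D.gen r j i • eval hΦ f (solve r t j) := by
  have h1 : ∀ j, eval hΦ f (solve r t j) = (hΦ _ r (fun i => eval hΦ f (t i)) h).choose j :=
    fun j => by rw [eval, dif_pos h]
  simp only [h1]
  exact (hΦ _ r (fun i => eval hΦ f (t i)) h).choose_spec i

/-- Thanks to the constructors `add` and `smul`, the values of terms already form a submodule, so
the operation `solve` is available on the whole image of the free module. -/
lemma SkolemTerm.exists_eval_eq (hΦ : SolvesRelations D Φ) (f : X →ₗ[R] Φ)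
    (x : SkolemTerm D X →₀ R) :
    ∃ t, eval hΦ f t = Finsupp.linearCombination R (eval hΦ f) x := by
  induction x using Finsupp.induction_linear with
  | zero => exact ⟨base 0, by rw [eval, map_zero, map_zero]⟩
  | add x y hx hy =>
    obtain ⟨s, hs⟩ := hx
    obtain ⟨t, ht⟩ := hy
    exact ⟨add s t, by rw [eval, hs, ht, map_add]⟩
  | single t r => exact ⟨smul r t, by rw [eval, Finsupp.linearCombination_single]⟩

variable (D) in
/-- The quotients of the module of formal expressions that solve relations, together with a
homomorphism from `X`. -/
abbrev PreenvelopeIndex (X : Type u) [AddCommGroup X] [Module R X] : Type u :=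
  {p : (N : Submodule R (SkolemTerm D X →₀ R)) × (X →ₗ[R] (SkolemTerm D X →₀ R) ⧸ N) //
    SolvesRelations D ((SkolemTerm D X →₀ R) ⧸ p.1)}

/-- The quotient that belongs to an index. -/
noncomputable def PreenvelopeIndex.obj {X : Type u} [AddCommGroup X] [Module R X]
    (p : PreenvelopeIndex D X) : ModuleCat.{u} R :=
  ModuleCat.of R ((SkolemTerm D X →₀ R) ⧸ p.1.1)

variable (D) in
/-- A flat preenvelope of `X`. -/
noncomputable def preenvelope (X : ModuleCat.{u} R) : ModuleCat.{u} R :=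
  ModuleCat.of R (∀ p : PreenvelopeIndex D X, p.obj)

variable (D) in
/-- The homomorphism from `X` to its flat preenvelope. -/
noncomputable def toPreenvelope (X : ModuleCat.{u} R) : X ⟶ preenvelope D X :=
  ModuleCat.ofHom (X := (X : Type u)) (Y := ∀ p : PreenvelopeIndex D X, p.obj)
    (LinearMap.pi fun p : PreenvelopeIndex D X => (p.1.2 : X →ₗ[R] p.obj))

lemma isFlat_preenvelope (X : ModuleCat.{u} R) : IsFlat (preenvelope D X) :=
  SolvesRelations.isFlat D _ (SolvesRelations.pi D (fun p : PreenvelopeIndex D X => p.obj) fun p : PreenvelopeIndex D X => p.2)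

/-- The values of terms form a submodule of Φ that contains f(X) and is closed under solving
relations. It is a quotient of one fixed free module, hence occurs among the factors of the product;
this bounds the size of the index type. -/
lemma exists_toPreenvelope_comp_eq {X Φ : ModuleCat.{u} R} (hΦ : SolvesRelations D Φ)
    (f : X ⟶ Φ) : ∃ g : preenvelope D X ⟶ Φ, toPreenvelope D X ≫ g = f := by
  let L := Finsupp.linearCombination R (SkolemTerm.eval hΦ f.hom)
  let ι : ((SkolemTerm D X →₀ R) ⧸ LinearMap.ker L) →ₗ[R] Φ := (LinearMap.ker L).liftQ L le_rfl
  have hι : Function.Injective ι :=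
    LinearMap.ker_eq_bot.1 (Submodule.ker_liftQ_eq_bot _ _ le_rfl le_rfl)
  have hmem : ∀ t, ∃ q, ι q = SkolemTerm.eval hΦ f.hom t := fun t =>
    ⟨Submodule.Quotient.mk (Finsupp.single t 1), by
      change L (Finsupp.single t 1) = _
      simp [L]⟩
  have hmem' : ∀ q, ∃ t, SkolemTerm.eval hΦ f.hom t = ι q := fun q => by
    obtain ⟨x, rfl⟩ := Submodule.Quotient.mk_surjective _ q
    exact SkolemTerm.exists_eval_eq hΦ f.hom x
  have hsol : SolvesRelations D ((SkolemTerm D X →₀ R) ⧸ LinearMap.ker L) := by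
    intro n r φ hφ
    choose t ht using fun i => hmem' (φ i)
    choose q hq using fun j => hmem (SkolemTerm.solve r t j)
    refine ⟨q, fun i => hι ?_⟩
    rw [← ht, SkolemTerm.eval_solve hΦ f.hom r t ?_ i, map_sum]
    · simp only [map_smul, hq]
    · simp only [ht, ← map_smul, ← map_sum, hφ, map_zero]
  let f' : X →ₗ[R] (SkolemTerm D X →₀ R) ⧸ LinearMap.ker L :=
    (LinearEquiv.ofInjective ι hι).symm.toLinearMap ∘ₗ
      f.hom.codRestrict (LinearMap.range ι) fun x => hmem (.base x)
  let p : PreenvelopeIndex D X := ⟨⟨LinearMap.ker L, f'⟩, hsol⟩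
  refine ⟨ModuleCat.ofHom (X := ∀ p : PreenvelopeIndex D X, p.obj) (Y := (Φ : Type u))
    ((ι : p.obj →ₗ[R] Φ) ∘ₗ LinearMap.proj p), ?_⟩
  ext x
  change ι (f' x) = f x
  exact congrArg Subtype.val ((LinearEquiv.ofInjective ι hι).apply_symm_apply
    (f.hom.codRestrict (LinearMap.range ι) (fun x => hmem (.base x)) x))

variable (D) in
/-- A homomorphism `d : A → B` is followed by `B → B / d(A) → E`, where `E` is a flat preenvelope
of the cokernel. -/
noncomputable def cokernelPreenvelope {A B : ModuleCat.{u} R} (d : A ⟶ B) :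
    B ⟶ preenvelope D (ModuleCat.of R (B ⧸ LinearMap.range d.hom)) :=
  ModuleCat.ofHom (LinearMap.range d.hom).mkQ ≫ toPreenvelope D _

lemma comp_cokernelPreenvelope {A B : ModuleCat.{u} R} (d : A ⟶ B) :
    d ≫ cokernelPreenvelope D d = 0 := by
  rw [cokernelPreenvelope, ← Category.assoc]
  have : d ≫ ModuleCat.ofHom (LinearMap.range d.hom).mkQ = 0 := by
    ext x
    exact (Submodule.Quotient.mk_eq_zero _).2 ⟨x, rfl⟩
  rw [this, Limits.zero_comp]

lemma exists_cokernelPreenvelope_comp_eq {A B Φ : ModuleCat.{u} R} (hΦ : SolvesRelations D Φ)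
    (d : A ⟶ B) (f : B ⟶ Φ) (h : d ≫ f = 0) : ∃ g, cokernelPreenvelope D d ≫ g = f := by
  obtain ⟨g, hg⟩ := exists_toPreenvelope_comp_eq hΦ
    (X := ModuleCat.of R (B ⧸ LinearMap.range d.hom))
    (ModuleCat.ofHom ((LinearMap.range d.hom).liftQ f.hom (by
      rintro _ ⟨x, rfl⟩
      exact ConcreteCategory.congr_hom h x)))
  refine ⟨g, ?_⟩
  rw [cokernelPreenvelope, Category.assoc, hg]
  rfl

end Preenvelope

/-! ### Replacing the upper cohomological part of a flat complex. -/

section Glue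

variable {R : Type u} [Ring R]

/-- The translation of a complex, without signs. -/
def translate (K : RComplex R) (k : ℤ) : RComplex R where
  X i := K.X (i + k)
  d i j := K.d (i + k) (j + k)
  shape i j hij := K.shape _ _ (by simp only [ComplexShape.up_Rel] at hij ⊢; omega)
  d_comp_d' _ _ _ _ _ := K.d_comp_d _ _ _

variable (D : RelationData R) (F : RComplex R)

/-- The differential `F⁻¹ → F⁰` and its continuation by flat preenvelopes of cokernels. -/
noncomputable def continuation : ℕ → Arrow (ModuleCat.{u} R)
  | 0 => Arrow.mk (F.d (-1) 0)
  | n + 1 => Arrow.mk (cokernelPreenvelope D (continuation n).hom)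

lemma isFlat_continuation (hF : IsFlat (F.X 0)) : ∀ n, IsFlat (continuation D F n).right
  | 0 => hF
  | _ + 1 => isFlat_preenvelope _

/-- The terms of the complex obtained from `F` by replacing the part in positive degrees. -/
noncomputable def glueX : ℤ → ModuleCat.{u} R
  | .ofNat n => (continuation D F n).right
  | .negSucc n => F.X (.negSucc n)

/-- The differentials of the complex obtained from `F` by replacing the part in positive
degrees. -/
noncomputable def glueD : ∀ n : ℤ, glueX D F n ⟶ glueX D F (n + 1)
  | .ofNat n => (continuation D F (n + 1)).hom
  | .negSucc 0 => (continuation D F 0).hom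
  | .negSucc (n + 1) => F.d (.negSucc (n + 1)) (.negSucc n)

lemma glueD_comp : ∀ n : ℤ, glueD D F n ≫ glueD D F (n + 1) = 0
  | .ofNat n => comp_cokernelPreenvelope (continuation D F (n + 1)).hom
  | .negSucc 0 => comp_cokernelPreenvelope (continuation D F 0).hom
  | .negSucc 1 => F.d_comp_d _ _ _
  | .negSucc (_ + 2) => F.d_comp_d _ _ _

/-- The complex obtained from `F` by replacing the part in positive degrees. -/
noncomputable def glue : RComplex R := CochainComplex.of (glueX D F) (glueD D F) (glueD_comp D F)

lemma glue_d (n : ℤ) : (glue D F).d n (n + 1) = glueD D F n :=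
  CochainComplex.of_d (glueX D F) (glueD D F) n

lemma isFlat_glue (hF : ∀ i, IsFlat (F.X i)) : ∀ i, IsFlat ((glue D F).X i)
  | .ofNat n => isFlat_continuation D F (hF 0) n
  | .negSucc _ => hF _

/-- The case i = -1 is included: the first preenvelope is that of the cokernel of F⁻¹ → F⁰, so the
extension property holds already in degree 0, the last degree kept from F. -/
lemma exists_glueD_comp_eq {Φ : ModuleCat.{u} R} (hΦ : SolvesRelations D Φ) : ∀ i : ℤ,
    0 ≤ i + 1 → ∀ f : glueX D F (i + 1) ⟶ Φ, glueD D F i ≫ f = 0 →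
      ∃ g, glueD D F (i + 1) ≫ g = f
  | .ofNat n, _, f, hf => exists_cokernelPreenvelope_comp_eq hΦ (continuation D F (n + 1)).hom f hf
  | .negSucc 0, _, f, hf => exists_cokernelPreenvelope_comp_eq hΦ (continuation D F 0).hom f hf
  | .negSucc (n + 1), h, _, _ => by omega

lemma exists_glue_d_comp_eq {Φ : ModuleCat.{u} R} (hΦ : SolvesRelations D Φ) (i j k : ℤ)
    (hij : i + 1 = j) (hjk : j + 1 = k) (hj : 0 ≤ j) (f : (glue D F).X j ⟶ Φ)
    (hf : (glue D F).d i j ≫ f = 0) : ∃ g, (glue D F).d j k ≫ g = f := by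
  subst hij hjk
  rw [glue_d] at hf ⊢
  exact exists_glueD_comp_eq D F hΦ i hj f hf

/-- The terms of `glue D F` in non-positive degrees are those of `F`. -/
noncomputable def glueXIso : ∀ i : ℤ, i ≤ 0 → ((glue D F).X i ≅ F.X i)
  | .ofNat 0, _ => Iso.refl _
  | .ofNat (n + 1), h => absurd h (not_le.2 (Int.natCast_pos.2 n.succ_pos))
  | .negSucc _, _ => Iso.refl _

lemma glueXIso_hom_comp_d : ∀ (i j : ℤ) (hi : i ≤ 0) (hj : j ≤ 0), i + 1 = j →
    (glueXIso D F i hi).hom ≫ F.d i j = (glue D F).d i j ≫ (glueXIso D F j hj).hom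
  | .ofNat 0, _, _, hj, rfl => absurd hj (by decide)
  | .ofNat (n + 1), _, h, _, _ => absurd h (not_le.2 (Int.natCast_pos.2 n.succ_pos))
  | .negSucc 0, _, hi, hj, rfl => by
    rw [glue_d]
    exact (Category.id_comp _).trans (Category.comp_id _).symm
  | .negSucc (n + 1), _, hi, hj, rfl => by
    rw [glue_d]
    exact (Category.id_comp _).trans (Category.comp_id _).symm

/-- A complex of flat modules can be changed in degrees above `a` so that homomorphisms to modules
that solve relations extend along the new differentials. -/
lemma exists_glue (hF : ∀ i, IsFlat (F.X i)) (a : ℤ) :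
    ∃ T : RComplex R, (∀ i, IsFlat (T.X i)) ∧
      (∀ Φ : ModuleCat.{u} R, SolvesRelations D Φ → ∀ i j k, i + 1 = j → j + 1 = k → a ≤ j →
        ∀ f : T.X j ⟶ Φ, T.d i j ≫ f = 0 → ∃ g, T.d j k ≫ g = f) ∧
      ∃ e : ∀ j : ℤ, j ≤ a → (T.X j ≅ F.X j), ∀ i j (hi : i ≤ a) (hj : j ≤ a), i + 1 = j →
        (e i hi).hom ≫ F.d i j = T.d i j ≫ (e j hj).hom := by
  refine ⟨translate (glue D (translate F a)) (-a), fun i =>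
      isFlat_glue D (translate F a) (fun i => hF (i + a)) (i + -a),
    fun Φ hΦ i j k hij hjk hj f hf => exists_glue_d_comp_eq D (translate F a) hΦ (i + -a) (j + -a)
      (k + -a) (by omega) (by omega) (by omega) f hf,
    fun j hj => glueXIso D (translate F a) (j + -a) (by omega) ≪≫
      F.XIsoOfEq (show j + -a + a = j by omega),
    fun i j hi hj hij => ?_⟩
  have h : (glueXIso D (translate F a) (i + -a) (by omega)).hom ≫ F.d (i + -a + a) (j + -a + a) =
      (glue D (translate F a)).d (i + -a) (j + -a) ≫
        (glueXIso D (translate F a) (j + -a) (by omega)).hom :=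
    glueXIso_hom_comp_d D (translate F a) (i + -a) (j + -a) (by omega) (by omega) (by omega)
  have h1 := F.XIsoOfEq_hom_comp_d (show i + -a + a = i by omega) j
  have h2 := F.d_comp_XIsoOfEq_hom (show j + -a + a = j by omega) (i + -a + a)
  refine (Category.assoc _ _ _).trans ((congrArg (fun z =>
    (glueXIso D (translate F a) (i + -a) (by omega)).hom ≫ z) (h1.trans h2.symm)).trans ?_)
  exact (Category.assoc _ _ _).symm.trans
    ((congrArg (fun z => z ≫ (F.XIsoOfEq (show j + -a + a = j by omega)).hom) h).trans
      (Category.assoc _ _ _))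

end Glue

end GorensteinDim

namespace GorensteinDim

/-! ### Acyclicity by comparison with a totally acyclic complex. -/

section Comparison

variable {S : Type u} [Ring S]

lemma exists_hom_extending (A B : RComplex S) (g : ℤ) (f : ∀ i, g ≤ i → (A.X i ⟶ B.X i))
    (hf : ∀ i j (hi : g ≤ i) (hj : g ≤ j), i + 1 = j → f i hi ≫ B.d i j = A.d i j ≫ f j hj)
    (hB : ∀ i j k, i + 1 = j → j + 1 = k → HomExactAt (A.X i) B i j k) :
    ∃ φ : A ⟶ B, ∀ i hi, φ.f i = f i hi := by
  obtain ⟨φ, hφ⟩ := exists_hom_of_homExactAt A B g (fun i => if h : g ≤ i then f i h else 0)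
    (fun i j hi hij => by
      have hj : g ≤ j := by omega
      rw [dif_pos hi, dif_pos hj, hf i j hi hj hij]) (fun i j k _ => hB i j k)
  exact ⟨φ, fun i hi => (hφ i hi).trans (dif_pos hi)⟩

/-- If d W = d s d, then W - d s is a cocycle in Hom(V^(i+1), V), so W = d s + y d; composing with
the preceding differential gives the same hypothesis one degree lower, with y for s. The maps s and
y of neighbouring degrees need not fit into a homotopy, but W still kills cohomology. -/
lemma exists_factorization_below {V : RComplex S} (hV : ∀ i, Injective (V.X i))
    (hVJ : ∀ J : ModuleCat.{u} S, Injective J → ∀ i j k, i + 1 = j → j + 1 = k →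
      HomExactAt J V i j k) (W : V ⟶ V) (g : ℤ)
    (h : ∀ i, g ≤ i → ∃ s : V.X (i + 1) ⟶ V.X i,
      V.d i (i + 1) ≫ W.f (i + 1) = V.d i (i + 1) ≫ s ≫ V.d i (i + 1)) (i : ℤ) :
    ∃ (s : V.X (i + 1 + 1) ⟶ V.X (i + 1)) (y : V.X (i + 1) ⟶ V.X i),
      W.f (i + 1) = V.d (i + 1) (i + 1 + 1) ≫ s + y ≫ V.d i (i + 1) := by
  have step : ∀ (i : ℤ) (s : V.X (i + 1 + 1) ⟶ V.X (i + 1)),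
      V.d (i + 1) (i + 1 + 1) ≫ W.f (i + 1 + 1) =
        V.d (i + 1) (i + 1 + 1) ≫ s ≫ V.d (i + 1) (i + 1 + 1) →
      ∃ y : V.X (i + 1) ⟶ V.X i,
        W.f (i + 1) = V.d (i + 1) (i + 1 + 1) ≫ s + y ≫ V.d i (i + 1) := by
    intro i s hs
    obtain ⟨y, hy⟩ := hVJ (V.X (i + 1)) (hV _) i (i + 1) (i + 1 + 1) rfl rfl
      (W.f (i + 1) - V.d _ _ ≫ s) (by
        rw [Preadditive.sub_comp, W.comm, hs, Category.assoc, sub_self])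
    exact ⟨y, by rw [hy, add_sub_cancel]⟩
  have all : ∀ (n : ℕ) (i : ℤ), g ≤ i + n → ∃ s : V.X (i + 1) ⟶ V.X i,
      V.d i (i + 1) ≫ W.f (i + 1) = V.d i (i + 1) ≫ s ≫ V.d i (i + 1) := by
    intro n
    induction n with
    | zero => exact fun i hi => h i (by simpa using hi)
    | succ n ih =>
      intro i hi
      obtain ⟨s, hs⟩ := ih (i + 1) (by push_cast at hi; omega)
      obtain ⟨y, hy⟩ := step i s hs
      refine ⟨y, ?_⟩
      rw [hy, Preadditive.comp_add, ← Category.assoc, V.d_comp_d, Limits.zero_comp, zero_add]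
  obtain ⟨s, hs⟩ := all (g - (i + 1)).toNat (i + 1) (by omega)
  obtain ⟨y, hy⟩ := step i s hs
  exact ⟨s, y, hy⟩

/-- A complex `V` of injective modules for which the complexes `Hom(J, V)` are exact is acyclic if
it agrees in high degrees, up to homotopy, with a totally acyclic complex. -/
lemma acyclic_of_homotopyEquiv {I P U V : RComplex S} (hU : TotallyAcyclicInjective U)
    (hV : ∀ i, Injective (V.X i))
    (hVJ : ∀ J : ModuleCat.{u} S, Injective J → ∀ i j k, i + 1 = j → j + 1 = k →
      HomExactAt J V i j k) (g : ℤ) (E : HomotopyEquiv P I) (υ : I ⟶ U)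
    (hυ : ∀ i, g ≤ i → IsIso (υ.f i)) (w : ∀ i, g ≤ i → (V.X i ≅ P.X i))
    (hw : ∀ i j (hi : g ≤ i) (hj : g ≤ j), i + 1 = j →
      (w i hi).hom ≫ P.d i j = V.d i j ≫ (w j hj).hom) : V.Acyclic := by
  have hw' : ∀ i j (hi : g ≤ i) (hj : g ≤ j), i + 1 = j →
      (w i hi).inv ≫ V.d i j = P.d i j ≫ (w j hj).inv := fun i j hi hj hij => by
    rw [Iso.inv_comp_eq, ← Category.assoc, hw i j hi hj hij, Category.assoc, Iso.hom_inv_id,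
      Category.comp_id]
  -- In degrees ≥ g, α is V ≅ P → I ≅ U and κ below is the reverse path. Both extend downwards by
  -- Hom-exactness against injective modules.
  obtain ⟨α, hα⟩ := exists_hom_extending V U g
    (fun i hi => (w i hi).hom ≫ E.hom.f i ≫ υ.f i)
    (fun i j hi hj hij => by
      rw [Category.assoc, Category.assoc, υ.comm, E.hom.comm_assoc, ← Category.assoc,
        hw i j hi hj hij, Category.assoc])
    (fun i j k hij hjk => hU.homExactAt _ (Or.inl (hV i)) hij hjk)
  obtain ⟨κ, hκ⟩ := exists_hom_extending U V g
    (fun i hi => (have := hυ i hi; inv (υ.f i)) ≫ E.inv.f i ≫ (w i hi).inv)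
    (fun i j hi hj hij => by
      have := hυ i hi
      have := hυ j hj
      rw [Category.assoc, Category.assoc, hw' i j hi hj hij, E.inv.comm_assoc, IsIso.inv_comp_eq,
        υ.comm_assoc, IsIso.hom_inv_id_assoc])
    (fun i j k hij hjk => hVJ _ (hU.injective i) i j k hij hjk)
  have hW : ∀ i hi, (α ≫ κ - 𝟙 V).f i = (w i hi).hom ≫ ((E.hom ≫ E.inv).f i - 𝟙 _) ≫
      (w i hi).inv := fun i hi => by
    have := hυ i hi
    rw [HomologicalComplex.sub_f_apply, HomologicalComplex.comp_f, hα i hi, hκ i hi]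
    simp
  -- From degree g on, κα - 1 comes from the homotopy for P → I → P; its component leading below g
  -- is unavailable, and composing with d removes the need for it.
  have key := exists_factorization_below hV hVJ (α ≫ κ - 𝟙 V) g fun i hi => by
    have hi' : g ≤ i + 1 := by omega
    refine ⟨(w (i + 1) hi').hom ≫ E.homotopyHomInvId.hom (i + 1) i ≫ (w i hi).inv, ?_⟩
    have h1 := homotopy_comm E.homotopyHomInvId i (i + 1) (i + 1 + 1) rfl rfl
    rw [hW (i + 1) hi', ← Category.assoc, ← hw i (i + 1) hi hi' rfl, h1,
      HomologicalComplex.id_f, add_sub_cancel_right, Category.assoc, Preadditive.add_comp,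
      Preadditive.comp_add, Category.assoc, P.d_comp_d_assoc, Limits.zero_comp, zero_add,
      Category.assoc, ← hw' i (i + 1) hi hi' rfl]
    simp only [Category.assoc]
    rw [← Category.assoc, hw i (i + 1) hi hi' rfl, Category.assoc]
  rw [acyclic_iff_of_moduleCat]
  intro i j k hij hjk x hx
  subst hij hjk
  -- For a cycle x, κα x is a boundary because U is acyclic, and κα x - x is one by the
  -- factorization.
  obtain ⟨s, y, hsy⟩ := key i
  obtain ⟨v, hv⟩ := (acyclic_iff_of_moduleCat U).1 hU.acyclic i (i + 1) (i + 1 + 1) rfl rfl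
    (α.f (i + 1) x) (by
      rw [← ModuleCat.comp_apply, α.comm, ModuleCat.comp_apply, hx, map_zero])
  have h1 : κ.f (i + 1) (α.f (i + 1) x) - x = s (V.d (i + 1) (i + 1 + 1) x) + V.d i (i + 1) (y x) :=
    ConcreteCategory.congr_hom hsy x
  have h2 : κ.f (i + 1) (U.d i (i + 1) v) = V.d i (i + 1) (κ.f i v) :=
    ConcreteCategory.congr_hom (κ.comm i (i + 1)).symm v
  rw [hx, map_zero, zero_add, ← hv, h2] at h1
  refine ⟨κ.f i v - y x, ?_⟩
  rw [map_sub, ← h1, sub_sub_cancel]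

end Comparison

/-! ### The coherent case and the theorem. -/

section Main

variable {R : Type u} [Ring R]

/-- An isomorphism of modules induces an isomorphism of character modules. -/
def characterIso {X Y : ModuleCat.{u} R} (e : X ≅ Y) : characterObj X ≅ characterObj Y where
  hom := characterMap e.inv
  inv := characterMap e.hom
  hom_inv_id := by rw [← characterMap_comp, Iso.hom_inv_id]; rfl
  inv_hom_id := by rw [← characterMap_comp, Iso.inv_hom_id]; rfl

/-- `characterSwap` identifies Hom(J, T⁺) with Hom(T, J⁺), so extension of maps from T into J⁺ along
its differentials is what Hom-exactness requires. -/
lemma homExactAt_of_exists_comp_eq {T : RComplex R} (J : ModuleCat.{u} Rᵐᵒᵖ) (i j k : ℤ)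
    (h : ∀ f : T.X (-j) ⟶ leftCharacterObj J, T.d (-k) (-j) ≫ f = 0 →
      ∃ f', T.d (-j) (-i) ≫ f' = f) : HomExactAt J (characterComplex T) i j k := by
  intro f hf
  obtain ⟨f', hf'⟩ := h (characterSwap J (T.X (-j)) f)
    (congrArg (characterSwap J (T.X (-k))) hf)
  refine ⟨(characterSwap J (T.X (-i))).symm f', ?_⟩
  apply (characterSwap J (T.X (-j))).injective
  exact hf'

lemma exists_gfd_of_gid (hR : IsRightCoherent R) {M : RComplex R} (g : ℤ)
    {I U : RComplex Rᵐᵒᵖ} (hI : SemiInjective I) (hU : TotallyAcyclicInjective U)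
    (ι : characterComplex M ⟶ I) (hι : QuasiIso ι) (υ : I ⟶ U)
    (hυ : ∀ i, g ≤ i → Function.Bijective (υ.f i)) :
    ∃ T F : RComplex R, TotallyAcyclicFlat T ∧ SemiFlat F ∧ DerivedIso F M ∧
      Nonempty (truncGE T g ≅ truncGE F g) := by
  obtain ⟨D⟩ := nonempty_relationData hR
  obtain ⟨F, hF, hFM⟩ := exists_semiFlat M
  obtain ⟨E⟩ := hF.nonempty_homotopyEquiv_of_quasiIso hFM hI ι hι
  obtain ⟨T, hT, hext, e, he⟩ := exists_glue D F hF.flat (-g)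
  have hυ' : ∀ i, g ≤ i → IsIso (υ.f i) := fun i hi =>
    (ConcreteCategory.isIso_iff_bijective _).2 (hυ i hi)
  let w : ∀ i, g ≤ i → ((characterComplex T).X i ≅ (characterComplex F).X i) := fun i hi =>
    characterIso (e (-i) (by omega))
  have hw : ∀ i j (hi : g ≤ i) (hj : g ≤ j), i + 1 = j →
      (w i hi).inv ≫ (characterComplex T).d i j = (characterComplex F).d i j ≫ (w j hj).inv :=
    fun i j hi hj hij => congrArg characterMap (he (-j) (-i) _ _ (by omega)).symm
  have hw' : ∀ i j (hi : g ≤ i) (hj : g ≤ j), i + 1 = j →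
      (w i hi).hom ≫ (characterComplex F).d i j = (characterComplex T).d i j ≫ (w j hj).hom :=
    fun i j hi hj hij => by
      rw [← Iso.eq_inv_comp, ← Category.assoc, hw i j hi hj hij, Category.assoc, Iso.inv_hom_id,
        Category.comp_id]
  have hV := (isFlat_iff_injective_characterComplex T).1 hT
  have hVJ : ∀ J : ModuleCat.{u} Rᵐᵒᵖ, Injective J → ∀ i j k, i + 1 = j → j + 1 = k →
      HomExactAt J (characterComplex T) i j k := by
    intro J hJ i j k hij hjk
    -- For i ≥ g exactness comes from U through I, F⁺ and T⁺. Otherwise the middle degree j = i + 1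
    -- is at most g, where the preenvelope construction applies; the two ranges leave no gap.
    rcases le_or_gt g i with hi | hi
    · have hj : g ≤ j := by omega
      have hk : g ≤ k := by omega
      have := hυ' i hi
      have := hυ' j hj
      have h1 : HomExactAt J I i j k := HomExactAt.of_isIso J (υ.f i) (υ.f j) (υ.f k)
        (υ.comm i j) (υ.comm j k) (hU.homExactAt J (Or.inl hJ) hij hjk)
      exact HomExactAt.of_isIso J (w i hi).hom (w j hj).hom (w k hk).hom (hw' i j hi hj hij)
        (hw' j k hj hk hjk) (HomExactAt.of_homotopyEquiv E J hij hjk h1)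
    · exact homExactAt_of_exists_comp_eq J i j k (hext _ (solvesRelations_leftCharacterObj D hJ)
        (-k) (-j) (-i) (by omega) (by omega) (by omega))
  have hacyclic := acyclic_of_homotopyEquiv hU hV hVJ g E υ hυ' w hw'
  exact ⟨T, F, (totallyAcyclicFlat_iff T).2 ⟨hV, hacyclic, fun J hJ =>
    (hom_acyclic_iff J _).2 (hVJ J hJ)⟩, hF, hFM, nonempty_truncGE_iso g e he⟩

end Main

end GorensteinDim

theorem mainTheorem7 {R : Type u} [Ring R] (M : GorensteinDim.RComplex R) :
    (GorensteinDim.gfd M ≤ GorensteinDim.fd M ∧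
      (GorensteinDim.fd M < ⊤ → GorensteinDim.gfd M = GorensteinDim.fd M)) ∧
    (GorensteinDim.gid (GorensteinDim.characterComplex M) ≤ GorensteinDim.gfd M ∧
      (GorensteinDim.IsRightCoherent R →
        GorensteinDim.gid (GorensteinDim.characterComplex M) = GorensteinDim.gfd M)) := by
  -- Everything is proved for the sets of admissible integers, as inclusions or equalities, so the
  -- infima ±∞ need no separate treatment.
  refine ⟨⟨sInf_le_sInf (Set.image_mono ?_), fun h => ?_⟩, sInf_le_sInf (Set.image_mono ?_),
    fun hR => congrArg sInf (congrArg _ (Set.Subset.antisymm ?_ ?_))⟩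
  · rintro g ⟨F, hF, hFM, h⟩
    exact GorensteinDim.exists_gfd_of_fd g hF hFM h
  · obtain ⟨n, ⟨F, hF, hFM, hFn⟩⟩ : {n : ℤ | ∃ F : GorensteinDim.RComplex R,
        GorensteinDim.SemiFlat F ∧ GorensteinDim.DerivedIso F M ∧
          ∀ i : ℤ, n < i → Subsingleton (F.X (-i))}.Nonempty := by
      rw [Set.nonempty_iff_ne_empty]
      intro hempty
      rw [GorensteinDim.fd, hempty, Set.image_empty, sInf_empty] at h
      exact lt_irrefl _ h
    refine congrArg sInf (congrArg _ (Set.Subset.antisymm ?_ ?_))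
    · rintro g ⟨T, F', hT, hF', hF'M, ⟨e⟩⟩
      exact GorensteinDim.exists_fd_of_gfd g n hF hFM hFn hT hF' hF'M e
    · rintro g ⟨F, hF, hFM, h⟩
      exact GorensteinDim.exists_gfd_of_fd g hF hFM h
  · rintro g ⟨T, F, hT, hF, hFM, ⟨e⟩⟩
    exact GorensteinDim.exists_gid_of_gfd g hT hF hFM e
  · rintro g ⟨I, U, ι, υ, hI, hι, hU, hυ⟩
    exact GorensteinDim.exists_gfd_of_gid hR g hI hU ι hι υ hυ
  · rintro g ⟨T, F, hT, hF, hFM, ⟨e⟩⟩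
    exact GorensteinDim.exists_gid_of_gfd g hT hF hFM e
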